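/- Let $K$ be an algebraically closed field of characteristic $0$ and let $\widetilde S$ be a generalized del Pezzo surface over $K$ (a non-singular projective surface whose anticanonical class is big and nef) of degree $d=(-K_{\widetilde S},-K_{\widetilde S})\le 7$. Let $D_0,\dots,D_{9-d}$ be divisors whose classes form a basis of $\operatorname{Pic}(\widetilde S)$, and let $$\operatorname{Cox}(\widetilde S)=\bigoplus_{\nu\in\mathbb Z^{10-d}}H^0\bigl(\widetilde S,\mathcal O(\nu_0D_0+\dots+\nu_{9-d}D_{9-d})\bigr).$$ Suppose that $\operatorname{Cox}(\widetilde S)$ has a minimal system of homogeneous generators $\eta_1,\dots,\eta_{13-d}$ consisting of $13-d$ elements, and that the ideal of all polynomial relations between them is generated by a single non-zero homogeneous polynomial $R\in K[X_1,\dots,X_{13-d}]$. Let $E_k$ be the effective divisor of zeros of the section $\eta_k$. Let $I\subset\{1,\dots,13-d\}$ with $\#I=9-d$, let $\rho:\widetilde S\to\mathbb P^2$ be the contraction of the curves $E_k$, $k\in I$ (i.e. each of these is mapped to a closed point, and $\rho$ is an isomorphism from the complement of their union onto an open subset of $\mathbb P^2$), and let $\ell_0$ be the class of $\rho^*\mathcal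 O_{\mathbb P^2}(1)$. (1) There are indices $i_0,\dots,i_3$ with $I\cup\{i_0,\dots,i_3\}=\{1,\dots,13-d\}$ and homogeneous coordinates $y_0,y_1,y_2$ of $\mathbb P^2$ (linearly independent linear forms) such that $\rho(E_{i_j})=\{y_j=0\}$ for $j=0,1,2$. (2) Whenever $i_0,\dots,i_3$ and $y_0,y_1,y_2$ are as in (1), one can rescale $y_0,y_1,y_2$ by non-zero constants and find a polynomial $R'\in K[Y_0,Y_1,Y_2]$, homogeneous of degree $n=(E_{i_3},\ell_0)$, such that, for the rescaled coordinates, $\rho(E_{i_3})=\{R'(y_0,y_1,y_2)=0\}$, and such that substituting $Y_j$ for $X_{i_j}$ ($j=0,\dots,3$) and $1$ for $X_k$ ($k\in I$) in the relation $R=0$ results in the equation $Y_3-R'(Y_0,Y_1,Y_2)=0$; that is, $R$ becomes $c\,\bigl(Y_3-R'(Y_0,Y_1,Y_2)\bigr)$ for some $c\in K\setminus\{0\}$. -/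

import Mathlib

open AlgebraicGeometry CategoryTheory Order

universe u

attribute [local instance] MvPolynomial.gradedAlgebra

noncomputable section

namespace DelPezzo

/-! ### Projective space -/

/-- The standard grading of `K[x₀, …, xₙ]` by degree. -/
abbrev stdGrading (K : Type u) [Field K] (n : ℕ) :
    ℕ → Submodule K (MvPolynomial (Fin (n + 1)) K) :=
  MvPolynomial.homogeneousSubmodule (Fin (n + 1)) K

/-- Projective space `ℙⁿ = Proj K[x₀, …, xₙ]`. -/
abbrev projSpace (K : Type u) [Field K] (n : ℕ) : Scheme.{u} := Proj (stdGrading K n)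

/-- The structure morphism `ℙⁿ ⟶ Spec K`. -/
def projSpaceStr (K : Type u) [Field K] (n : ℕ) : projSpace K n ⟶ Spec (.of K) :=
  Proj.toSpecZero (stdGrading K n) ≫
    Spec.map (CommRingCat.ofHom (algebraMap K (stdGrading K n 0)))

/-- The closed subset `{F = 0}` of `ℙⁿ`. -/
def zeroSet {K : Type u} [Field K] {n : ℕ} (F : MvPolynomial (Fin (n + 1)) K) :
    Set (projSpace K n) :=
  {p | F ∈ p.asHomogeneousIdeal}

instance isNoetherianRing_stdGrading_zero (K : Type u) [Field K] (n : ℕ) :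
    IsNoetherianRing (stdGrading K n 0) := by
  refine isNoetherianRing_of_surjective K _ (algebraMap K (stdGrading K n 0)) ?_
  rintro ⟨p, hp⟩
  have hp' : p.IsHomogeneous 0 := hp
  refine ⟨p.coeff 0, Subtype.ext ?_⟩
  have h := MvPolynomial.totalDegree_eq_zero_iff_eq_C.mp
    (Nat.le_zero.mp hp'.totalDegree_le)
  exact h.symm

instance finiteType_stdGrading_zero (K : Type u) [Field K] (n : ℕ) :
    Algebra.FiniteType (stdGrading K n 0) (MvPolynomial (Fin (n + 1)) K) :=
  haveI : IsScalarTower K (stdGrading K n 0) (MvPolynomial (Fin (n + 1)) K) :=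
    ⟨fun a b c => smul_mul_assoc a (b : MvPolynomial (Fin (n + 1)) K) c⟩
  Algebra.FiniteType.of_restrictScalars_finiteType K _ _

instance isLocallyNoetherian_projSpace (K : Type u) [Field K] (n : ℕ) :
    IsLocallyNoetherian (projSpace K n) :=
  haveI : IsLocallyNoetherian (Spec (.of (stdGrading K n 0))) :=
    isLocallyNoetherian_Spec.mpr (isNoetherianRing_stdGrading_zero K n)
  LocallyOfFiniteType.isLocallyNoetherian (Proj.toSpecZero (stdGrading K n))

/-! ### Non-singular projective surfaces and their divisors -/

/-- A non-singular (integral) projective surface over `K`. -/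
structure Surface (K : Type u) [Field K] where
  /-- the underlying scheme -/
  X : Scheme.{u}
  /-- the structure morphism -/
  str : X ⟶ Spec (.of K)
  isIntegral : IsIntegral X
  projective : ∃ (n : ℕ) (i : X ⟶ projSpace K n), IsClosedImmersion i ∧ i ≫ projSpaceStr K n = str
  nonsingular : ∀ x : X, IsRegularLocalRing (X.presheaf.stalk x)
  dimension : topologicalKrullDim X = 2

namespace Surface

variable {K : Type u} [Field K] (S : Surface K)

instance : IsIntegral S.X := S.isIntegral

instance : IsLocallyNoetherian S.X := by
  obtain ⟨n, i, hi, -⟩ := S.projective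
  exact LocallyOfFiniteType.isLocallyNoetherian i

instance : Nonempty (⊤ : S.X.Opens) := ⟨⟨genericPoint S.X, trivial⟩⟩

/-- The field `K(S)` of rational functions. -/
abbrev FunField : Type u := S.X.functionField

/-- The inclusion `K → K(S)` of the constants. -/
def constHom : K →+* S.FunField :=
  ((S.X.germToFunctionField ⊤).hom.comp S.str.appTop.hom).comp
    (Scheme.ΓSpecIso (.of K)).inv.hom

instance : Algebra K S.FunField := S.constHom.toAlgebra

/-- Prime divisors, given by their generic points: the points of codimension one. -/
def PrimeDivisor : Type u := {x : S.X // coheight x = 1}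

/-- The group of (Weil) divisors. -/
abbrev Div : Type u := S.PrimeDivisor →₀ ℤ

variable {S}

/-- The local ring at a point of codimension one is a discrete valuation ring. -/
instance isDVR_stalk (x : S.PrimeDivisor) :
    IsDiscreteValuationRing (S.X.presheaf.stalk x.1) := by
  have hreg := S.nonsingular x.1
  have h := (IsRegularLocalRing.iff_finrank_cotangentSpace
    (S.X.presheaf.stalk x.1)).mp hreg
  rw [ringKrullDim_stalk_eq_coheight, x.2] at h
  exact IsLocalRing.finrank_CotangentSpace_eq_one_iff.mp (by exact_mod_cast h)

/-- The order of the rational function `f` along the prime divisor `x` (zero for `f = 0`). -/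
def ord (f : S.FunField) (x : S.PrimeDivisor) : ℤ := Scheme.ord f x.1

lemma ord_mul {f g : S.FunField} (hf : f ≠ 0) (hg : g ≠ 0) (x : S.PrimeDivisor) :
    ord (f * g) x = ord f x + ord g x :=
  Scheme.ord_mul hf hg

lemma ord_add {f g : S.FunField} (h : f + g ≠ 0) (x : S.PrimeDivisor) :
    min (ord f x) (ord g x) ≤ ord (f + g) x :=
  Scheme.ord_add (x := x.1) h

lemma algebraMap_ne_zero {c : K} (hc : c ≠ 0) : algebraMap K S.FunField c ≠ 0 :=
  (map_ne_zero (algebraMap K S.FunField)).mpr hc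

lemma ord_const {c : K} (hc : c ≠ 0) (x : S.PrimeDivisor) :
    ord (algebraMap K S.FunField c) x = 0 := by
  have hu : IsUnit ((S.str.appTop.hom.comp (Scheme.ΓSpecIso (.of K)).inv.hom) c) :=
    IsUnit.map (S.str.appTop.hom.comp (Scheme.ΓSpecIso (.of K)).inv.hom)
      (isUnit_iff_ne_zero.mpr hc)
  have h := Scheme.ord_of_isUnit (X := S.X) (U := ⊤) hu (x := x.1) trivial
  exact h

/-- `D` is the divisor of a non-zero rational function. -/
def IsPrincipal (D : S.Div) : Prop :=
  ∃ f : S.FunField, f ≠ 0 ∧ ∀ x, D x = ord f x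

variable (S) in
/-- The subgroup of principal divisors. -/
def principalDivisors : AddSubgroup S.Div where
  carrier := {D | IsPrincipal D}
  zero_mem' := ⟨1, one_ne_zero, fun x => by
    have h := ord_const (S := S) (one_ne_zero (α := K)) x
    rw [map_one] at h
    simp [h]⟩
  add_mem' := by
    rintro D D' ⟨f, hf, h⟩ ⟨g, hg, h'⟩
    exact ⟨f * g, mul_ne_zero hf hg, fun x => by rw [ord_mul hf hg, ← h, ← h']; rfl⟩
  neg_mem' := by
    rintro D ⟨f, hf, h⟩
    refine ⟨f⁻¹, inv_ne_zero hf, fun x => ?_⟩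
    have h1 := ord_const (S := S) (one_ne_zero (α := K)) x
    have h2 := ord_mul hf (inv_ne_zero hf) x
    rw [map_one] at h1
    rw [mul_inv_cancel₀ hf, h1] at h2
    rw [Finsupp.neg_apply, h x]
    omega

variable (S) in
/-- The Picard group: the group of divisors modulo linear equivalence. -/
abbrev Pic : Type u := S.Div ⧸ S.principalDivisors

/-- The class of a divisor in the Picard group. -/
def cl (D : S.Div) : S.Pic := QuotientAddGroup.mk D

/-- The closed subset of the surface underlying a divisor. -/
def supp (D : S.Div) : Set S.X := ⋃ x ∈ D.support, closure {x.1}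

/-- The space of global sections
`H⁰(S, 𝒪(D)) = {f ∈ K(S) | f = 0 or div f + D ≥ 0}`. -/
def H0 (D : S.Div) : Submodule K S.FunField where
  carrier := {f | f ≠ 0 → ∀ x, 0 ≤ ord f x + D x}
  zero_mem' h := absurd rfl h
  add_mem' := by
    intro f g hf hg hfg x
    by_cases hf0 : f = 0
    · subst hf0
      rw [zero_add] at hfg ⊢
      exact hg hfg x
    by_cases hg0 : g = 0
    · subst hg0
      rw [add_zero]
      exact hf hf0 x
    have h := ord_add hfg x
    have h1 := hf hf0 x
    have h2 := hg hg0 x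
    rcases min_le_iff.mp h with h | h <;> omega
  smul_mem' := by
    intro c f hf hcf x
    rw [Algebra.smul_def] at hcf ⊢
    have hc : c ≠ 0 := by
      rintro rfl
      simp at hcf
    have hf0 : f ≠ 0 := right_ne_zero_of_mul hcf
    rw [ord_mul (algebraMap_ne_zero hc) hf0, ord_const hc, zero_add]
    exact hf hf0 x

lemma mul_mem_H0 {D D' : S.Div} {f g : S.FunField} (hf : f ∈ H0 D) (hg : g ∈ H0 D') :
    f * g ∈ H0 (D + D') := by
  intro hfg x
  have hf0 := left_ne_zero_of_mul hfg
  have hg0 := right_ne_zero_of_mul hfg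
  have h1 := hf hf0 x
  have h2 := hg hg0 x
  rw [ord_mul hf0 hg0, Finsupp.add_apply]
  omega

lemma const_mem_H0 (c : K) : algebraMap K S.FunField c ∈ H0 (0 : S.Div) := by
  intro h x
  have hc : c ≠ 0 := by
    rintro rfl
    simp at h
  rw [ord_const hc]
  simp

/-! ### Intersection numbers -/

/-- For a prime divisor `x` through the point `p`, the prime ideal of the local ring at `p`
consisting of the functions that vanish along `x`. -/
def primeIdealAt (p : S.X) (x : S.PrimeDivisor) (h : x.1 ⤳ p) : Ideal (S.X.presheaf.stalk p) :=
  (IsLocalRing.maximalIdeal (S.X.presheaf.stalk x.1)).comap (S.X.presheaf.stalkSpecializes h).hom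

/-- The intersection number of two distinct prime divisors `x` and `y`: the sum, over the closed
points `p` of their intersection, of the length of `𝒪_p / (I_x + I_y)`. -/
def primeInter (x y : S.PrimeDivisor) : ℕ :=
  ∑ᶠ p : {p : S.X // IsClosed {p} ∧ x.1 ⤳ p ∧ y.1 ⤳ p},
    (Module.length (S.X.presheaf.stalk p.1)
      (S.X.presheaf.stalk p.1 ⧸
        (primeIdealAt p.1 x p.2.2.1 ⊔ primeIdealAt p.1 y p.2.2.2))).toNat

/-- `(D, E) = m` for the intersection form: there are divisors `D' ∼ D` and `E' ∼ E` without
common component whose local intersection multiplicities add up to `m`. (Such `D'`, `E'` exist on a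
non-singular projective surface, and `m` does not depend on their choice.) -/
def HasInter (D E : S.Div) (m : ℤ) : Prop :=
  ∃ D' E' : S.Div, cl D' = cl D ∧ cl E' = cl E ∧ Disjoint D'.support E'.support ∧
    m = D'.sum fun x a => E'.sum fun y b => a * b * (primeInter x y : ℤ)

/-- `D` is nef: it has non-negative intersection number with every irreducible curve. -/
def IsNef (D : S.Div) : Prop :=
  ∀ C : S.PrimeDivisor, ∃ m : ℤ, 0 ≤ m ∧ HasInter D (Finsupp.single C 1) m

/-- `D` is big: `h⁰(mD)` grows like `m²`. -/
def IsBig (D : S.Div) : Prop :=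
  ∃ c : ℝ, 0 < c ∧
    ∀ᶠ m : ℕ in Filter.atTop, c * (m : ℝ) ^ 2 ≤ (Module.finrank K (H0 (m • D)) : ℝ)

/-! ### The canonical class -/

/-- The local ring at `x`, as a subring of the function field. -/
def localSubring (x : S.PrimeDivisor) : Subring S.FunField :=
  (algebraMap (S.X.presheaf.stalk x.1) S.FunField).range

variable (S) in
/-- Rational two-forms. -/
abbrev RatForm : Type u := ⋀[S.FunField]^2 (Ω[S.FunField⁄K])

/-- The rational two-form `da ∧ db`. -/
def wedgeD (a b : S.FunField) : S.RatForm :=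
  exteriorPower.ιMulti S.FunField 2
    ![KaehlerDifferential.D K S.FunField a, KaehlerDifferential.D K S.FunField b]

/-- The rational two-form `ω` has order `n` along `x`: it is `f η`, where `η` generates the
module of two-forms that are regular along `x` and `f` has order `n` along `x`. -/
def HasFormOrder (ω : S.RatForm) (x : S.PrimeDivisor) (n : ℤ) : Prop :=
  ∃ (f : S.FunField) (η : S.RatForm), f ≠ 0 ∧ ord f x = n ∧ ω = f • η ∧
    Submodule.span (localSubring x) {η} =
      Submodule.span (localSubring x)
        {θ : S.RatForm | ∃ a ∈ localSubring x, ∃ b ∈ localSubring x, θ = wedgeD a b}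

/-- `C` is a canonical divisor, i.e. the divisor of a non-zero rational two-form. -/
def IsCanonical (C : S.Div) : Prop :=
  ∃ ω : S.RatForm, ω ≠ 0 ∧ ∀ x, HasFormOrder ω x (C x)

variable (S) in
/-- `S` is a generalized del Pezzo surface of degree `d`: its anticanonical class is big and nef
and has self intersection number `d`. -/
def IsGeneralizedDelPezzo (d : ℕ) : Prop :=
  ∃ C : S.Div, IsCanonical C ∧ IsBig (-C) ∧ IsNef (-C) ∧ HasInter (-C) (-C) d

/-! ### Cox rings -/

section Cox

variable {ι : Type} [Fintype ι] (D : ι → S.Div)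

/-- The classes of the divisors `D j` form a basis of the Picard group. -/
def IsPicBasis : Prop :=
  LinearIndependent ℤ (fun j => cl (D j)) ∧
    Submodule.span ℤ (Set.range fun j => cl (D j)) = ⊤

/-- The divisor `∑ ν_j D_j`. -/
def combo (ν : ι → ℤ) : S.Div := ∑ j, ν j • D j

lemma combo_zero : combo D 0 = 0 := by simp [combo]

lemma combo_add (μ ν : ι → ℤ) : combo D (μ + ν) = combo D μ + combo D ν := by
  simp [combo, add_smul, Finset.sum_add_distrib]

/-- The Cox ring `⨁_ν H⁰(S, 𝒪(∑ ν_j D_j))`; the monomial with exponent `ν` records the degree. -/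
def CoxRing : Subalgebra K (AddMonoidAlgebra S.FunField (ι → ℤ)) where
  carrier := {F | ∀ ν, F.coeff ν ∈ H0 (combo D ν)}
  mul_mem' := by
    classical
    intro F G hF hG ν
    rw [AddMonoidAlgebra.coeff_mul]
    refine Submodule.sum_mem _ fun a _ => Submodule.sum_mem _ fun b _ => ?_
    dsimp only
    split_ifs with h
    · rw [← h, combo_add]
      exact mul_mem_H0 (hF a) (hG b)
    · exact zero_mem _
  add_mem' := fun hF hG ν => (H0 _).add_mem (hF ν) (hG ν)
  algebraMap_mem' := by
    classical
    intro c ν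
    rw [AddMonoidAlgebra.coe_algebraMap]
    simp only [Function.comp_apply, AddMonoidAlgebra.coeff_single, Finsupp.single_apply]
    split_ifs with h
    · rw [← h, combo_zero]
      exact const_mem_H0 c
    · exact zero_mem _

variable {D}

/-- The divisor `E` corresponding to a homogeneous element `s` of degree `ν` of the Cox ring:
the divisor of zeros of the section `s` of `𝒪(∑ ν_j D_j)`. -/
def IsDivisorOf (s : CoxRing D) (ν : ι → ℤ) (E : S.Div) : Prop :=
  ∀ x, E x = ord (s.1.coeff ν) x + combo D ν x

/-- `e` is a minimal system of generators of the Cox ring, homogeneous of degrees `ν`. -/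
structure IsMinimalGenerators {t : ℕ} (e : Fin t → CoxRing D) (ν : Fin t → ι → ℤ) : Prop where
  homogeneous : ∀ i, ∃ f, (e i).1 = AddMonoidAlgebra.single (ν i) f
  generate : Algebra.adjoin K (Set.range e) = ⊤
  minimal : ∀ s : Set (Fin t), Algebra.adjoin K (e '' s) = ⊤ → s = Set.univ

/-- `R(e₁, …, e_t) = 0` alone is a minimal system of relations between the generators `e`:
the polynomial `R` is non-zero, homogeneous, and generates the ideal of all relations. -/
structure IsSingleRelation {t : ℕ} (e : Fin t → CoxRing D) (ν : Fin t → ι → ℤ)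
    (R : MvPolynomial (Fin t) K) : Prop where
  ne_zero : R ≠ 0
  homogeneous : ∃ δ : ι → ℤ, MvPolynomial.IsWeightedHomogeneous ν R δ
  generate : RingHom.ker (MvPolynomial.aeval (R := K) e) = Ideal.span {R}

end Cox

/-! ### Morphisms to the plane -/

/-- `ρ : S ⟶ ℙ²` is the contraction of the curves in `C`: it is a morphism over `K` that maps each
of them to a closed point and is an isomorphism from the complement of these curves onto an open
subset of `ℙ²`. -/
def IsContraction (ρ : S.X ⟶ projSpace K 2) (C : Set S.Div) : Prop :=
  ρ ≫ projSpaceStr K 2 = S.str ∧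
    (∀ E ∈ C, ∃ p : projSpace K 2, IsClosed {p} ∧ ρ '' supp E = {p}) ∧
    ∃ U : (projSpace K 2).Opens, (ρ ⁻¹ᵁ U : Set S.X) = (⋃ E ∈ C, supp E)ᶜ ∧ IsIso (ρ ∣_ U)

/-- The pullback along `ρ` of the quotient `y / z` of two linear forms, where `z` does not vanish
at `ρ x`, as a rational function on `S`. -/
def pullbackQuot (ρ : S.X ⟶ projSpace K 2) (x : S.X) (y z : stdGrading K 2 1)
    (hz : ρ x ∉ zeroSet (z : MvPolynomial (Fin 3) K)) : S.FunField :=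
  algebraMap (S.X.presheaf.stalk x) S.FunField
    ((ρ.stalkMap x).hom ((Proj.stalkIso (stdGrading K 2) (ρ x)).inv.hom
      (HomogeneousLocalization.mk ⟨1, y, z, hz⟩)))

/-- `L` is the pullback `ρ^* {y = 0}` of a line `{y = 0}` in the plane, so that its class is
`ℓ₀ = ρ^* 𝒪(1)`. Near `x` the line is defined by `y / z`, for any linear form `z` that does not
vanish at `ρ x`. -/
def IsPullbackOfLine (ρ : S.X ⟶ projSpace K 2) (L : S.Div) : Prop :=
  ∃ y : stdGrading K 2 1, y ≠ 0 ∧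
    ∀ (x : S.PrimeDivisor) (z : stdGrading K 2 1)
      (hz : ρ x.1 ∉ zeroSet (z : MvPolynomial (Fin 3) K)),
      L x = ord (pullbackQuot ρ x.1 y z hz) x

/-- `y₀, y₁, y₂` are homogeneous coordinates of the plane. -/
def IsCoordinates (y : Fin 3 → MvPolynomial (Fin 3) K) : Prop :=
  (∀ j, (y j).IsHomogeneous 1) ∧ LinearIndependent K y

end Surface

/-- The substitution, in a polynomial in variables indexed by `Fin t`, of the four variables with
indices `i₀, …, i₃` by `Y₀, …, Y₃`, and of all other variables by `1`. -/
def substHom {K : Type u} [Field K] {t : ℕ} (i : Fin 4 → Fin t) :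
    MvPolynomial (Fin t) K →ₐ[K] MvPolynomial (Fin 4) K :=
  open Classical in
  MvPolynomial.aeval fun k => if h : ∃ j, i j = k then MvPolynomial.X h.choose else 1

end DelPezzo

end

/-! Because `ρ` is birational, `K(S)` is the field of homogeneous fractions of degree zero in `K[y₀,
y₁, y₂]`. The prime divisors of `S` are the contracted curves together with one strict transform for
each irreducible plane curve, and the order along such a transform is the multiplicity of the
irreducible form (`IsContraction.exists_planeModel`, `ord_eq_fracOrd`). Hence `Pic` is free on the
class of `L` and the classes of the `E k`, `k ∈ I` (`degBasis`): off the contracted curves every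
divisor is equivalent to a multiple of `L`, and a relation would produce mutually inverse forms of
degrees `n` and `-n`.

Setting the sections of the contracted curves equal to `1` turns a section of degree `μ` into a form
of degree `deg μ` on the plane. This is an algebra homomorphism `formHom`, injective on each graded
piece. Every form arises, since the multiplicities along contracted curves may be prescribed freely
(`exists_formHom_eq`). So the forms of the four remaining generators generate `K[y₀, y₁, y₂]`
(`aeval_genForm_surjective`).

Minimality of the generators makes the `E k` pairwise distinct prime divisors, for if `E k` split,
then `e k` would be a product of sections that do not involve it. The four forms are therefore
irreducible of positive degree, and `ρ` maps each of these `E k` onto the zero set of its form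
(`irreducible_genForm`, `image_supp`). A linear form which is a polynomial in forms of positive
degree is a linear combination of those of degree one, so three of the four are coordinates. This is
(1).

For (2), equality of zero sets shows that each `y j` is a constant times the corresponding generator
form; after rescaling they agree, and the fourth form is `R'(y₀, y₁, y₂)`. The kernel of `K[Y₀, …,
Y₃] → K[y₀, y₁, y₂]` is then generated by `Y₃ - R'`, and it contains the dehomogenised relation.
Conversely, `Y₃ - R'` can be made homogeneous for the `Pic`-grading by monomials in the variables of
the contracted curves; the result is a relation, hence a multiple of `R`. So the two polynomials are
associated, and units are constants (`associated_substHom`).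

Finally `(E j, L)` is the degree of the form of `e j`: two general lines avoid the contracted
points, and their strict transforms represent the class of `L`, meet transversally in one point, and
are disjoint from the contracted curves (`hasInter`). -/

noncomputable section

/-! ### Homogeneous components, and factors of forms. -/

namespace MvPolynomial

variable {σ : Type*} {R : Type*} [CommRing R]

/-- The substitution `Xᵢ ↦ Xᵢ T`, which separates the homogeneous components. -/
def gradingHom : MvPolynomial σ R →ₐ[R] Polynomial (MvPolynomial σ R) :=
  aeval fun i => Polynomial.C (X i) * Polynomial.X

lemma gradingHom_monomial (d : σ →₀ ℕ) (c : R) :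
    gradingHom (monomial d c) = Polynomial.monomial d.degree (monomial d c) := by
  rw [gradingHom, aeval_monomial, Finsupp.prod]
  simp_rw [mul_pow]
  rw [Finset.prod_mul_distrib, Finset.prod_pow_eq_pow_sum, monomial_eq, Finsupp.prod,
    ← Polynomial.C_mul_X_pow_eq_monomial, map_mul, map_prod, ← mul_assoc]
  simp_rw [map_pow]
  rfl

lemma coeff_gradingHom (F : MvPolynomial σ R) (m : ℕ) :
    (gradingHom F).coeff m = homogeneousComponent m F := by
  classical
  induction F using MvPolynomial.induction_on' with
  | monomial d c =>
    rw [gradingHom_monomial, Polynomial.coeff_monomial]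
    rw [homogeneousComponent_of_mem (isHomogeneous_monomial c rfl)]
    simp [eq_comm]
  | add p q hp hq => simp [hp, hq]

lemma gradingHom_of_isHomogeneous {F : MvPolynomial σ R} {n : ℕ} (hF : F.IsHomogeneous n) :
    gradingHom F = Polynomial.monomial n F := by
  classical
  ext1 m
  rw [coeff_gradingHom, homogeneousComponent_of_mem hF, Polynomial.coeff_monomial]
  simp [eq_comm]

/-- Over a domain both the highest and the lowest degree in `T` are additive under multiplication.
They coincide for the monomial `gradingHom (a * b)`, so they coincide for each factor. -/
lemma IsHomogeneous.of_mul_left [IsDomain R] {a b : MvPolynomial σ R} {n : ℕ}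
    (h : (a * b).IsHomogeneous n) (h0 : a * b ≠ 0) : ∃ m, a.IsHomogeneous m := by
  have h1 := gradingHom_of_isHomogeneous h
  rw [map_mul] at h1
  have hm0 : (Polynomial.monomial n (a * b)) ≠ 0 := by
    simpa using h0
  have ha : gradingHom a ≠ 0 := by
    intro h; rw [h, zero_mul] at h1; exact hm0 h1.symm
  have hb : gradingHom b ≠ 0 := by
    intro h; rw [h, mul_zero] at h1; exact hm0 h1.symm
  have h2 := Polynomial.natDegree_mul ha hb
  have h3 := Polynomial.natTrailingDegree_mul ha hb
  rw [h1, Polynomial.natDegree_monomial_eq _ h0] at h2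
  rw [h1, Polynomial.natTrailingDegree_monomial h0] at h3
  have h4 := (gradingHom a).natTrailingDegree_le_natDegree
  have h5 := (gradingHom b).natTrailingDegree_le_natDegree
  refine ⟨(gradingHom a).natDegree, ?_⟩
  have : a = homogeneousComponent (gradingHom a).natDegree a := by
    conv_lhs => rw [← sum_homogeneousComponent a]
    by_cases hmem : (gradingHom a).natDegree ∈ Finset.range (a.totalDegree + 1)
    · refine Finset.sum_eq_single_of_mem _ hmem fun m _ hm => ?_
      rw [← coeff_gradingHom]
      rcases lt_or_gt_of_ne hm with hlt | hgt
      · exact Polynomial.coeff_eq_zero_of_lt_natTrailingDegree (by omega)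
      · exact Polynomial.coeff_eq_zero_of_natDegree_lt hgt
    · exfalso
      have hc : (gradingHom a).coeff (gradingHom a).natDegree ≠ 0 := by simpa using ha
      rw [coeff_gradingHom] at hc
      exact hc (homogeneousComponent_eq_zero _ _ (by simpa [Nat.lt_succ_iff] using hmem))
  have h6 := homogeneousComponent_isHomogeneous (gradingHom a).natDegree a
  rwa [← this] at h6

lemma IsHomogeneous.of_dvd [IsDomain R] {a F : MvPolynomial σ R} {n : ℕ}
    (h : F.IsHomogeneous n) (h0 : F ≠ 0) (ha : a ∣ F) : ∃ m, a.IsHomogeneous m := by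
  obtain ⟨b, rfl⟩ := ha
  exact h.of_mul_left h0

/-- Every non-constant ternary form over an algebraically closed field has a non-trivial zero. -/
lemma exists_eval_eq_zero_of_not_isUnit {K : Type*} [Field K] [IsAlgClosed K]
    {P : MvPolynomial (Fin 3) K} (hP : ¬ IsUnit P) : ∃ a : Fin 3 → K, a ≠ 0 ∧ eval a P = 0 := by
  by_contra! hcon
  -- If `P` vanished at most at the origin, each variable would vanish on its zero locus. By the
  -- Nullstellensatz `P` would divide powers of both `X 0` and `X 1`, which are coprime.
  have key : ∀ i : Fin 3, ∃ n, P ∣ X i ^ n := by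
    intro i
    have : (X i : MvPolynomial (Fin 3) K) ∈ (Ideal.span {P}).radical := by
      rw [← vanishingIdeal_zeroLocus_eq_radical (K := K), mem_vanishingIdeal_iff]
      intro x hx
      have hx0 : eval x P = 0 := by
        simpa using hx P (Ideal.mem_span_singleton_self P)
      have : x = 0 := by
        by_contra h
        exact hcon x h hx0
      simp [this]
    obtain ⟨n, hn⟩ := this
    exact ⟨n, Ideal.mem_span_singleton.mp hn⟩
  obtain ⟨n, hn⟩ := key 0
  obtain ⟨m, hm⟩ := key 1
  apply hP
  have hrel : IsRelPrime (X 0 ^ n : MvPolynomial (Fin 3) K) (X 1 ^ m) := by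
    refine IsRelPrime.pow ?_
    refine (Irreducible.isRelPrime_iff_not_dvd X_prime.irreducible).mpr ?_
    rw [X_dvd_X]
    simp
  exact hrel hn hm

end MvPolynomial

/-! ### Orders at prime elements on the fraction field of a factorial ring. -/

section FracOrd

variable {A : Type*} [CommRing A] [IsDomain A] [UniqueFactorizationMonoid A]
  {Q : Type*} [Field Q] [Algebra A Q] [IsFractionRing A Q]

/-- The order of an element of the fraction field at the prime element `P`. -/
def fracOrd (P : A) (q : Q) : ℤ :=
  (multiplicity P (IsFractionRing.num A q) : ℤ) - multiplicity P (IsFractionRing.den A q : A)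

lemma multiplicity_mul_of_prime {P a b : A} (hP : Prime P) (ha : a ≠ 0) (hb : b ≠ 0) :
    multiplicity P (a * b) = multiplicity P a + multiplicity P b :=
  multiplicity_mul hP (FiniteMultiplicity.of_prime_left hP (mul_ne_zero ha hb))

/-- Cross-multiplication with the reduced fraction in the definition gives independence of the
representation. The elements must be non-zero, since `multiplicity` only takes a default value at
`0`. -/
lemma fracOrd_div {P : A} (hP : Prime P) {a b : A} (ha : a ≠ 0) (hb : b ≠ 0) :
    fracOrd P (algebraMap A Q a / algebraMap A Q b) =
      (multiplicity P a : ℤ) - multiplicity P b := by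
  have hinj := IsFractionRing.injective A Q
  have ha' : algebraMap A Q a ≠ 0 := by simpa using ha
  have hb' : algebraMap A Q b ≠ 0 := by simpa using hb
  set q := algebraMap A Q a / algebraMap A Q b with hq
  have hd : (IsFractionRing.den A q : A) ≠ 0 := nonZeroDivisors.coe_ne_zero _
  have hd' : algebraMap A Q (IsFractionRing.den A q : A) ≠ 0 := by simp
  have h1 : algebraMap A Q (IsFractionRing.num A q) / algebraMap A Q (IsFractionRing.den A q) = q :=
    IsFractionRing.mk'_num_den' A q
  have h2 : IsFractionRing.num A q * b = a * (IsFractionRing.den A q : A) := by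
    apply hinj
    rw [map_mul, map_mul]
    rw [hq] at h1
    exact (div_eq_div_iff hd' hb').mp h1
  have hn : IsFractionRing.num A q ≠ 0 := by
    intro h
    rw [h, zero_mul] at h2
    exact mul_ne_zero ha hd h2.symm
  have h3 := congrArg (multiplicity P) h2
  rw [multiplicity_mul_of_prime hP hn hb, multiplicity_mul_of_prime hP ha hd] at h3
  unfold fracOrd
  omega

lemma fracOrd_algebraMap {P : A} (hP : Prime P) {a : A} (ha : a ≠ 0) :
    fracOrd P (algebraMap A Q a) = multiplicity P a := by
  have h := fracOrd_div (Q := Q) hP ha one_ne_zero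
  rw [map_one, div_one] at h
  rw [h, multiplicity_of_one_right hP.not_isUnit]
  simp

lemma fracOrd_mul {P : A} (hP : Prime P) {p q : Q} (hp : p ≠ 0) (hq : q ≠ 0) :
    fracOrd P (p * q) = fracOrd P p + fracOrd P q := by
  obtain ⟨a, b, hb, rfl⟩ := IsFractionRing.div_surjective (A := A) p
  obtain ⟨c, d, hd, rfl⟩ := IsFractionRing.div_surjective (A := A) q
  have hb := nonZeroDivisors.ne_zero hb
  have hd := nonZeroDivisors.ne_zero hd
  have ha : a ≠ 0 := by rintro rfl; simp at hp
  have hc : c ≠ 0 := by rintro rfl; simp at hq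
  rw [div_mul_div_comm, ← map_mul, ← map_mul, fracOrd_div hP (mul_ne_zero ha hc)
    (mul_ne_zero hb hd), fracOrd_div hP ha hb, fracOrd_div hP hc hd,
    multiplicity_mul_of_prime hP ha hc, multiplicity_mul_of_prime hP hb hd]
  push_cast
  ring

lemma fracOrd_one {P : A} (hP : Prime P) : fracOrd P (1 : Q) = 0 := by
  have h := fracOrd_mul (Q := Q) hP one_ne_zero one_ne_zero
  rw [mul_one] at h
  omega

lemma fracOrd_inv {P : A} (hP : Prime P) {q : Q} (hq : q ≠ 0) :
    fracOrd P q⁻¹ = -fracOrd P q := by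
  have h := fracOrd_mul hP hq (inv_ne_zero hq)
  rw [mul_inv_cancel₀ hq, fracOrd_one hP] at h
  omega

variable (Q) in
/-- The order at the prime element `P`, as a homomorphism on the group of units. -/
def fracOrdHom {P : A} (hP : Prime P) : Additive Qˣ →+ ℤ where
  toFun q := fracOrd P (q.toMul : Q)
  map_zero' := fracOrd_one hP
  map_add' p q := by
    rw [toMul_add, Units.val_mul]
    exact fracOrd_mul hP p.toMul.ne_zero q.toMul.ne_zero

lemma fracOrd_zpow {P : A} (hP : Prime P) {q : Q} (hq : q ≠ 0) (m : ℤ) :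
    fracOrd P (q ^ m) = m * fracOrd P q := by
  have h := map_zsmul (fracOrdHom (Q := Q) hP) m (Additive.ofMul (Units.mk0 q hq))
  simpa [fracOrdHom] using h

/-- A fraction `a / b` without poles along the prime divisors of `b` is integral. -/
lemma exists_algebraMap_eq_of_fracOrd_nonneg {a b : A} (ha : a ≠ 0) (hb : b ≠ 0)
    (h : ∀ P, Irreducible P → P ∣ b → 0 ≤ fracOrd P (algebraMap A Q a / algebraMap A Q b)) :
    b ∣ a := by
  induction b using UniqueFactorizationMonoid.induction_on_prime generalizing a with
  | h₁ => exact absurd rfl hb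
  | h₂ x hx => exact hx.dvd
  | h₃ c p hc hp ih =>
    -- The factor `p` contributes at least one to the multiplicity of the denominator, so a
    -- non-negative order forces `p ∣ a`, and `p` can be cancelled.
    have h1 := h p hp.irreducible (Dvd.intro _ rfl)
    rw [fracOrd_div hp ha hb, multiplicity_mul_of_prime hp hp.ne_zero hc,
      multiplicity_self] at h1
    have h2 : p ∣ a := by
      rw [← pow_one p, FiniteMultiplicity.pow_dvd_iff_le_multiplicity
        (FiniteMultiplicity.of_prime_left hp ha)]
      omega
    obtain ⟨a', rfl⟩ := h2
    have ha' := right_ne_zero_of_mul ha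
    refine mul_dvd_mul_left p (ih ha' hc fun P hP hPc => ?_)
    have h3 := h P hP (hPc.mul_left p)
    rwa [map_mul, map_mul, mul_div_mul_left] at h3
    simpa using hp.ne_zero

end FracOrd

end

/-! ### Local rings of the plane and the function field of the surface. -/

noncomputable section

namespace DelPezzo

section ProjStalk

variable {σ : Type*} {A : Type u} [CommRing A] [SetLike σ A] [AddSubgroupClass σ A]
  (𝒜 : ℕ → σ) [GradedRing 𝒜]

instance isPrime_asHomogeneousIdeal (p : Proj 𝒜) : p.asHomogeneousIdeal.toIdeal.IsPrime :=
  ProjectiveSpectrum.isPrime p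

/-- Both elements are germs of the same section `a / b` over the basic open set of `b`. -/
lemma stalkSpecializes_stalkIso_inv_mk {p q : Proj 𝒜} (h : p ⤳ q) {n : ℕ} (a b : 𝒜 n)
    (hq : (b : A) ∉ q.asHomogeneousIdeal) (hp : (b : A) ∉ p.asHomogeneousIdeal) :
    (Proj 𝒜).presheaf.stalkSpecializes h ((Proj.stalkIso 𝒜 q).inv.hom
      (HomogeneousLocalization.mk ⟨n, a, b, hq⟩)) =
    (Proj.stalkIso 𝒜 p).inv.hom (HomogeneousLocalization.mk ⟨n, a, b, hp⟩) := by
  exact TopCat.Presheaf.germ_stalkSpecializes_apply (Proj 𝒜).presheaf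
    (U := Proj.basicOpen 𝒜 (b : A)) (y := q) hq h
    (sectionInBasicOpen 𝒜 q ⟨n, a, b, hq⟩)

end ProjStalk

namespace Surface

variable {K : Type u} [Field K] {S : Surface K} (ρ : S.X ⟶ projSpace K 2)

/-- The local ring of the plane at `p`, as a ring of homogeneous fractions. -/
abbrev planeStalk (p : projSpace K 2) : Type u :=
  HomogeneousLocalization.AtPrime (stdGrading K 2) p.asHomogeneousIdeal.toIdeal

/-- The pullback of functions to the local ring at `x`. -/
def pullbackStalk (x : S.X) : planeStalk (ρ x) →+* S.X.presheaf.stalk x :=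
  (ρ.stalkMap x).hom.comp (Proj.stalkIso (stdGrading K 2) (ρ x)).inv.hom

instance (x : S.X) : IsLocalHom (pullbackStalk ρ x) := by
  have h1 : IsLocalHom (Proj.stalkIso (stdGrading K 2) (ρ x)).inv.hom := isLocalHom_of_isIso _
  have h2 : IsLocalHom (ρ.stalkMap x).hom := inferInstance
  exact RingHom.isLocalHom_comp _ _

lemma genericPoint_specializes (x : S.X) : genericPoint S.X ⤳ x :=
  (genericPoint_spec S.X).specializes trivial

lemma stalkSpecializes_pullbackStalk {x y : S.X} (h : x ⤳ y) {n : ℕ} (a b : stdGrading K 2 n)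
    (hy : (b : MvPolynomial (Fin 3) K) ∉ (ρ y).asHomogeneousIdeal)
    (hx : (b : MvPolynomial (Fin 3) K) ∉ (ρ x).asHomogeneousIdeal) :
    (S.X.presheaf.stalkSpecializes h).hom
      (pullbackStalk ρ y (HomogeneousLocalization.mk ⟨n, a, b, hy⟩)) =
      pullbackStalk ρ x (HomogeneousLocalization.mk ⟨n, a, b, hx⟩) := by
  simp only [pullbackStalk, RingHom.comp_apply]
  rw [← stalkSpecializes_stalkIso_inv_mk (stdGrading K 2) (ρ.base.hom.map_specializes h) a b hy hx]
  exact (Scheme.Hom.stalkSpecializes_stalkMap_apply ρ x y h _).symm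

lemma notMem_of_specializes {p q : projSpace K 2} (h : p ⤳ q) {b : MvPolynomial (Fin 3) K}
    (hq : b ∉ q.asHomogeneousIdeal) : b ∉ p.asHomogeneousIdeal := by
  have := h.mem_open (Proj.basicOpen (stdGrading K 2) b).isOpen hq
  exact this

lemma algebraMap_pullbackStalk (x : S.X) {n : ℕ} (a b : stdGrading K 2 n)
    (hx : (b : MvPolynomial (Fin 3) K) ∉ (ρ x).asHomogeneousIdeal)
    (hη : (b : MvPolynomial (Fin 3) K) ∉ (ρ (genericPoint S.X)).asHomogeneousIdeal) :
    algebraMap (S.X.presheaf.stalk x) S.FunField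
      (pullbackStalk ρ x (HomogeneousLocalization.mk ⟨n, a, b, hx⟩)) =
      pullbackStalk ρ (genericPoint S.X) (HomogeneousLocalization.mk ⟨n, a, b, hη⟩) :=
  stalkSpecializes_pullbackStalk ρ (genericPoint_specializes x) a b hx hη


/-- The inclusion of the local ring at `p` into the fraction field of `K[y₀, y₁, y₂]`. -/
def planeRatio (p : projSpace K 2) :
    planeStalk p →+* FractionRing (MvPolynomial (Fin 3) K) :=
  (IsLocalization.lift (M := p.asHomogeneousIdeal.toIdeal.primeCompl)
    (S := Localization.AtPrime p.asHomogeneousIdeal.toIdeal)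
    (g := algebraMap (MvPolynomial (Fin 3) K) (FractionRing (MvPolynomial (Fin 3) K)))
    (fun y => by
      rw [isUnit_iff_ne_zero, Ne, map_eq_zero_iff _ (IsFractionRing.injective _ _)]
      intro h
      exact y.2 (h ▸ zero_mem p.asHomogeneousIdeal.toIdeal))).comp
    (algebraMap (planeStalk p) (Localization.AtPrime p.asHomogeneousIdeal.toIdeal))

lemma planeRatio_mk (p : projSpace K 2) {n : ℕ} (a b : stdGrading K 2 n)
    (hp : (b : MvPolynomial (Fin 3) K) ∉ p.asHomogeneousIdeal) :
    planeRatio p (HomogeneousLocalization.mk ⟨n, a, b, hp⟩) =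
      algebraMap _ (FractionRing (MvPolynomial (Fin 3) K)) (a : MvPolynomial (Fin 3) K) /
        algebraMap _ (FractionRing (MvPolynomial (Fin 3) K)) (b : MvPolynomial (Fin 3) K) := by
  have hb : (b : MvPolynomial (Fin 3) K) ≠ 0 := by
    intro h
    exact hp (h ▸ zero_mem p.asHomogeneousIdeal.toIdeal)
  rw [planeRatio, RingHom.comp_apply, HomogeneousLocalization.algebraMap_apply,
    HomogeneousLocalization.val_mk, Localization.mk_eq_mk', IsLocalization.lift_mk',
    eq_div_iff (by simpa using hb)]
  rw [mul_assoc]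
  convert mul_one _
  exact Units.inv_mul_of_eq (IsUnit.coe_liftRight _ _ _)

variable {ρ}

/-- The embedding of the function field of `S` into the field of fractions of `K[y₀, y₁, y₂]`
which is given by a birational morphism to the plane. -/
def toFrac (h : Function.Bijective (pullbackStalk ρ (genericPoint S.X))) :
    S.FunField →+* FractionRing (MvPolynomial (Fin 3) K) :=
  (planeRatio (ρ (genericPoint S.X))).comp
    ((RingEquiv.ofBijective _ h).symm : S.FunField →+* planeStalk (ρ (genericPoint S.X)))

lemma toFrac_pullbackStalk (h : Function.Bijective (pullbackStalk ρ (genericPoint S.X)))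
    (x : S.X) {n : ℕ} (a b : stdGrading K 2 n)
    (hx : (b : MvPolynomial (Fin 3) K) ∉ (ρ x).asHomogeneousIdeal) :
    toFrac h (algebraMap (S.X.presheaf.stalk x) S.FunField
      (pullbackStalk ρ x (HomogeneousLocalization.mk ⟨n, a, b, hx⟩))) =
      algebraMap _ (FractionRing (MvPolynomial (Fin 3) K)) (a : MvPolynomial (Fin 3) K) /
        algebraMap _ (FractionRing (MvPolynomial (Fin 3) K)) (b : MvPolynomial (Fin 3) K) := by
  have hη := notMem_of_specializes (ρ.base.hom.map_specializes (genericPoint_specializes x)) hx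
  rw [algebraMap_pullbackStalk ρ x a b hx hη, toFrac, RingHom.comp_apply, ← planeRatio_mk _ a b hη]
  congr 1
  exact (RingEquiv.ofBijective _ h).symm_apply_apply _

lemma exists_toFrac_eq (h : Function.Bijective (pullbackStalk ρ (genericPoint S.X)))
    (f : S.FunField) : ∃ (n : ℕ) (a b : stdGrading K 2 n), (b : MvPolynomial (Fin 3) K) ≠ 0 ∧
      toFrac h f =
      algebraMap _ (FractionRing (MvPolynomial (Fin 3) K)) (a : MvPolynomial (Fin 3) K) /
        algebraMap _ (FractionRing (MvPolynomial (Fin 3) K)) (b : MvPolynomial (Fin 3) K) := by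
  obtain ⟨z, rfl⟩ := h.2 f
  obtain ⟨⟨n, a, b, hb⟩, rfl⟩ := HomogeneousLocalization.mk_surjective z
  refine ⟨n, a, b, ?_, ?_⟩
  · intro h0
    exact hb (h0 ▸ zero_mem (ρ (genericPoint S.X)).asHomogeneousIdeal.toIdeal)
  · rw [← planeRatio_mk _ a b hb, toFrac, RingHom.comp_apply]
    congr 1
    exact (RingEquiv.ofBijective _ h).symm_apply_apply _

/-- Since `ρ` hits the generic point of the plane, every non-zero form is an admissible denominator
there. -/
lemma exists_of_ratio (h : Function.Bijective (pullbackStalk ρ (genericPoint S.X)))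
    (hbot : (ρ (genericPoint S.X)).asHomogeneousIdeal = ⊥)
    {n : ℕ} (a b : stdGrading K 2 n) (hb : (b : MvPolynomial (Fin 3) K) ≠ 0) :
    ∃ f, toFrac h f =
      algebraMap _ (FractionRing (MvPolynomial (Fin 3) K)) (a : MvPolynomial (Fin 3) K) /
        algebraMap _ (FractionRing (MvPolynomial (Fin 3) K)) (b : MvPolynomial (Fin 3) K) := by
  have hη : (b : MvPolynomial (Fin 3) K) ∉ (ρ (genericPoint S.X)).asHomogeneousIdeal := by
    rw [hbot]
    intro h0
    exact hb (HomogeneousIdeal.mem_iff.mpr h0)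
  exact ⟨_, toFrac_pullbackStalk h _ a b hη⟩

section Restrict

variable {U : (projSpace K 2).Opens} [IsIso (ρ ∣_ U)]

lemma isIso_stalkMap_of_mem (U : (projSpace K 2).Opens) [IsIso (ρ ∣_ U)]
    {x : S.X} (hx : ρ x ∈ U) : IsIso (ρ.stalkMap x) := by
  have hoi : IsOpenImmersion ((ρ ⁻¹ᵁ U).ι ≫ ρ) := by
    rw [← morphismRestrict_ι]
    infer_instance
  let x' : (ρ ⁻¹ᵁ U).toScheme := ⟨x, hx⟩
  have h1 : IsIso (((ρ ⁻¹ᵁ U).ι ≫ ρ).stalkMap x') := inferInstance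
  have h2 : IsIso ((ρ ⁻¹ᵁ U).ι.stalkMap x') := inferInstance
  have h3 := Scheme.Hom.stalkMap_comp (ρ ⁻¹ᵁ U).ι ρ x'
  rw [h3] at h1
  exact @IsIso.of_isIso_comp_right _ _ _ _ _ (ρ.stalkMap x) ((ρ ⁻¹ᵁ U).ι.stalkMap x') h2 h1

lemma pullbackStalk_bijective (U : (projSpace K 2).Opens) [IsIso (ρ ∣_ U)]
    {x : S.X} (hx : ρ x ∈ U) : Function.Bijective (pullbackStalk ρ x) := by
  have := isIso_stalkMap_of_mem U hx
  have h1 : IsIso ((Proj.stalkIso (stdGrading K 2) (ρ x)).inv ≫ ρ.stalkMap x) := inferInstance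
  exact ConcreteCategory.bijective_of_isIso ((Proj.stalkIso (stdGrading K 2) (ρ x)).inv ≫ ρ.stalkMap x)

lemma injOn_of_isIso (U : (projSpace K 2).Opens) [IsIso (ρ ∣_ U)] {x y : S.X} (hx : ρ x ∈ U)
    (h : ρ x = ρ y) : x = y := by
  have h1 : Function.Injective ((ρ ∣_ U) ≫ U.ι) := Scheme.Hom.injective _
  have h2 : (⟨x, hx⟩ : (ρ ⁻¹ᵁ U : S.X.Opens)) = ⟨y, (h ▸ hx : ρ y ∈ U)⟩ := by
    apply h1
    rw [morphismRestrict_ι]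
    exact h
  exact congrArg Subtype.val h2

lemma exists_of_mem (U : (projSpace K 2).Opens) [IsIso (ρ ∣_ U)] {p : projSpace K 2} (hp : p ∈ U) :
    ∃ x, ρ x = p := by
  obtain ⟨x, hx⟩ := (ρ ∣_ U).surjective ⟨p, hp⟩
  refine ⟨x.1, ?_⟩
  have h2 := congrArg U.ι hx
  rw [← Scheme.Hom.comp_apply, morphismRestrict_ι] at h2
  exact h2

end Restrict

end Surface
end DelPezzo

end

/-! ### Points of the plane: generic points of curves and rational points. -/

noncomputable section

namespace DelPezzo

open MvPolynomial

variable {K : Type u} [Field K]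

lemma decompose_stdGrading {n : ℕ} (F : MvPolynomial (Fin (n + 1)) K) (i : ℕ) :
    (DirectSum.decompose (stdGrading K n) F i : MvPolynomial (Fin (n + 1)) K) =
      homogeneousComponent i F :=
  decomposition.decompose'_apply F i

/-- The point of the plane given by a homogeneous prime ideal. -/
def pointOfIdeal (I : Ideal (MvPolynomial (Fin 3) K)) (hI : I.IsPrime)
    (hom : ∀ F ∈ I, ∀ n, homogeneousComponent n F ∈ I) (hX : ∃ i, X i ∉ I) : projSpace K 2 where
  asHomogeneousIdeal := ⟨I, fun i F hF => by
    rw [decompose_stdGrading]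
    exact hom F hF i⟩
  isPrime := hI
  not_irrelevant_le := by
    intro h
    obtain ⟨i, hi⟩ := hX
    apply hi
    have h1 : (X i : MvPolynomial (Fin 3) K) ∈ HomogeneousIdeal.irrelevant (stdGrading K 2) := by
      rw [HomogeneousIdeal.mem_irrelevant_iff, GradedRing.proj_apply, decompose_stdGrading]
      rw [homogeneousComponent_of_mem (isHomogeneous_X K i)]
      simp
    exact h h1

lemma mem_pointOfIdeal {I : Ideal (MvPolynomial (Fin 3) K)} {hI : I.IsPrime}
    {hom : ∀ F ∈ I, ∀ n, homogeneousComponent n F ∈ I} {hX : ∃ i, X i ∉ I}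
    {F : MvPolynomial (Fin 3) K} :
    F ∈ (pointOfIdeal I hI hom hX).asHomogeneousIdeal ↔ F ∈ I := Iff.rfl

lemma exists_X_notMem (p : projSpace K 2) : ∃ i, X i ∉ p.asHomogeneousIdeal := by
  by_contra! h
  apply p.not_irrelevant_le
  intro F hF
  have h0 : F ∈ HomogeneousIdeal.irrelevant (stdGrading K 2) := hF
  rw [HomogeneousIdeal.mem_irrelevant_iff, GradedRing.proj_apply, decompose_stdGrading,
    homogeneousComponent_zero] at h0
  have h1 : F ∈ Ideal.span (X '' Set.univ : Set (MvPolynomial (Fin 3) K)) := by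
    rw [mem_ideal_span_X_image]
    intro m hm
    by_contra! hcon
    have : m = 0 := by
      ext i
      simpa using hcon i
    rw [this, mem_support_iff] at hm
    exact hm (by simpa using h0)
  have h2 : Ideal.span (X '' Set.univ : Set (MvPolynomial (Fin 3) K)) ≤
      p.asHomogeneousIdeal.toIdeal := by
    rw [Ideal.span_le]
    rintro _ ⟨i, -, rfl⟩
    exact h i
  exact h2 h1

lemma mem_closure_singleton_iff {p q : projSpace K 2} :
    p ∈ closure {q} ↔ ∀ F, F ∈ q.asHomogeneousIdeal → F ∈ p.asHomogeneousIdeal :=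
  (ProjectiveSpectrum.le_iff_mem_closure (stdGrading K 2) q p).symm

lemma specializes_iff {p q : projSpace K 2} :
    q ⤳ p ↔ ∀ F, F ∈ q.asHomogeneousIdeal → F ∈ p.asHomogeneousIdeal := by
  rw [specializes_iff_mem_closure, mem_closure_singleton_iff]

lemma mem_iff_component (p : projSpace K 2) {F : MvPolynomial (Fin 3) K} :
    F ∈ p.asHomogeneousIdeal ↔ ∀ n, homogeneousComponent n F ∈ p.asHomogeneousIdeal :=
  mem_iff_homogeneousComponent_mem p.asHomogeneousIdeal.isHomogeneous F

/-- Points of the plane are determined by the forms that vanish at them. -/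
lemma specializes_of_forms {p q : projSpace K 2}
    (h : ∀ (n : ℕ) (F : MvPolynomial (Fin 3) K), F.IsHomogeneous n →
      F ∈ q.asHomogeneousIdeal → F ∈ p.asHomogeneousIdeal) : q ⤳ p := by
  rw [specializes_iff]
  intro F hF
  rw [mem_iff_component]
  rw [mem_iff_component] at hF
  exact fun n => h n _ (homogeneousComponent_isHomogeneous _ _) (hF n)

lemma ext_point {p q : projSpace K 2}
    (h : ∀ F, F ∈ q.asHomogeneousIdeal ↔ F ∈ p.asHomogeneousIdeal) : q = p :=
  (specializes_iff.mpr fun F => (h F).1).antisymm (specializes_iff.mpr fun F => (h F).2) |>.eq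

/-- The generic point of the plane. -/
def planeGeneric : projSpace K 2 :=
  pointOfIdeal ⊥ Ideal.isPrime_bot (by simp) ⟨0, by simp⟩

lemma planeGeneric_specializes (p : projSpace K 2) : planeGeneric ⤳ p := by
  rw [specializes_iff]
  intro F hF
  have : F = 0 := hF
  rw [this]
  exact zero_mem p.asHomogeneousIdeal.toIdeal

lemma exists_X_not_dvd {P : MvPolynomial (Fin 3) K} (hP : Irreducible P) : ∃ i, ¬ P ∣ X i := by
  by_contra! h
  have h1 : IsRelPrime (X 0 : MvPolynomial (Fin 3) K) (X 1) := by
    refine (Irreducible.isRelPrime_iff_not_dvd X_prime.irreducible).mpr ?_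
    rw [X_dvd_X]
    simp
  exact hP.not_isUnit (h1 (h 0) (h 1))

/-- The generic point of the plane curve `{P = 0}`. -/
def curvePoint {P : MvPolynomial (Fin 3) K} (hP : Irreducible P) (hom : ∃ n, P.IsHomogeneous n) :
    projSpace K 2 :=
  pointOfIdeal (Ideal.span {P}) ((Ideal.span_singleton_prime hP.ne_zero).mpr hP.prime)
    (by
      obtain ⟨n, hn⟩ := hom
      intro F hF m
      have h1 : (Ideal.span {P}).IsHomogeneous (homogeneousSubmodule (Fin 3) K) := by
        apply Ideal.homogeneous_span
        rintro _ rfl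
        exact ⟨n, hn⟩
      exact homogeneousComponent_mem_of_mem h1 hF m)
    (by
      obtain ⟨i, hi⟩ := exists_X_not_dvd hP
      exact ⟨i, by rwa [Ideal.mem_span_singleton]⟩)

lemma mem_curvePoint {P : MvPolynomial (Fin 3) K} (hP : Irreducible P)
    (hom : ∃ n, P.IsHomogeneous n) {F : MvPolynomial (Fin 3) K} :
    F ∈ (curvePoint hP hom).asHomogeneousIdeal ↔ P ∣ F := by
  rw [curvePoint, mem_pointOfIdeal, Ideal.mem_span_singleton]

lemma closure_curvePoint {P : MvPolynomial (Fin 3) K} (hP : Irreducible P)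
    (hom : ∃ n, P.IsHomogeneous n) : closure {curvePoint hP hom} = zeroSet P := by
  ext p
  rw [mem_closure_singleton_iff]
  constructor
  · intro h
    exact h P ((mem_curvePoint hP hom).mpr dvd_rfl)
  · intro h F hF
    obtain ⟨G, rfl⟩ := (mem_curvePoint hP hom).mp hF
    exact Ideal.mul_mem_right G p.asHomogeneousIdeal.toIdeal h

/-- The homomorphism `Xᵢ ↦ aᵢ T`. -/
def coneHom (a : Fin 3 → K) : MvPolynomial (Fin 3) K →+* Polynomial K :=
  (Polynomial.mapRingHom (eval a)).comp (gradingHom (σ := Fin 3) (R := K)).toRingHom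

lemma coneHom_eq_zero_iff {a : Fin 3 → K} {F : MvPolynomial (Fin 3) K} :
    coneHom a F = 0 ↔ ∀ n, eval a (homogeneousComponent n F) = 0 := by
  rw [Polynomial.ext_iff]
  simp [coneHom, coeff_gradingHom]

lemma coneHom_eq_zero_iff_of_isHomogeneous {a : Fin 3 → K} {F : MvPolynomial (Fin 3) K} {n : ℕ}
    (hF : F.IsHomogeneous n) : coneHom a F = 0 ↔ eval a F = 0 := by
  simp [coneHom, gradingHom_of_isHomogeneous hF]

/-- The `K`-rational point with homogeneous coordinates `a`. -/
def ratPoint {a : Fin 3 → K} (ha : a ≠ 0) : projSpace K 2 :=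
  -- The kernel is prime because `K[T]` is a domain, and homogeneous because the coefficient of `T ^
  -- n` is the value at `a` of the component of degree `n`.
  pointOfIdeal (RingHom.ker (coneHom a)) (RingHom.ker_isPrime _)
    (by
      intro F hF n
      rw [RingHom.mem_ker, coneHom_eq_zero_iff_of_isHomogeneous
        (homogeneousComponent_isHomogeneous _ _)]
      exact coneHom_eq_zero_iff.mp hF n)
    (by
      obtain ⟨i, hi⟩ := Function.ne_iff.mp ha
      refine ⟨i, ?_⟩
      rw [RingHom.mem_ker, coneHom_eq_zero_iff_of_isHomogeneous (isHomogeneous_X K i)]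
      simpa using hi)

lemma mem_ratPoint {a : Fin 3 → K} (ha : a ≠ 0) {F : MvPolynomial (Fin 3) K} {n : ℕ}
    (hF : F.IsHomogeneous n) : F ∈ (ratPoint ha).asHomogeneousIdeal ↔ eval a F = 0 := by
  rw [ratPoint, mem_pointOfIdeal, RingHom.mem_ker, coneHom_eq_zero_iff_of_isHomogeneous hF]

lemma isUnit_of_isHomogeneous_zero {F : MvPolynomial (Fin 3) K} (hF : F.IsHomogeneous 0)
    (h0 : F ≠ 0) : IsUnit F := by
  have h1 := totalDegree_eq_zero_iff_eq_C.mp (hF.totalDegree h0)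
  rw [h1]
  refine IsUnit.map C (isUnit_iff_ne_zero.mpr ?_)
  intro h2
  rw [h2, C_0] at h1
  exact h0 h1

/-- The factors of a linear form are forms whose degrees add up to one, so one of them is a non-zero
constant. -/
lemma irreducible_of_linear {F : MvPolynomial (Fin 3) K} (hF : F.IsHomogeneous 1)
    (h0 : F ≠ 0) : Irreducible F := by
  refine ⟨?_, ?_⟩
  · intro h
    have h1 := hF.totalDegree h0
    rw [(isUnit_iff_totalDegree_of_isReduced.mp h).2] at h1
    exact zero_ne_one h1
  · rintro a b rfl
    have ha := left_ne_zero_of_mul h0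
    have hb := right_ne_zero_of_mul h0
    obtain ⟨m, hm⟩ := hF.of_mul_left h0
    obtain ⟨n, hn⟩ := hF.of_dvd h0 (Dvd.intro_left a rfl)
    have h1 := (hm.mul hn).inj_right hF h0
    rcases Nat.eq_zero_or_pos m with rfl | hm'
    · exact Or.inl (isUnit_of_isHomogeneous_zero hm ha)
    · obtain rfl : n = 0 := by omega
      exact Or.inr (isUnit_of_isHomogeneous_zero hn hb)

/-- The form `P` has a zero `a`, and the rational point `a` lies in the closure of the generic point
of the curve. If the two points were equal, `P` would divide all linear forms vanishing at `a`,
among which two are not proportional. This is what keeps generic points of curves away from the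
images of contracted curves. -/
lemma not_isClosed_curvePoint [IsAlgClosed K] {P : MvPolynomial (Fin 3) K} (hP : Irreducible P)
    (hom : ∃ n, P.IsHomogeneous n) : ¬ IsClosed {curvePoint hP hom} := by
  intro hcl
  obtain ⟨n, hn⟩ := hom
  obtain ⟨a, ha, hPa⟩ := exists_eval_eq_zero_of_not_isUnit hP.not_isUnit
  have h1 : ratPoint ha ∈ closure {curvePoint hP ⟨n, hn⟩} := by
    rw [closure_curvePoint]
    exact (mem_ratPoint ha hn).mpr hPa
  rw [hcl.closure_eq, Set.mem_singleton_iff] at h1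
  have key : ∀ L : MvPolynomial (Fin 3) K, L.IsHomogeneous 1 → eval a L = 0 → P ∣ L := by
    intro L hL hLa
    rw [← mem_curvePoint hP ⟨n, hn⟩, ← h1]
    exact (mem_ratPoint ha hL).mpr hLa
  obtain ⟨i, hi⟩ := Function.ne_iff.mp ha
  have hi : a i ≠ 0 := hi
  obtain ⟨j, k, hji, hki, hjk⟩ : ∃ j k : Fin 3, j ≠ i ∧ k ≠ i ∧ j ≠ k := by
    fin_cases i
    · exact ⟨1, 2, by decide⟩
    · exact ⟨0, 2, by decide⟩
    · exact ⟨0, 1, by decide⟩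
  -- For `j ≠ i` these are the equations of two different lines through `a`; the coefficients of the
  -- variables other than `X i` tell them apart.
  have hhom : ∀ j : Fin 3, (C (a i) * X j - C (a j) * X i : MvPolynomial (Fin 3) K).IsHomogeneous 1 :=
    fun j => (isHomogeneous_C_mul_X _ _).sub (isHomogeneous_C_mul_X _ _)
  have hdvd : ∀ j : Fin 3, P ∣ (C (a i) * X j - C (a j) * X i) := fun j =>
    key _ (hhom j) (by simp; ring)
  have hcoeff : ∀ j l : Fin 3, l ≠ i → coeff (Finsupp.single l 1)
      (C (a i) * X j - C (a j) * X i : MvPolynomial (Fin 3) K) = if j = l then a i else 0 := by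
    intro j l hl
    simp [coeff_C_mul, coeff_X, Finsupp.single_left_inj, hl.symm]
  have hne : ∀ j : Fin 3, j ≠ i → (C (a i) * X j - C (a j) * X i : MvPolynomial (Fin 3) K) ≠ 0 := by
    intro j hj h0
    have := hcoeff j j hj
    rw [h0] at this
    simp [hi.symm] at this
  have h2 : Associated (C (a i) * X j - C (a j) * X i : MvPolynomial (Fin 3) K)
      (C (a i) * X k - C (a k) * X i) :=
    (hP.associated_of_dvd (irreducible_of_linear (hhom j) (hne j hji)) (hdvd j)).symm.trans
      (hP.associated_of_dvd (irreducible_of_linear (hhom k) (hne k hki)) (hdvd k))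
  obtain ⟨u, hu⟩ := h2
  have hu1 := totalDegree_eq_zero_iff_eq_C.mp (isUnit_iff_totalDegree_of_isReduced.mp u.isUnit).2
  rw [hu1, mul_comm] at hu
  have h3 := hcoeff k k hki
  rw [← hu, coeff_C_mul, hcoeff j k hki] at h3
  simp [hjk, hi.symm] at h3

/-- Finitely many points of the plane can be avoided by a line. -/
lemma exists_linear_notMem [Infinite K] {s : Set (projSpace K 2)} (hs : s.Finite) :
    ∃ M : MvPolynomial (Fin 3) K, M.IsHomogeneous 1 ∧ ∀ p ∈ s, M ∉ p.asHomogeneousIdeal := by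
  classical
  let W : projSpace K 2 → Submodule K (stdGrading K 2 1) := fun p =>
    (p.asHomogeneousIdeal.toIdeal.restrictScalars K).comap (stdGrading K 2 1).subtype
  have hW : ⊤ ∉ hs.toFinset.image W := by
    intro h
    obtain ⟨p, -, hp⟩ := Finset.mem_image.mp h
    obtain ⟨i, hi⟩ := exists_X_notMem p
    have h1 : (⟨X i, isHomogeneous_X K i⟩ : stdGrading K 2 1) ∈ W p := hp ▸ Submodule.mem_top
    exact hi h1
  -- Over an infinite field a vector space is not a finite union of proper subspaces; here these
  -- consist of the linear forms vanishing at one of the points.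
  have h := Subspace.biUnion_ne_univ_of_top_notMem hW
  obtain ⟨M, hM⟩ := (Set.ne_univ_iff_exists_notMem _).mp h
  refine ⟨M.1, M.2, fun p hp hMp => hM ?_⟩
  simp only [Set.mem_iUnion]
  exact ⟨W p, Finset.mem_image_of_mem _ (hs.mem_toFinset.mpr hp), hMp⟩

end DelPezzo

end

/-! ### The valuation of a plane curve on the surface. -/

noncomputable section

namespace DelPezzo

namespace Surface

open MvPolynomial

variable {K : Type u} [Field K] {S : Surface K}

/-! ### Orders along prime divisors -/

lemma ord_algebraMap (x : S.PrimeDivisor) {a : S.X.presheaf.stalk x.1} (ha : a ≠ 0) {n : ℕ}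
    (hn : Ring.ord (S.X.presheaf.stalk x.1) a = n) :
    ord (algebraMap (S.X.presheaf.stalk x.1) S.FunField a) x = n := by
  have ha' : algebraMap (S.X.presheaf.stalk x.1) S.FunField a ≠ 0 := by
    rwa [Ne, map_eq_zero_iff _ (IsFractionRing.injective _ _)]
  have : Ring.KrullDimLE 1 (S.X.presheaf.stalk x.1) := krullDimLE_of_coheight_le x.2.le
  refine (Scheme.ord_eq_iff x.2 ha').mpr ?_
  refine (Ring.ordFrac_eq_ord _ ha).trans ?_
  exact Ring.ordMonoidWithZeroHom_eq_coe _ (mem_nonZeroDivisors_of_ne_zero ha) hn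

lemma ord_algebraMap_of_isUnit (x : S.PrimeDivisor) {a : S.X.presheaf.stalk x.1} (ha : IsUnit a) :
    ord (algebraMap (S.X.presheaf.stalk x.1) S.FunField a) x = 0 :=
  ord_algebraMap x ha.ne_zero (n := 0) (by rw [Ring.ord_of_isUnit ha]; rfl)

lemma ord_algebraMap_of_irreducible (x : S.PrimeDivisor) {a : S.X.presheaf.stalk x.1}
    (ha : Irreducible a) : ord (algebraMap (S.X.presheaf.stalk x.1) S.FunField a) x = 1 :=
  ord_algebraMap x ha.ne_zero (n := 1) (by rw [Ring.ord_of_irreducible ha]; rfl)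

lemma ord_one (x : S.PrimeDivisor) : ord (1 : S.FunField) x = 0 := by
  have := ord_const (S := S) (one_ne_zero (α := K)) x
  rwa [map_one] at this

lemma ord_inv {f : S.FunField} (hf : f ≠ 0) (x : S.PrimeDivisor) :
    ord f⁻¹ x = -ord f x := by
  have h := ord_mul hf (inv_ne_zero hf) x
  rw [mul_inv_cancel₀ hf, ord_one] at h
  omega

lemma ord_pow {f : S.FunField} (hf : f ≠ 0) (n : ℕ) (x : S.PrimeDivisor) :
    ord (f ^ n) x = n * ord f x := by
  induction n with
  | zero => simp [ord_one]
  | succ n ih =>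
    rw [pow_succ, ord_mul (pow_ne_zero n hf) hf, ih]
    push_cast
    ring

lemma PrimeDivisor.ne_genericPoint (x : S.PrimeDivisor) : x.1 ≠ genericPoint S.X := by
  intro h
  have h1 : IsMax x.1 := by
    rw [h]
    intro y _
    exact genericPoint_specializes y
  have h2 := x.2
  rw [Order.coheight_eq_zero.mpr h1] at h2
  exact zero_ne_one h2

/-- A proper specialization raises the coheight by at least one. -/
lemma PrimeDivisor.eq_of_specializes {x y : S.PrimeDivisor} (h : x.1 ⤳ y.1) : x = y := by
  by_contra hne
  have hlt : y.1 < x.1 := by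
    refine lt_of_le_not_ge h fun h' => hne ?_
    exact Subtype.ext ((show x.1 ⤳ y.1 from h).antisymm (show y.1 ⤳ x.1 from h')).eq
  have h1 := Order.coheight_add_one_le hlt
  rw [x.2, y.2] at h1
  norm_num at h1

lemma genericPoint_notMem_supp (D : S.Div) : genericPoint S.X ∉ supp D := by
  intro h
  simp only [supp, Set.mem_iUnion] at h
  obtain ⟨x, -, hx⟩ := h
  have h1 : x.1 ⤳ genericPoint S.X := specializes_iff_mem_closure.mpr hx
  exact x.ne_genericPoint ((genericPoint_specializes x.1).antisymm h1).eq.symm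

/-! ### Local rings along plane curves -/

variable {ρ : S.X ⟶ projSpace K 2}

/-- Pullback is a local homomorphism, so units can be tested on the plane, where `b / a` is the
inverse of `a / b` as soon as `a` does not vanish at the point. -/
lemma isUnit_pullbackStalk_iff {x : S.X} {n : ℕ} {a b : stdGrading K 2 n}
    (hb : (b : MvPolynomial (Fin 3) K) ∉ (ρ x).asHomogeneousIdeal) :
    IsUnit (pullbackStalk ρ x (HomogeneousLocalization.mk ⟨n, a, b, hb⟩)) ↔
      (a : MvPolynomial (Fin 3) K) ∉ (ρ x).asHomogeneousIdeal := by
  rw [isUnit_map_iff]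
  constructor
  · intro h ha
    have h1 : IsUnit (algebraMap (planeStalk (ρ x))
        (Localization.AtPrime (ρ x).asHomogeneousIdeal.toIdeal)
        (HomogeneousLocalization.mk ⟨n, a, b, hb⟩)) := h.map _
    rw [HomogeneousLocalization.algebraMap_apply, HomogeneousLocalization.val_mk,
      Localization.mk_eq_mk', IsLocalization.AtPrime.isUnit_mk'_iff] at h1
    exact h1 ha
  · intro ha
    refine IsUnit.of_mul_eq_one (HomogeneousLocalization.mk ⟨n, b, a, ha⟩) ?_
    rw [HomogeneousLocalization.ext_iff_val, HomogeneousLocalization.val_mul,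
      HomogeneousLocalization.val_mk, HomogeneousLocalization.val_mk,
      HomogeneousLocalization.val_one, Localization.mk_mul, ← Localization.mk_one,
      Localization.mk_eq_mk_iff, Localization.r_iff_exists]
    refine ⟨1, ?_⟩
    simp
    ring

section Curve

variable {P : MvPolynomial (Fin 3) K} {hP : Irreducible P} {hom : ∃ n, P.IsHomogeneous n}

/-- The local equation of a plane curve generates the maximal ideal of the local ring. -/
lemma maximalIdeal_eq_span {x : S.X} (hbij : Function.Bijective (pullbackStalk ρ x))
    (hx : ρ x = curvePoint hP hom) {n : ℕ} {a b : stdGrading K 2 n}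
    (ha : (a : MvPolynomial (Fin 3) K) = P)
    (hb : (b : MvPolynomial (Fin 3) K) ∉ (ρ x).asHomogeneousIdeal) :
    IsLocalRing.maximalIdeal (S.X.presheaf.stalk x) =
      Ideal.span {pullbackStalk ρ x (HomogeneousLocalization.mk ⟨n, a, b, hb⟩)} := by
  have hmem : ∀ F, F ∈ (ρ x).asHomogeneousIdeal ↔ P ∣ F := by
    intro F
    rw [hx]
    exact mem_curvePoint hP hom
  apply le_antisymm
  · intro z hz
    obtain ⟨z, rfl⟩ := hbij.2 z
    obtain ⟨⟨N, c, d, hd⟩, rfl⟩ := HomogeneousLocalization.mk_surjective z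
    rw [IsLocalRing.mem_maximalIdeal, mem_nonunits_iff, isUnit_pullbackStalk_iff hd, not_not,
      hmem] at hz
    obtain ⟨G, hG⟩ := hz
    by_cases hc0 : (c : MvPolynomial (Fin 3) K) = 0
    · have : HomogeneousLocalization.mk ⟨N, c, d, hd⟩ = (0 : planeStalk (ρ x)) := by
        rw [HomogeneousLocalization.ext_iff_val, HomogeneousLocalization.val_mk,
          HomogeneousLocalization.val_zero]
        simp only [hc0]
        exact Localization.mk_zero _
      rw [this, map_zero]
      exact zero_mem _
    · obtain ⟨m, hm⟩ := IsHomogeneous.of_dvd c.2 hc0 (Dvd.intro_left P hG.symm)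
      have hP1 : P.IsHomogeneous n := ha ▸ a.2
      have hN : n + m = N := by
        refine (hP1.mul hm).inj_right ?_ ?_
        · rw [← hG]; exact c.2
        · rw [← hG]; exact hc0
      subst hN
      rw [Ideal.mem_span_singleton]
      -- With `c = P G` the cofactor of `P / b` in `c / d` is `G b / d`, whose numerator and
      -- denominator both have degree `n + m`.
      have hbG : G * b ∈ stdGrading K 2 (n + m) := by
        have h5 := hm.mul b.2
        rwa [add_comm m n] at h5
      refine ⟨pullbackStalk ρ x (HomogeneousLocalization.mk ⟨n + m, ⟨G * b, hbG⟩, d, hd⟩), ?_⟩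
      rw [← map_mul]
      congr 1
      rw [HomogeneousLocalization.ext_iff_val, HomogeneousLocalization.val_mul,
        HomogeneousLocalization.val_mk, HomogeneousLocalization.val_mk,
        HomogeneousLocalization.val_mk, Localization.mk_mul,
        Localization.mk_eq_mk_iff, Localization.r_iff_exists]
      refine ⟨1, ?_⟩
      simp only [OneMemClass.coe_one, one_mul, Submonoid.coe_mul, ha, hG]
      ring
  · rw [Ideal.span_le, Set.singleton_subset_iff]
    change _ ∈ IsLocalRing.maximalIdeal (S.X.presheaf.stalk x)
    rw [IsLocalRing.mem_maximalIdeal, mem_nonunits_iff, isUnit_pullbackStalk_iff hb, not_not,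
      hmem, ha]

lemma exists_linear_notMem_point (p : projSpace K 2) :
    ∃ m : MvPolynomial (Fin 3) K, m.IsHomogeneous 1 ∧ m ∉ p.asHomogeneousIdeal := by
  obtain ⟨i, hi⟩ := exists_X_notMem p
  exact ⟨MvPolynomial.X i, isHomogeneous_X K i, hi⟩

lemma pow_notMem {p : projSpace K 2} {m : MvPolynomial (Fin 3) K}
    (hm : m ∉ p.asHomogeneousIdeal) (n : ℕ) : m ^ n ∉ p.asHomogeneousIdeal := fun h =>
  hm ((isPrime_asHomogeneousIdeal (stdGrading K 2) p).mem_of_pow_mem n h)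

lemma pow_mem_stdGrading {m : MvPolynomial (Fin 3) K} (hm : m.IsHomogeneous 1) (n : ℕ) :
    m ^ n ∈ stdGrading K 2 n := by
  have := hm.pow n
  rwa [one_mul] at this

lemma pullbackStalk_mk_ne_zero (h : Function.Bijective (pullbackStalk ρ (genericPoint S.X)))
    {x : S.X} {n : ℕ} {a b : stdGrading K 2 n} (ha : (a : MvPolynomial (Fin 3) K) ≠ 0)
    (hb : (b : MvPolynomial (Fin 3) K) ∉ (ρ x).asHomogeneousIdeal) :
    pullbackStalk ρ x (HomogeneousLocalization.mk ⟨n, a, b, hb⟩) ≠ 0 := by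
  intro h0
  have h1 := toFrac_pullbackStalk h x a b hb
  rw [h0, map_zero, map_zero, eq_comm, div_eq_zero_iff,
    map_eq_zero_iff _ (IsFractionRing.injective _ _),
    map_eq_zero_iff _ (IsFractionRing.injective _ _)] at h1
  rcases h1 with h1 | h1
  · exact ha h1
  · exact hb (h1 ▸ zero_mem (ρ x).asHomogeneousIdeal.toIdeal)

lemma irreducible_pullbackStalk (h : Function.Bijective (pullbackStalk ρ (genericPoint S.X)))
    {x : S.X} (hbij : Function.Bijective (pullbackStalk ρ x))
    (hx : ρ x = curvePoint hP hom) {n : ℕ} {a b : stdGrading K 2 n}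
    (ha : (a : MvPolynomial (Fin 3) K) = P)
    (hb : (b : MvPolynomial (Fin 3) K) ∉ (ρ x).asHomogeneousIdeal) :
    Irreducible (pullbackStalk ρ x (HomogeneousLocalization.mk ⟨n, a, b, hb⟩)) := by
  have hne := pullbackStalk_mk_ne_zero h (x := x) (a := a) (ha ▸ hP.ne_zero) hb
  have h1 := maximalIdeal_eq_span hbij hx ha hb
  refine Prime.irreducible ((Ideal.span_singleton_prime hne).mp ?_)
  rw [← h1]
  infer_instance

/-- The local ring has a non-zero principal maximal ideal, so it is a discrete valuation ring, and
its dimension is the coheight of `x`. This makes the preimage of the generic point of a plane curve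
a prime divisor. -/
lemma coheight_eq_one (h : Function.Bijective (pullbackStalk ρ (genericPoint S.X)))
    {x : S.X} (hbij : Function.Bijective (pullbackStalk ρ x))
    (hx : ρ x = curvePoint hP hom) : coheight x = 1 := by
  obtain ⟨m, hm, hmx⟩ := exists_linear_notMem_point (ρ x)
  obtain ⟨n, hn⟩ := hom
  have hb := pow_notMem hmx n
  have hirr := irreducible_pullbackStalk h hbij hx (a := ⟨P, hn⟩)
    (b := ⟨m ^ n, pow_mem_stdGrading hm n⟩) rfl hb
  have h1 := maximalIdeal_eq_span hbij hx (a := ⟨P, hn⟩)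
    (b := ⟨m ^ n, pow_mem_stdGrading hm n⟩) rfl hb
  have hf : ¬ IsField (S.X.presheaf.stalk x) := by
    intro hf
    have := IsLocalRing.isField_iff_maximalIdeal_eq.mp hf
    rw [h1, Ideal.span_singleton_eq_bot] at this
    exact hirr.ne_zero this
  have hprin : (IsLocalRing.maximalIdeal (S.X.presheaf.stalk x)).IsPrincipal := ⟨_, h1⟩
  have hdvr : IsDiscreteValuationRing (S.X.presheaf.stalk x) :=
    ((IsDiscreteValuationRing.TFAE _ hf).out 0 4).mpr hprin
  have h2 := ringKrullDim_stalk_eq_coheight x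
  rw [IsPrincipalIdealRing.ringKrullDim_eq_one _ hf] at h2
  exact_mod_cast h2.symm

/-- Write `A = P ^ α * G` with `P ∤ G`. Dividing by powers of the linear form `m`, which does not
vanish at the point, gives `f = π ^ α * w` with a uniformizer `π` and a unit `w`. -/
lemma ord_toFrac_pow (h : Function.Bijective (pullbackStalk ρ (genericPoint S.X)))
    {x : S.PrimeDivisor} (hbij : Function.Bijective (pullbackStalk ρ x.1))
    (hx : ρ x.1 = curvePoint hP hom) {m : MvPolynomial (Fin 3) K} (hm : m.IsHomogeneous 1)
    (hmx : m ∉ (ρ x.1).asHomogeneousIdeal) {N : ℕ} {A : MvPolynomial (Fin 3) K}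
    (hA : A.IsHomogeneous N) (hA0 : A ≠ 0) {f : S.FunField}
    (hf : toFrac h f = algebraMap _ (FractionRing (MvPolynomial (Fin 3) K)) A /
      algebraMap _ (FractionRing (MvPolynomial (Fin 3) K)) (m ^ N)) :
    ord f x = multiplicity P A := by
  obtain ⟨n, hn⟩ := id hom
  obtain ⟨G, hG, hPG⟩ := (FiniteMultiplicity.of_prime_left hP.prime hA0).exists_eq_pow_mul_and_not_dvd
  set α := multiplicity P A
  have hG0 : G ≠ 0 := by
    rintro rfl
    exact hPG (dvd_zero _)
  obtain ⟨l, hl⟩ := hA.of_dvd hA0 (Dvd.intro_left _ hG.symm)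
  have hN : N = n * α + l :=
    hA.inj_right (hG ▸ (hn.pow α).mul hl) hA0
  have hm0 : m ≠ 0 := fun h0 => hmx (h0 ▸ zero_mem (ρ x.1).asHomogeneousIdeal.toIdeal)
  have hm0' : algebraMap _ (FractionRing (MvPolynomial (Fin 3) K)) m ≠ 0 := by simpa using hm0
  set π := pullbackStalk ρ x.1 (HomogeneousLocalization.mk
    ⟨n, ⟨P, hn⟩, ⟨m ^ n, pow_mem_stdGrading hm n⟩, pow_notMem hmx n⟩) with hπ
  set w := pullbackStalk ρ x.1 (HomogeneousLocalization.mk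
    ⟨l, ⟨G, hl⟩, ⟨m ^ l, pow_mem_stdGrading hm l⟩, pow_notMem hmx l⟩) with hw
  have hπirr : Irreducible π := irreducible_pullbackStalk h hbij hx rfl _
  have hwu : IsUnit w := by
    rw [hw, isUnit_pullbackStalk_iff, hx]
    intro h1
    exact hPG ((mem_curvePoint hP hom).mp h1)
  have key : f = (algebraMap (S.X.presheaf.stalk x.1) S.FunField π) ^ α *
      algebraMap (S.X.presheaf.stalk x.1) S.FunField w := by
    apply (toFrac h).injective
    rw [map_mul, map_pow, toFrac_pullbackStalk, toFrac_pullbackStalk, hf, hG, hN]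
    simp only [map_mul, map_pow]
    have alg : ∀ p g μ : FractionRing (MvPolynomial (Fin 3) K), μ ≠ 0 →
        p ^ α * g / μ ^ (n * α + l) = (p / μ ^ n) ^ α * (g / μ ^ l) := by
      intro p g μ hμ
      rw [div_pow, ← pow_mul, div_mul_div_comm, ← pow_add]
    exact alg _ _ _ hm0'
  have h1 := ord_algebraMap_of_irreducible x hπirr
  have h2 := ord_algebraMap_of_isUnit x hwu
  have hπ0 : algebraMap (S.X.presheaf.stalk x.1) S.FunField π ≠ 0 := by
    rw [Ne, map_eq_zero_iff _ (IsFractionRing.injective _ _)]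
    exact hπirr.ne_zero
  have hw0 : algebraMap (S.X.presheaf.stalk x.1) S.FunField w ≠ 0 := by
    rw [Ne, map_eq_zero_iff _ (IsFractionRing.injective _ _)]
    exact hwu.ne_zero
  rw [key, ord_mul (pow_ne_zero _ hπ0) hw0, ord_pow hπ0, h1, h2]
  ring

/-- A homogeneous fraction `a / b` is the quotient of `a / m ^ N` and `b / m ^ N`, where the line
`m` avoids the point, so that `ord_toFrac_pow` applies to both. -/
lemma ord_eq_fracOrd (h : Function.Bijective (pullbackStalk ρ (genericPoint S.X)))
    (hbot : (ρ (genericPoint S.X)).asHomogeneousIdeal = ⊥)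
    {x : S.PrimeDivisor} (hbij : Function.Bijective (pullbackStalk ρ x.1))
    (hx : ρ x.1 = curvePoint hP hom) {f : S.FunField} (hf : f ≠ 0) :
    ord f x = fracOrd P (toFrac h f) := by
  obtain ⟨m, hm, hmx⟩ := exists_linear_notMem_point (ρ x.1)
  obtain ⟨N, a, b, hb, hab⟩ := exists_toFrac_eq h f
  have hm0 : m ≠ 0 := fun h0 => hmx (h0 ▸ zero_mem (ρ x.1).asHomogeneousIdeal.toIdeal)
  have hm0' : algebraMap _ (FractionRing (MvPolynomial (Fin 3) K)) (m ^ N) ≠ 0 := by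
    simpa using fun h0 => absurd h0 hm0
  have ha : (a : MvPolynomial (Fin 3) K) ≠ 0 := by
    intro h0
    rw [h0, map_zero, zero_div, map_eq_zero] at hab
    exact hf hab
  have hb' : algebraMap _ (FractionRing (MvPolynomial (Fin 3) K)) (b : MvPolynomial (Fin 3) K) ≠ 0 := by
    simpa using hb
  obtain ⟨f₁, hf₁⟩ := exists_of_ratio h hbot a ⟨m ^ N, pow_mem_stdGrading hm N⟩ (pow_ne_zero _ hm0)
  obtain ⟨f₂, hf₂⟩ := exists_of_ratio h hbot b ⟨m ^ N, pow_mem_stdGrading hm N⟩ (pow_ne_zero _ hm0)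
  have h1 := ord_toFrac_pow h hbij hx hm hmx a.2 ha hf₁
  have h2 := ord_toFrac_pow h hbij hx hm hmx b.2 hb hf₂
  have h3 : f * f₂ = f₁ := by
    apply (toFrac h).injective
    rw [map_mul, hab, hf₁, hf₂]
    field_simp
  have hf₂0 : f₂ ≠ 0 := by
    rintro rfl
    rw [map_zero, eq_comm, div_eq_zero_iff] at hf₂
    exact hf₂.elim hb' hm0'
  rw [hab, fracOrd_div hP.prime ha hb, ← h1, ← h2, ← h3, ord_mul hf hf₂0]
  ring

end Curve

end Surface
end DelPezzo

end

/-! ### Constants of the function field as constant polynomials. -/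

noncomputable section

namespace DelPezzo

section Constants

/-- The morphism `Proj.toSpecZero` is built from the chart of the element `1`, which equals all of
`Proj` only propositionally. This identifies the resulting transport of sections with a restriction
map. -/
lemma topIso_inv_comp_isoOfEq (X : Scheme.{u}) (U : X.Opens) (e : U = ⊤) :
   U.topIso.inv ≫ (X.isoOfEq e).inv.appTop ≫ X.topIso.inv.appTop = X.presheaf.map (eqToHom e.symm).op := by
  have h1 : X.presheaf.map (eqToHom e).op ≫ U.topIso.inv = U.ι.appTop := by
    simp only [Scheme.Hom.appTop, Scheme.Opens.ι_app, Scheme.Opens.topIso_inv]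
    refine (X.presheaf.map_comp _ _).symm.trans ?_
    exact congrArg _ (Subsingleton.elim _ _)
  rw [← cancel_epi (X.presheaf.map (eqToHom e).op), reassoc_of% h1, ← Functor.map_comp,
     ← Scheme.Hom.comp_appTop, ← Scheme.Hom.comp_appTop, Category.assoc, Scheme.isoOfEq_inv_ι, Scheme.toIso_inv_ι]
  simp 

variable {σ : Type*} {A : Type u} [CommRing A] [SetLike σ A] [AddSubgroupClass σ A]
  (𝒜 : ℕ → σ) [GradedRing 𝒜]

lemma ΓSpecIso_inv_comp_toSpecZero : (Scheme.ΓSpecIso (.of (𝒜 0))).inv ≫ (Proj.toSpecZero 𝒜).appTop = 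
   CommRingCat.ofHom (HomogeneousLocalization.fromZeroRingHom 𝒜 (Submonoid.powers 1)) ≫ Proj.awayToSection 𝒜 1 ≫ (Proj 𝒜).presheaf.map (eqToHom (Proj.basicOpen_one 𝒜).symm).op := by
  have h2 : (Proj.basicOpenToSpec 𝒜 1).appTop = _ := Proj.basicOpenToSpec_app_top 𝒜 1
  have h1 := Scheme.ΓSpecIso_inv_naturality (CommRingCat.ofHom (HomogeneousLocalization.fromZeroRingHom 𝒜 (Submonoid.powers 1)))
  rw [← topIso_inv_comp_isoOfEq (Proj 𝒜) _ (Proj.basicOpen_one 𝒜), Proj.toSpecZero, Scheme.Hom.comp_appTop, Scheme.Hom.comp_appTop, Scheme.Hom.comp_appTop]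
  simp only [Category.assoc]
  rw [← reassoc_of% h1, h2]
  simp
  rfl
lemma germ_toSpecZero (p : Proj 𝒜) (a : 𝒜 0) (h) : (Proj 𝒜).presheaf.germ ⊤ p trivial ((Proj.toSpecZero 𝒜).appTop.hom ((Scheme.ΓSpecIso (.of (𝒜 0))).inv.hom a)) = 
   (Proj.stalkIso 𝒜 p).inv.hom (HomogeneousLocalization.mk ⟨0, a, 1, h⟩) := by
  have h1 : (Scheme.ΓSpecIso (.of (𝒜 0))).inv ≫ (Proj.toSpecZero 𝒜).appTop ≫ (Proj 𝒜).presheaf.germ ⊤ p trivial = CommRingCat.ofHom (HomogeneousLocalization.fromZeroRingHom 𝒜 (Submonoid.powers 1)) ≫ Proj.awayToSection 𝒜 1 ≫ (Proj 𝒜).presheaf.germ _ p (by simp) := by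
    rw [reassoc_of% ΓSpecIso_inv_comp_toSpecZero 𝒜]
    exact congrArg _ (congrArg _ ((Proj 𝒜).presheaf.germ_res (eqToHom (Proj.basicOpen_one 𝒜).symm) p trivial))
  have h2 := congrArg (fun f => f.hom a) h1
  refine h2.trans ?_
  have h3 := congrArg (fun f => f.hom (HomogeneousLocalization.fromZeroRingHom 𝒜 (Submonoid.powers 1) a)) (ProjectiveSpectrum.Proj.awayToSection_germ 𝒜 1 p h)
  refine h3.trans ?_
  simp
  rfl

end Constants

namespace Surface

open MvPolynomial

variable {K : Type u} [Field K] {S : Surface K} {ρ : S.X ⟶ projSpace K 2}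

/-- This is where it matters that `ρ` is a morphism over `K`: the constants of `K(S)` come from the
structure morphism of `S`, those of the plane from its degree zero part. -/
lemma constHom_eq (hρ : ρ ≫ projSpaceStr K 2 = S.str) (c : K)
    (h : (((1 : stdGrading K 2 0) : MvPolynomial (Fin 3) K)) ∉
      (ρ (genericPoint S.X)).asHomogeneousIdeal) :
    algebraMap K S.FunField c = pullbackStalk ρ (genericPoint S.X)
      (HomogeneousLocalization.mk ⟨0, algebraMap K (stdGrading K 2 0) c, 1, h⟩) := by
  have h1 := germ_toSpecZero (stdGrading K 2) (ρ (genericPoint S.X))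
    (algebraMap K (stdGrading K 2 0) c) h
  have h2 : S.str.appTop = (Spec.map (CommRingCat.ofHom
      (algebraMap K (stdGrading K 2 0)))).appTop ≫
      (Proj.toSpecZero (stdGrading K 2)).appTop ≫ ρ.appTop := by
    rw [← hρ, projSpaceStr, Scheme.Hom.comp_appTop, Scheme.Hom.comp_appTop, Category.assoc]
  have h3 := Scheme.ΓSpecIso_inv_naturality (CommRingCat.ofHom (algebraMap K (stdGrading K 2 0)))
  have h4 := Scheme.Hom.germ_stalkMap ρ ⊤ (genericPoint S.X) trivial
  have h5 : (Scheme.ΓSpecIso (.of K)).inv ≫ S.str.appTop ≫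
      S.X.presheaf.germ ⊤ (genericPoint S.X) trivial =
      CommRingCat.ofHom (algebraMap K (stdGrading K 2 0)) ≫
        (Scheme.ΓSpecIso (.of (stdGrading K 2 0))).inv ≫
        (Proj.toSpecZero (stdGrading K 2)).appTop ≫
        (projSpace K 2).presheaf.germ ⊤ (ρ (genericPoint S.X)) trivial ≫
        ρ.stalkMap (genericPoint S.X) := by
    rw [h2, h4]
    simp only [Category.assoc]
    rw [← reassoc_of% h3]
    rfl
  have h6 := congrArg (fun f => f.hom c) h5
  refine h6.trans ?_
  exact congrArg (ρ.stalkMap (genericPoint S.X)).hom h1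

lemma toFrac_const (h : Function.Bijective (pullbackStalk ρ (genericPoint S.X)))
    (hρ : ρ ≫ projSpaceStr K 2 = S.str) (c : K) :
    toFrac h (algebraMap K S.FunField c) =
      algebraMap _ (FractionRing (MvPolynomial (Fin 3) K)) (C c : MvPolynomial (Fin 3) K) := by
  have h1 : ((1 : stdGrading K 2 0) : MvPolynomial (Fin 3) K) ∉
      (ρ (genericPoint S.X)).asHomogeneousIdeal := fun h1 =>
    (isPrime_asHomogeneousIdeal (stdGrading K 2) _).ne_top
      ((Ideal.eq_top_iff_one _).mpr h1)
  have h2 := toFrac_pullbackStalk h (genericPoint S.X) (algebraMap K (stdGrading K 2 0) c) 1 h1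
  rw [algebraMap_pullbackStalk ρ _ _ _ h1 h1, ← constHom_eq hρ] at h2
  rw [h2]
  have h3 : ((1 : stdGrading K 2 0) : MvPolynomial (Fin 3) K) = 1 := rfl
  rw [h3, map_one, div_one]
  rfl

end Surface
end DelPezzo

end

/-! ### The plane model of a contraction. -/

noncomputable section

namespace DelPezzo

open MvPolynomial

instance isIso_stdGrading_zero (K : Type u) [Field K] (n : ℕ) :
    IsIso (CommRingCat.ofHom (algebraMap K (stdGrading K n 0))) := by
  rw [ConcreteCategory.isIso_iff_bijective]
  refine ⟨fun a b h => C_injective (Fin (n + 1)) K (congrArg Subtype.val h), ?_⟩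
  rintro ⟨p, hp⟩
  have hp' : p.IsHomogeneous 0 := hp
  exact ⟨p.coeff 0, Subtype.ext (totalDegree_eq_zero_iff_eq_C.mp
    (Nat.le_zero.mp hp'.totalDegree_le)).symm⟩

instance isProper_projSpaceStr (K : Type u) [Field K] (n : ℕ) : IsProper (projSpaceStr K n) := by
  unfold projSpaceStr
  infer_instance

namespace Surface

variable {K : Type u} [Field K] {S : Surface K} {ρ : S.X ⟶ projSpace K 2}

instance isProper_str : IsProper S.str := by
  obtain ⟨n, i, hi, h⟩ := S.projective
  rw [← h]
  infer_instance

/-- The surface is proper and the plane is separated over `K`, so `ρ` is proper. -/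
lemma isClosedMap_of_str (hρ : ρ ≫ projSpaceStr K 2 = S.str) : IsClosedMap ρ := by
  have h1 : IsProper (ρ ≫ projSpaceStr K 2) := hρ ▸ isProper_str
  have h2 : IsProper ρ := IsProper.of_comp ρ (projSpaceStr K 2)
  exact Scheme.Hom.isClosedMap ρ

/-- A presentation of the function field of `S` as a field of homogeneous fractions, together with
the prime divisors which correspond to the curves in the plane. -/
structure PlaneModel (ρ : S.X ⟶ projSpace K 2) where
  /-- the embedding of the function field -/
  frac : S.FunField →+* FractionRing (MvPolynomial (Fin 3) K)
  frac_const : ∀ c, frac (algebraMap K S.FunField c) = algebraMap _ _ (C c : MvPolynomial (Fin 3) K)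
  exists_eq_ratio : ∀ f, ∃ (n : ℕ) (a b : MvPolynomial (Fin 3) K), a.IsHomogeneous n ∧
    b.IsHomogeneous n ∧ b ≠ 0 ∧ frac f = algebraMap _ _ a / algebraMap _ _ b
  exists_frac_eq : ∀ (n : ℕ) (a b : MvPolynomial (Fin 3) K), a.IsHomogeneous n →
    b.IsHomogeneous n → b ≠ 0 → ∃ f, frac f = algebraMap _ _ a / algebraMap _ _ b
  frac_pullbackQuot : ∀ (x : S.X) (y z : stdGrading K 2 1)
    (hz : ρ x ∉ zeroSet (z : MvPolynomial (Fin 3) K)), frac (pullbackQuot ρ x y z hz) =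
      algebraMap _ _ (y : MvPolynomial (Fin 3) K) / algebraMap _ _ (z : MvPolynomial (Fin 3) K)
  /-- the strict transform of a plane curve -/
  curve : ∀ {P : MvPolynomial (Fin 3) K}, Irreducible P → (∃ n, P.IsHomogeneous n) →
    S.PrimeDivisor
  map_curve : ∀ {P : MvPolynomial (Fin 3) K} (hP : Irreducible P) (hom : ∃ n, P.IsHomogeneous n),
    ρ (curve hP hom).1 = curvePoint hP hom
  ord_curve : ∀ {P : MvPolynomial (Fin 3) K} (hP : Irreducible P) (hom : ∃ n, P.IsHomogeneous n)
    {f : S.FunField}, f ≠ 0 → ord f (curve hP hom) = fracOrd P (frac f)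
  curve_congr : ∀ {P P' : MvPolynomial (Fin 3) K} (hP : Irreducible P)
    (hom : ∃ n, P.IsHomogeneous n) (hP' : Irreducible P') (hom' : ∃ n, P'.IsHomogeneous n),
    Associated P P' → curve hP hom = curve hP' hom'
  isClosedMap : IsClosedMap ρ

namespace PlaneModel

/-- The prime divisor `x` is the strict transform of a curve in the plane. -/
def IsCurve (m : PlaneModel ρ) (x : S.PrimeDivisor) : Prop :=
  ∃ (P : MvPolynomial (Fin 3) K) (hP : Irreducible P) (hom : ∃ n, P.IsHomogeneous n),
    x = m.curve hP hom

end PlaneModel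

/-- The homogeneous prime of a non-generic point contains a non-zero form; by primality it contains
an irreducible factor, and factors of forms are forms. -/
lemma exists_form_factor_mem {p : projSpace K 2} (hp : p ≠ planeGeneric) :
    ∃ (P : MvPolynomial (Fin 3) K) (_ : Irreducible P) (_ : ∃ n, P.IsHomogeneous n),
      P ∈ p.asHomogeneousIdeal := by
  obtain ⟨n, F, hF, hFp, hF0⟩ : ∃ (n : ℕ) (F : MvPolynomial (Fin 3) K), F.IsHomogeneous n ∧
      F ∈ p.asHomogeneousIdeal ∧ F ≠ 0 := by
    by_contra! h
    apply hp
    have h1 : p ⤳ planeGeneric := by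
      refine specializes_of_forms fun n F hF hFp => ?_
      rw [h n F hF hFp]
      exact zero_mem planeGeneric.asHomogeneousIdeal.toIdeal
    exact (h1.antisymm (planeGeneric_specializes p)).eq
  suffices h : ∀ F : MvPolynomial (Fin 3) K, F ≠ 0 → F ∈ p.asHomogeneousIdeal →
      ∃ P, Irreducible P ∧ P ∣ F ∧ P ∈ p.asHomogeneousIdeal by
    obtain ⟨P, hP, hPF, hPp⟩ := h F hF0 hFp
    exact ⟨P, hP, hF.of_dvd hF0 hPF, hPp⟩
  intro F hF0 hFp
  have hprime := isPrime_asHomogeneousIdeal (stdGrading K 2) p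
  induction F using UniqueFactorizationMonoid.induction_on_prime with
  | h₁ => exact absurd rfl hF0
  | h₂ x hx => exact absurd (Ideal.eq_top_of_isUnit_mem _ hFp hx) hprime.ne_top
  | h₃ a q ha hq ih =>
    rcases hprime.mem_or_mem (show q * a ∈ p.asHomogeneousIdeal.toIdeal from hFp) with h | h
    · exact ⟨q, hq.irreducible, Dvd.intro _ rfl, h⟩
    · obtain ⟨P, hP, hPF, hPp⟩ := ih ha h
      exact ⟨P, hP, hPF.mul_left _, hPp⟩

lemma specializes_of_isIso (U : (projSpace K 2).Opens) [IsIso (ρ ∣_ U)] {x y : S.X}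
    (hx : ρ x ∈ U) (hy : ρ y ∈ U) (h : ρ x ⤳ ρ y) : x ⤳ y := by
  have h1 := (Scheme.Hom.isOpenEmbedding ((ρ ∣_ U) ≫ U.ι)).isInducing
  have h2 : (⟨x, hx⟩ : (ρ ⁻¹ᵁ U).toScheme) ⤳ ⟨y, hy⟩ := by
    refine h1.specializes_iff.mp ?_
    rw [morphismRestrict_ι]
    exact h
  exact (ρ ⁻¹ᵁ U).ι.base.hom.map_specializes h2

section Contraction

variable {Cs : Set S.Div}

/-- The image of `ρ` is closed and contains the generic point of the plane, so `ρ` is surjective. A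
point outside `U` is therefore the image of a point on a contracted curve, hence closed. -/
lemma IsContraction.exists_opens (hρ : IsContraction ρ Cs) : ∃ U : (projSpace K 2).Opens, IsIso (ρ ∣_ U) ∧
    (∀ x, ρ x ∈ U ↔ x ∉ ⋃ E ∈ Cs, supp E) ∧ ρ (genericPoint S.X) = planeGeneric ∧
    ρ (genericPoint S.X) ∈ U ∧ ∀ p, p ∉ U → IsClosed {p} := by
  obtain ⟨hstr, hpt, U, hU, hiso⟩ := hρ
  have hmem : ∀ x, ρ x ∈ U ↔ x ∉ ⋃ E ∈ Cs, supp E := by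
    intro x
    rw [← Set.mem_compl_iff, ← hU]
    rfl
  have hη : ρ (genericPoint S.X) ∈ U := by
    rw [hmem]
    simp only [Set.mem_iUnion, not_exists]
    exact fun E _ => genericPoint_notMem_supp E
  have hbotU : planeGeneric ∈ U := (planeGeneric_specializes _).mem_open U.isOpen hη
  obtain ⟨z, hz⟩ := exists_of_mem (ρ := ρ) U hbotU
  have hbot : ρ (genericPoint S.X) = planeGeneric := by
    have h1 := ρ.base.hom.map_specializes (genericPoint_specializes z)
    rw [hz] at h1
    exact (h1.antisymm (planeGeneric_specializes _)).eq
  refine ⟨U, hiso, hmem, hbot, hη, fun p hp => ?_⟩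
  have hsurj : Function.Surjective ρ := by
    intro p
    have h1 : IsClosed (Set.range ρ) := (isClosedMap_of_str hstr).isClosed_range
    exact (planeGeneric_specializes p).mem_closed h1 ⟨z, hz⟩
  obtain ⟨x, rfl⟩ := hsurj p
  rw [hmem, not_not] at hp
  simp only [Set.mem_iUnion] at hp
  obtain ⟨E, hE, hx⟩ := hp
  obtain ⟨q, hq, hqE⟩ := hpt E hE
  have h2 : ρ x ∈ ρ '' supp E := ⟨x, hx, rfl⟩
  rw [hqE, Set.mem_singleton_iff] at h2
  rwa [h2]

/-- Generic points of plane curves are not closed, so they lie in `U` and have unique preimages, the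
strict transforms. Conversely, a prime divisor that is not contracted maps to a non-generic point of
`U`, at which some irreducible form `P` vanishes; the strict transform of `P` specializes to it, and
both have codimension one. -/
lemma IsContraction.exists_planeModel [IsAlgClosed K] (hρ : IsContraction ρ Cs) :
    ∃ m : PlaneModel ρ, ∀ x : S.PrimeDivisor, m.IsCurve x ↔ x.1 ∉ ⋃ E ∈ Cs, supp E := by
  obtain ⟨U, hiso, hmem, hbot, hη, hcl⟩ := hρ.exists_opens
  have h := pullbackStalk_bijective U hη
  have hcurve : ∀ (P : MvPolynomial (Fin 3) K) (hP : Irreducible P)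
      (hom : ∃ n, P.IsHomogeneous n), curvePoint hP hom ∈ U := by
    intro P hP hom
    by_contra hU
    exact not_isClosed_curvePoint hP hom (hcl _ hU)
  have hbot' : (ρ (genericPoint S.X)).asHomogeneousIdeal = ⊥ := by
    rw [hbot]
    rfl
  have hex : ∀ (P : MvPolynomial (Fin 3) K) (hP : Irreducible P)
      (hom : ∃ n, P.IsHomogeneous n), ∃ x : S.PrimeDivisor, ρ x.1 = curvePoint hP hom := by
    intro P hP hom
    obtain ⟨x, hx⟩ := exists_of_mem (ρ := ρ) U (hcurve P hP hom)
    exact ⟨⟨x, coheight_eq_one h (pullbackStalk_bijective U (hx ▸ hcurve P hP hom)) hx⟩, hx⟩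
  choose cv hcv using hex
  let m : PlaneModel ρ :=
    { frac := toFrac h
      frac_const := toFrac_const h hρ.1
      exists_eq_ratio := by
        intro f
        obtain ⟨n, a, b, hb, hab⟩ := exists_toFrac_eq h f
        exact ⟨n, a, b, a.2, b.2, hb, hab⟩
      exists_frac_eq := fun n a b ha hb hb0 => exists_of_ratio h hbot' ⟨a, ha⟩ ⟨b, hb⟩ hb0
      frac_pullbackQuot := fun x y z hz => toFrac_pullbackStalk h x y z hz
      curve := fun {P} hP hom => cv P hP hom
      map_curve := fun {P} hP hom => hcv P hP hom
      ord_curve := fun {P} hP hom f hf => ord_eq_fracOrd h hbot'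
        (pullbackStalk_bijective U (hcv P hP hom ▸ hcurve P hP hom)) (hcv P hP hom) hf
      curve_congr := by
        intro P P' hP hom hP' hom' hass
        refine Subtype.ext (injOn_of_isIso U (hcv P hP hom ▸ hcurve P hP hom) ?_)
        rw [hcv, hcv]
        refine ext_point fun F => ?_
        rw [mem_curvePoint, mem_curvePoint, hass.dvd_iff_dvd_left]
      isClosedMap := isClosedMap_of_str hρ.1 }
  refine ⟨m, fun x => ⟨?_, fun hx => ?_⟩⟩
  · rintro ⟨P, hP, hom, rfl⟩
    rw [← hmem, m.map_curve]
    exact hcurve P hP hom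
  · rw [← hmem] at hx
    have hne : ρ x.1 ≠ planeGeneric := by
      intro h1
      rw [← hbot] at h1
      exact x.ne_genericPoint (injOn_of_isIso U hx h1)
    obtain ⟨P, hP, hom, hPx⟩ := exists_form_factor_mem hne
    refine ⟨P, hP, hom, (PrimeDivisor.eq_of_specializes ?_).symm⟩
    refine specializes_of_isIso U ?_ hx ?_
    · rw [m.map_curve]
      exact hcurve P hP hom
    · rw [m.map_curve, specializes_iff]
      intro F hF
      obtain ⟨G, rfl⟩ := (mem_curvePoint hP hom).mp hF
      exact Ideal.mul_mem_right G (ρ x.1).asHomogeneousIdeal.toIdeal hPx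

end Contraction

end Surface
end DelPezzo

end

/-! ### Linear equivalence and homogeneous elements of the Cox ring. -/

noncomputable section

namespace DelPezzo

namespace Surface

open MvPolynomial

variable {K : Type u} [Field K] {S : Surface K} {ρ : S.X ⟶ projSpace K 2}

/-! ### Divisor classes -/

lemma cl_eq_iff {A B : S.Div} :
    cl A = cl B ↔ ∃ f : S.FunField, f ≠ 0 ∧ ∀ x, B x = A x + ord f x := by
  unfold cl
  rw [QuotientAddGroup.eq]
  constructor
  · rintro ⟨f, hf, h⟩
    refine ⟨f, hf, fun x => ?_⟩
    rw [← h x]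
    simp
  · rintro ⟨f, hf, h⟩
    refine ⟨f, hf, fun x => ?_⟩
    rw [← sub_eq_iff_eq_add'.mpr (h x)]
    simp [neg_add_eq_sub]

lemma cl_add (A B : S.Div) : cl (A + B) = cl A + cl B := rfl

lemma cl_sub (A B : S.Div) : cl (A - B) = cl A - cl B := rfl

variable (S) in
/-- The class map as a homomorphism. -/
def clHom : S.Div →+ S.Pic := QuotientAddGroup.mk' _

lemma cl_zsmul (n : ℤ) (A : S.Div) : cl (n • A) = n • cl A := map_zsmul (clHom S) n A

lemma cl_sum {β : Type*} (s : Finset β) (A : β → S.Div) : cl (∑ b ∈ s, A b) = ∑ b ∈ s, cl (A b) :=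
  map_sum (clHom S) A s

section Basis

variable {ι : Type} [Fintype ι] {D : ι → S.Div}

/-- `combo D` as a homomorphism. -/
def comboHom (D : ι → S.Div) : (ι → ℤ) →+ S.Div where
  toFun := combo D
  map_zero' := combo_zero D
  map_add' := combo_add D

lemma comboHom_apply (μ : ι → ℤ) : comboHom D μ = combo D μ := rfl

lemma cl_combo (μ : ι → ℤ) : cl (combo D μ) = ∑ j, μ j • cl (D j) := by
  simp only [combo, cl_sum, cl_zsmul]

lemma IsPicBasis.combo_injective (hD : IsPicBasis D) {μ μ' : ι → ℤ}
    (h : cl (combo D μ) = cl (combo D μ')) : μ = μ' := by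
  rw [cl_combo, cl_combo, ← sub_eq_zero, ← Finset.sum_sub_distrib] at h
  simp_rw [← sub_smul] at h
  have h1 := Fintype.linearIndependent_iff.mp hD.1 (fun j => μ j - μ' j) h
  ext j
  exact sub_eq_zero.mp (h1 j)

lemma IsPicBasis.exists_combo (hD : IsPicBasis D) (A : S.Div) : ∃ μ, cl (combo D μ) = cl A := by
  have h : cl A ∈ Submodule.span ℤ (Set.range fun j => cl (D j)) := hD.2 ▸ Submodule.mem_top
  obtain ⟨μ, hμ⟩ := (Submodule.mem_span_range_iff_exists_fun ℤ).mp h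
  exact ⟨μ, by rw [cl_combo, hμ]⟩

end Basis

namespace PlaneModel

lemma frac_ne_zero (m : PlaneModel ρ) {f : S.FunField} (hf : f ≠ 0) : m.frac f ≠ 0 := (map_ne_zero m.frac).mpr hf

/-- Write `f = a / b` with forms of equal degree. The absence of poles along the strict transforms
of the factors of `b` forces `b ∣ a`, and the quotient is a form of degree zero. -/
lemma exists_eq_const (m : PlaneModel ρ) {f : S.FunField} (hf : f ≠ 0) (h : ∀ x, 0 ≤ ord f x) :
    ∃ c : K, f = algebraMap K S.FunField c := by
  obtain ⟨n, a, b, ha, hb, hb0, hab⟩ := m.exists_eq_ratio f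
  have ha0 : a ≠ 0 := by
    rintro rfl
    rw [map_zero, zero_div] at hab
    exact m.frac_ne_zero hf hab
  have hdvd : b ∣ a := by
    refine exists_algebraMap_eq_of_fracOrd_nonneg (Q := FractionRing (MvPolynomial (Fin 3) K))
      ha0 hb0 fun P hP hPb => ?_
    have := h (m.curve hP (hb.of_dvd hb0 hPb))
    rwa [m.ord_curve hP _ hf, hab] at this
  obtain ⟨G, rfl⟩ := hdvd
  obtain ⟨k, hk⟩ := ha.of_dvd ha0 (Dvd.intro_left b rfl)
  have hk0 := (hb.mul hk).inj_right ha ha0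
  obtain rfl : k = 0 := by omega
  have hG := totalDegree_eq_zero_iff_eq_C.mp (hk.totalDegree (right_ne_zero_of_mul ha0))
  refine ⟨coeff 0 G, m.frac.injective ?_⟩
  rw [m.frac_const, hab, ← hG, map_mul, mul_div_cancel_left₀]
  simpa using hb0

lemma eq_zero_of_cl_eq_zero (m : PlaneModel ρ) {A : S.Div} (hA : 0 ≤ A) (h : cl A = 0) : A = 0 := by
  obtain ⟨f, hf, h1⟩ := cl_eq_iff.mp (show cl (0 : S.Div) = cl A from h.symm)
  obtain ⟨c, rfl⟩ := m.exists_eq_const hf fun x => by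
    have := h1 x
    rw [Finsupp.zero_apply, zero_add] at this
    rw [← this]
    exact hA x
  ext x
  rw [h1 x, ord_const ((map_ne_zero _).mp hf)]
  simp

lemma exists_const_mul (m : PlaneModel ρ) {f g : S.FunField} (hf : f ≠ 0) (hg : g ≠ 0)
    (h : ∀ x, ord f x = ord g x) : ∃ c : K, f = algebraMap K S.FunField c * g := by
  obtain ⟨c, hc⟩ := m.exists_eq_const (f := f * g⁻¹) (mul_ne_zero hf (inv_ne_zero hg)) fun x => by
    rw [ord_mul hf (inv_ne_zero hg), ord_inv hg, h x]
    simp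
  exact ⟨c, by rw [← hc, inv_mul_cancel_right₀ hg]⟩

end PlaneModel

/-! ### Homogeneous generators of the Cox ring -/

section Generators

variable {ι : Type} [Fintype ι] {D : ι → S.Div} {t : ℕ} {e : Fin t → CoxRing D}
  {ν : Fin t → ι → ℤ} {E : Fin t → S.Div}

lemma mem_coxRing_single {μ : ι → ℤ} {f : S.FunField} :
    AddMonoidAlgebra.single μ f ∈ CoxRing D ↔ f ∈ H0 (combo D μ) := by
  classical
  constructor
  · intro h
    have := h μ
    simpa using this
  · intro h μ'
    rw [AddMonoidAlgebra.coeff_single, Finsupp.single_apply]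
    split_ifs with h1
    · exact h1 ▸ h
    · exact zero_mem _

lemma IsMinimalGenerators.notMem_adjoin (he : IsMinimalGenerators e ν) (k : Fin t) :
    e k ∉ Algebra.adjoin K (e '' {k}ᶜ) := by
  intro h
  have h1 := he.minimal {k}ᶜ (by
    rw [eq_top_iff, ← he.generate]
    refine Algebra.adjoin_le ?_
    rintro _ ⟨j, rfl⟩
    by_cases hj : j = k
    · exact hj ▸ h
    · exact Algebra.subset_adjoin ⟨j, hj, rfl⟩)
  have : k ∈ ({k}ᶜ : Set (Fin t)) := h1 ▸ Set.mem_univ k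
  exact this rfl

/-- The rational function underlying the `k`-th generator. -/
def genFun (e : Fin t → CoxRing D) (ν : Fin t → ι → ℤ) (k : Fin t) : S.FunField :=
  (e k).1.coeff (ν k)

lemma IsMinimalGenerators.eq_single (he : IsMinimalGenerators e ν) (k : Fin t) :
    (e k).1 = AddMonoidAlgebra.single (ν k) (genFun e ν k) := by
  obtain ⟨f, hf⟩ := he.homogeneous k
  rw [genFun, hf]
  simp

lemma IsMinimalGenerators.genFun_ne_zero (he : IsMinimalGenerators e ν) (k : Fin t) :
    genFun e ν k ≠ 0 := by
  intro h
  apply he.notMem_adjoin k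
  have : e k = 0 := Subtype.ext (by rw [he.eq_single, h]; simp)
  rw [this]
  exact zero_mem _

lemma divisor_apply (hE : ∀ k, IsDivisorOf (e k) (ν k) (E k)) (k : Fin t) (x : S.PrimeDivisor) :
    E k x = ord (genFun e ν k) x + combo D (ν k) x := hE k x

lemma IsMinimalGenerators.divisor_nonneg (he : IsMinimalGenerators e ν)
    (hE : ∀ k, IsDivisorOf (e k) (ν k) (E k)) (k : Fin t) : 0 ≤ E k := by
  intro x
  have h1 := (e k).2 (ν k)
  rw [divisor_apply hE]
  exact h1 (he.genFun_ne_zero k) x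

lemma IsMinimalGenerators.cl_divisor (he : IsMinimalGenerators e ν)
    (hE : ∀ k, IsDivisorOf (e k) (ν k) (E k)) (k : Fin t) : cl (E k) = cl (combo D (ν k)) := by
  refine (cl_eq_iff.mpr ⟨genFun e ν k, he.genFun_ne_zero k, fun x => ?_⟩).symm
  rw [divisor_apply hE]
  ring

lemma exists_section {μ : ι → ℤ} {A : S.Div} (hA : 0 ≤ A) (h : cl (combo D μ) = cl A) :
    ∃ f : S.FunField, f ≠ 0 ∧ AddMonoidAlgebra.single μ f ∈ CoxRing D ∧
      ∀ x, A x = ord f x + combo D μ x := by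
  obtain ⟨f, hf, h1⟩ := cl_eq_iff.mp h
  refine ⟨f, hf, mem_coxRing_single.mpr fun _ x => ?_, fun x => ?_⟩
  · rw [add_comm, ← h1 x]
    exact hA x
  · rw [h1 x, add_comm]

/-- Elements of a degree which does not contain an effective divisor bigger than `E k` do not
involve the `k`-th generator. -/
lemma IsMinimalGenerators.mem_adjoin_of_class (he : IsMinimalGenerators e ν)
    (hE : ∀ k, IsDivisorOf (e k) (ν k) (E k)) {k : Fin t} {μ : ι → ℤ}
    (hno : ∀ A : S.Div, E k ≤ A → cl A ≠ cl (combo D μ)) {s : CoxRing D} {f : S.FunField}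
    (hs : s.1 = AddMonoidAlgebra.single μ f) : s ∈ Algebra.adjoin K (e '' {k}ᶜ) := by
  classical
  -- A monomial in the generators has as divisor the corresponding sum of the effective divisors `E
  -- j`; if it involves `e k`, this sum is at least `E k`.
  have hmon : ∀ z ∈ Submonoid.closure (Set.range e), ∃ (ξ : ι → ℤ) (g : S.FunField) (A : S.Div),
      z.1 = AddMonoidAlgebra.single ξ g ∧ 0 ≤ A ∧ cl A = cl (combo D ξ) ∧
      (z ∈ Algebra.adjoin K (e '' {k}ᶜ) ∨ E k ≤ A) := by
    intro z hz
    induction hz using Submonoid.closure_induction with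
    | mem z hz =>
      obtain ⟨j, rfl⟩ := hz
      refine ⟨ν j, genFun e ν j, E j, he.eq_single j, he.divisor_nonneg hE j, he.cl_divisor hE j, ?_⟩
      by_cases hj : j = k
      · exact Or.inr (hj ▸ le_rfl)
      · exact Or.inl (Algebra.subset_adjoin ⟨j, hj, rfl⟩)
    | one =>
      exact ⟨0, 1, 0, rfl, le_rfl, by rw [combo_zero], Or.inl (one_mem _)⟩
    | mul z w _ _ ihz ihw =>
      obtain ⟨ξ, g, A, h1, h2, h3, h4⟩ := ihz
      obtain ⟨ξ', g', A', h1', h2', h3', h4'⟩ := ihw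
      refine ⟨ξ + ξ', g * g', A + A', ?_, add_nonneg h2 h2', ?_, ?_⟩
      · rw [MulMemClass.coe_mul, h1, h1', AddMonoidAlgebra.single_mul_single]
      · rw [combo_add, cl_add, cl_add, h3, h3']
      · rcases h4 with h4 | h4
        · rcases h4' with h4' | h4'
          · exact Or.inl (mul_mem h4 h4')
          · exact Or.inr (h4'.trans (le_add_of_nonneg_left h2))
        · exact Or.inr (h4.trans (le_add_of_nonneg_right h2'))
  -- Only the component of degree `μ` is kept: by `hno` the monomials of that degree do not involve
  -- `e k`, and all others contribute zero.
  have hspan : ∀ z ∈ Submodule.span K (Submonoid.closure (Set.range e) : Set (CoxRing D)),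
      ∃ w ∈ Algebra.adjoin K (e '' {k}ᶜ), w.1 = AddMonoidAlgebra.single μ (z.1.coeff μ) := by
    intro z hz
    induction hz using Submodule.span_induction with
    | mem z hz =>
      obtain ⟨ξ, g, A, h1, h2, h3, h4⟩ := hmon z hz
      by_cases hξ : ξ = μ
      · subst hξ
        rcases h4 with h4 | h4
        · exact ⟨z, h4, by rw [h1]; simp⟩
        · exact absurd h3 (hno A h4)
      · exact ⟨0, zero_mem _, by rw [h1]; simp [hξ]⟩
    | zero => exact ⟨0, zero_mem _, by simp⟩
    | add z w _ _ ihz ihw =>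
      obtain ⟨z', hz', h1⟩ := ihz
      obtain ⟨w', hw', h2⟩ := ihw
      exact ⟨z' + w', add_mem hz' hw', by simp [h1, h2]⟩
    | smul a z _ ih =>
      obtain ⟨z', hz', h1⟩ := ih
      refine ⟨a • z', Subalgebra.smul_mem _ hz' a, ?_⟩
      simp [h1]
  obtain ⟨w, hw, h1⟩ := hspan s (by
    rw [← Algebra.adjoin_eq_span, he.generate]
    trivial)
  have : s = w := Subtype.ext (by rw [h1, hs]; simp)
  rwa [this]

end Generators

end Surface
end DelPezzo

end

/-! ### Prime divisors of the generators, and generation of the Picard group. -/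

noncomputable section

namespace DelPezzo

namespace Surface

open MvPolynomial

variable {K : Type u} [Field K] {S : Surface K} {ρ : S.X ⟶ projSpace K 2}

/-- A birational morphism to the plane which contracts the divisors of some of the generators of
the Cox ring. -/
structure PlaneCox {ι : Type} [Fintype ι] {t : ℕ} (ρ : S.X ⟶ projSpace K 2) (D : ι → S.Div)
    (e : Fin t → CoxRing D) (ν : Fin t → ι → ℤ) (E : Fin t → S.Div) (I : Finset (Fin t))
    (L : S.Div) where
  /-- the presentation of the function field by homogeneous fractions -/
  model : PlaneModel ρ
  basis : IsPicBasis D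
  gens : IsMinimalGenerators e ν
  div : ∀ k, IsDivisorOf (e k) (ν k) (E k)
  isCurve_iff : ∀ x, model.IsCurve x ↔ ∀ k ∈ I, x.1 ∉ supp (E k)
  /-- a line in the plane -/
  line : MvPolynomial (Fin 3) K
  line_hom : line.IsHomogeneous 1
  line_ne_zero : line ≠ 0
  pullback_line : ∀ {P : MvPolynomial (Fin 3) K} (hP : Irreducible P)
    (hom : ∃ n, P.IsHomogeneous n), L (model.curve hP hom) = multiplicity P line

namespace PlaneCox

variable {ι : Type} [Fintype ι] {t : ℕ} {D : ι → S.Div}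
  {e : Fin t → CoxRing D} {ν : Fin t → ι → ℤ} {E : Fin t → S.Div} {I : Finset (Fin t)}
  {L : S.Div}

/-- A generator with divisor zero would have degree zero and be a constant, hence superfluous. -/
lemma divisor_ne_zero (c : PlaneCox ρ D e ν E I L) (k : Fin t) : E k ≠ 0 := by
  intro h0
  have hν : ν k = 0 := c.basis.combo_injective (by
    rw [← c.gens.cl_divisor c.div, h0, combo_zero])
  have hord : ∀ x, 0 ≤ ord (genFun e ν k) x := by
    intro x
    have := divisor_apply c.div k x
    rw [h0, hν, combo_zero] at this
    simp only [Finsupp.zero_apply, add_zero] at this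
    exact this.le
  obtain ⟨a, ha⟩ := c.model.exists_eq_const (c.gens.genFun_ne_zero k) hord
  apply c.gens.notMem_adjoin k
  have : e k = algebraMap K (CoxRing D) a := by
    apply Subtype.ext
    rw [c.gens.eq_single, ha, hν]
    rfl
  rw [this]
  exact Subalgebra.algebraMap_mem _ _

lemma eq_smul_of_divisor_eq (c : PlaneCox ρ D e ν E I L) {k : Fin t} {s : CoxRing D}
    {f : S.FunField} (hf : f ≠ 0) (hs : s.1 = AddMonoidAlgebra.single (ν k) f)
    (h : ∀ x, E k x = ord f x + combo D (ν k) x) : ∃ a : K, e k = a • s := by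
  obtain ⟨a, ha⟩ := c.model.exists_const_mul (c.gens.genFun_ne_zero k) hf fun x => by
    have h1 := divisor_apply c.div k x
    have h2 := h x
    omega
  refine ⟨a, Subtype.ext ?_⟩
  rw [c.gens.eq_single, ha, ← Algebra.smul_def]
  simp [hs]

/-- If `E k = A + B` with `A` and `B` effective and non-zero, then `e k` is a constant times a
product of sections with divisors `A` and `B`. Neither section involves `e k`: an effective divisor
`A' ≥ E k` equivalent to `A` would make `A' - A ≥ B` effective and principal, hence zero. This
contradicts minimality. -/
lemma exists_divisor_eq_single (c : PlaneCox ρ D e ν E I L) (k : Fin t) :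
    ∃ x, E k = Finsupp.single x 1 := by
  classical
  have hpos := c.gens.divisor_nonneg c.div k
  obtain ⟨x, hx⟩ := Finsupp.ne_iff.mp (c.divisor_ne_zero k)
  have hx1 : 1 ≤ E k x := by
    have := hpos x
    simp only [Finsupp.zero_apply] at this hx
    omega
  refine ⟨x, ?_⟩
  by_contra hne
  set A : S.Div := Finsupp.single x 1 with hA
  set B : S.Div := E k - A with hB
  have hA0 : 0 ≤ A := by
    intro y
    rw [hA, Finsupp.single_apply]
    split_ifs <;> simp
  have hB0 : 0 ≤ B := by
    intro y
    have := hpos y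
    rw [hB, hA, Finsupp.sub_apply, Finsupp.single_apply]
    simp only [Finsupp.zero_apply] at this ⊢
    split_ifs with h
    · subst h; omega
    · omega
  have hAB : A + B = E k := add_sub_cancel _ _
  have hBne : B ≠ 0 := fun h => hne (by rw [← hAB, h, add_zero])
  have hAne : A ≠ 0 := by simp [hA]
  obtain ⟨μ, hμ⟩ := c.basis.exists_combo A
  obtain ⟨μ', hμ'⟩ := c.basis.exists_combo B
  have hsum : μ + μ' = ν k := c.basis.combo_injective (by
    rw [combo_add, cl_add, hμ, hμ', ← cl_add, hAB, c.gens.cl_divisor c.div])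
  obtain ⟨f, hf, hfm, hfo⟩ := exists_section hA0 hμ
  obtain ⟨g, hg, hgm, hgo⟩ := exists_section hB0 hμ'
  have key : ∀ (A B : S.Div), 0 ≤ A → 0 ≤ B → B ≠ 0 → A + B = E k → ∀ μ,
      cl (combo D μ) = cl A → ∀ A' : S.Div, E k ≤ A' → cl A' ≠ cl (combo D μ) := by
    intro A B _ hB hBne hAB μ hμ A' hA' h
    have hle : B ≤ A' - A := by
      rw [le_sub_iff_add_le, add_comm, hAB]
      exact hA'
    have h0 : A' - A = 0 := c.model.eq_zero_of_cl_eq_zero (hB.trans hle) (by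
      rw [cl_sub, h, hμ, sub_self])
    exact hBne (le_antisymm (h0 ▸ hle) hB)
  have h1 := c.gens.mem_adjoin_of_class c.div (key A B hA0 hB0 hBne hAB μ hμ)
    (s := (⟨AddMonoidAlgebra.single μ f, hfm⟩ : CoxRing D)) rfl
  have h2 := c.gens.mem_adjoin_of_class c.div
    (key B A hB0 hA0 hAne (by rw [add_comm, hAB]) μ' hμ') (s := (⟨AddMonoidAlgebra.single μ' g, hgm⟩ : CoxRing D)) rfl
  obtain ⟨a, ha⟩ := c.eq_smul_of_divisor_eq (k := k)
    (s := (⟨AddMonoidAlgebra.single μ f, hfm⟩ : CoxRing D) *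
      (⟨AddMonoidAlgebra.single μ' g, hgm⟩ : CoxRing D)) (mul_ne_zero hf hg) (by
      rw [MulMemClass.coe_mul, AddMonoidAlgebra.single_mul_single, hsum]) (fun x => by
      rw [ord_mul hf hg, ← hsum, combo_add, ← hAB, Finsupp.add_apply, Finsupp.add_apply, hfo, hgo]
      ring)
  apply c.gens.notMem_adjoin k
  rw [ha]
  exact Subalgebra.smul_mem _ (mul_mem h1 h2) a

/-- The prime divisor of the `k`-th generator. -/
def pt (c : PlaneCox ρ D e ν E I L) (k : Fin t) : S.PrimeDivisor :=
  (c.exists_divisor_eq_single k).choose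

lemma divisor_eq (c : PlaneCox ρ D e ν E I L) (k : Fin t) : E k = Finsupp.single (c.pt k) 1 :=
  (c.exists_divisor_eq_single k).choose_spec

/-- Generators with the same divisor have the same degree and differ by a constant factor, so one of
them would be superfluous. -/
lemma pt_injective (c : PlaneCox ρ D e ν E I L) : Function.Injective c.pt := by
  intro j k h
  by_contra hne
  have hE : E j = E k := by rw [c.divisor_eq, c.divisor_eq, h]
  have hν : ν j = ν k := c.basis.combo_injective (by
    rw [← c.gens.cl_divisor c.div, ← c.gens.cl_divisor c.div, hE])
  obtain ⟨a, ha⟩ := c.eq_smul_of_divisor_eq (k := k) (c.gens.genFun_ne_zero j)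
    (s := e j) (by rw [c.gens.eq_single, hν]) (fun x => by rw [← hE, ← hν, divisor_apply c.div])
  apply c.gens.notMem_adjoin k
  rw [ha]
  exact Subalgebra.smul_mem _ (Algebra.subset_adjoin (Set.mem_image_of_mem e (show j ∈ ({k}ᶜ : Set (Fin t)) from hne))) a

lemma supp_divisor (c : PlaneCox ρ D e ν E I L) (k : Fin t) : supp (E k) = closure {(c.pt k).1} := by
  rw [supp, c.divisor_eq, Finsupp.support_single _ one_ne_zero]
  simp

lemma isCurve_iff_ne (c : PlaneCox ρ D e ν E I L) (x : S.PrimeDivisor) :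
    c.model.IsCurve x ↔ ∀ k ∈ I, x ≠ c.pt k := by
  rw [c.isCurve_iff]
  refine forall₂_congr fun k _ => not_congr ?_
  rw [c.supp_divisor, ← specializes_iff_mem_closure]
  exact ⟨fun h => (PrimeDivisor.eq_of_specializes h).symm, fun h => h ▸ specializes_rfl⟩

lemma divisor_curve_eq_zero (c : PlaneCox ρ D e ν E I L) {k : Fin t} (hk : k ∈ I)
    {x : S.PrimeDivisor} (hx : c.model.IsCurve x) : E k x = 0 := by
  classical
  rw [c.divisor_eq, Finsupp.single_apply, if_neg]
  exact fun h => (c.isCurve_iff_ne x).mp hx k hk h.symm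

lemma sum_apply_curve (c : PlaneCox ρ D e ν E I L) (a : Fin t → ℤ) {x : S.PrimeDivisor}
    (hx : c.model.IsCurve x) : (∑ k ∈ I, a k • E k) x = 0 := by
  rw [Finsupp.finsetSum_apply, Finset.sum_eq_zero]
  intro k hk
  rw [Finsupp.smul_apply, c.divisor_curve_eq_zero hk hx, smul_zero]

lemma sum_apply_pt (c : PlaneCox ρ D e ν E I L) (a : Fin t → ℤ) {k : Fin t} (hk : k ∈ I) :
    (∑ k ∈ I, a k • E k) (c.pt k) = a k := by
  classical
  rw [Finsupp.finsetSum_apply, Finset.sum_eq_single_of_mem k hk]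
  · rw [Finsupp.smul_apply, c.divisor_eq k]
    simp
  · intro j _ hj
    rw [Finsupp.smul_apply, c.divisor_eq j, Finsupp.single_apply, if_neg, smul_zero]
    exact fun h => hj (c.pt_injective h)

lemma eq_pt_of_not_isCurve (c : PlaneCox ρ D e ν E I L) {x : S.PrimeDivisor}
    (hx : ¬ c.model.IsCurve x) : ∃ k ∈ I, x = c.pt k := by
  rw [c.isCurve_iff_ne] at hx
  push Not at hx
  exact hx

/-- Divisors which are equivalent away from the contracted curves are equivalent up to a
combination of contracted curves. -/
lemma exists_cl_eq_of_curve (c : PlaneCox ρ D e ν E I L) {A B : S.Div} {f : S.FunField}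
    (hf : f ≠ 0) (h : ∀ x, c.model.IsCurve x → B x = A x + ord f x) :
    ∃ a : Fin t → ℤ, cl B = cl (A + ∑ k ∈ I, a k • E k) := by
  refine ⟨fun k => B (c.pt k) - A (c.pt k) - ord f (c.pt k),
    (cl_eq_iff.mpr ⟨f, hf, fun x => ?_⟩).symm⟩
  by_cases hx : c.model.IsCurve x
  · rw [Finsupp.add_apply, c.sum_apply_curve _ hx, h x hx]
    ring
  · obtain ⟨k, hk, rfl⟩ := c.eq_pt_of_not_isCurve hx
    rw [Finsupp.add_apply, c.sum_apply_pt _ hk]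
    ring

lemma algebraMap_line_ne_zero (c : PlaneCox ρ D e ν E I L) :
    algebraMap _ (FractionRing (MvPolynomial (Fin 3) K)) c.line ≠ 0 := by
  simpa using c.line_ne_zero

/-- Homogeneous fractions without poles are homogeneous polynomials. -/
lemma exists_form (c : PlaneCox ρ D e ν E I L) {h : S.FunField} (hh : h ≠ 0) (n : ℤ)
    (hpos : ∀ (P : MvPolynomial (Fin 3) K) (_ : Irreducible P) (_ : ∃ n, P.IsHomogeneous n),
      0 ≤ fracOrd P (c.model.frac h * (algebraMap _ (FractionRing (MvPolynomial (Fin 3) K)) c.line) ^ n)) :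
    ∃ (k : ℕ) (G : MvPolynomial (Fin 3) K), (k : ℤ) = n ∧ G.IsHomogeneous k ∧ G ≠ 0 ∧
      c.model.frac h * (algebraMap _ (FractionRing (MvPolynomial (Fin 3) K)) c.line) ^ n =
        algebraMap _ _ G := by
  have hl := c.algebraMap_line_ne_zero
  obtain ⟨N, a, b, ha, hb, hb0, hab⟩ := c.model.exists_eq_ratio h
  have ha0 : a ≠ 0 := by
    rintro rfl
    rw [map_zero, zero_div] at hab
    exact c.model.frac_ne_zero hh hab
  have hb0' : algebraMap _ (FractionRing (MvPolynomial (Fin 3) K)) b ≠ 0 := by simpa using hb0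
  -- Splitting `n` allows for negative exponents: the fraction becomes one of forms of degrees `N +
  -- p` and `N + q`. Divisibility then also shows that `n`, being the degree of the quotient, is
  -- non-negative.
  obtain ⟨p, q, rfl⟩ : ∃ p q : ℕ, n = p - q := ⟨n.toNat, (-n).toNat, by omega⟩
  have hq : c.model.frac h *
      (algebraMap _ (FractionRing (MvPolynomial (Fin 3) K)) c.line) ^ ((p : ℤ) - q) =
      algebraMap _ _ (a * c.line ^ p) / algebraMap _ _ (b * c.line ^ q) := by
    rw [hab, zpow_sub₀ hl, zpow_natCast, zpow_natCast, map_mul, map_mul, map_pow, map_pow,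
      div_mul_div_comm]
  have hA : (a * c.line ^ p).IsHomogeneous (N + p) := by
    have := ha.mul (c.line_hom.pow p)
    rwa [one_mul] at this
  have hB : (b * c.line ^ q).IsHomogeneous (N + q) := by
    have := hb.mul (c.line_hom.pow q)
    rwa [one_mul] at this
  have hA0 : a * c.line ^ p ≠ 0 := mul_ne_zero ha0 (pow_ne_zero _ c.line_ne_zero)
  have hB0 : b * c.line ^ q ≠ 0 := mul_ne_zero hb0 (pow_ne_zero _ c.line_ne_zero)
  rw [hq] at hpos
  obtain ⟨G, hG⟩ := exists_algebraMap_eq_of_fracOrd_nonneg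
    (Q := FractionRing (MvPolynomial (Fin 3) K)) hA0 hB0
    fun P hP hPb => hpos P hP (hB.of_dvd hB0 hPb)
  obtain ⟨k, hk⟩ := hA.of_dvd hA0 (Dvd.intro_left _ hG.symm)
  have hdeg := (hB.mul hk).inj_right (hG ▸ hA) (hG ▸ hA0)
  refine ⟨k, G, by omega, hk, ?_, ?_⟩
  · rintro rfl
    rw [mul_zero] at hG
    exact hA0 hG
  · rw [hq, hG, map_mul, mul_div_cancel_left₀]
    simpa using hB0

lemma isCurve_curve (m : PlaneModel ρ) {P : MvPolynomial (Fin 3) K} (hP : Irreducible P)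
    (hom : ∃ n, P.IsHomogeneous n) : m.IsCurve (m.curve hP hom) := ⟨P, hP, hom, rfl⟩

lemma curve_eq_iff (c : PlaneCox ρ D e ν E I L) {P P' : MvPolynomial (Fin 3) K}
    (hP : Irreducible P) (hom : ∃ n, P.IsHomogeneous n) (hP' : Irreducible P')
    (hom' : ∃ n, P'.IsHomogeneous n) :
    c.model.curve hP hom = c.model.curve hP' hom' ↔ Associated P P' := by
  constructor
  · intro h
    refine hP.associated_of_dvd hP' ?_
    rw [← mem_curvePoint hP hom, ← c.model.map_curve, h, c.model.map_curve, mem_curvePoint]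
  · intro h
    exact c.model.curve_congr hP hom hP' hom' h

lemma ord_fun_curve (c : PlaneCox ρ D e ν E I L) {P P' : MvPolynomial (Fin 3) K}
    (hP' : Irreducible P')
    (hom' : ∃ n, P'.IsHomogeneous n) (hP : P ≠ 0) {n : ℕ} {f : S.FunField} (hf : f ≠ 0)
    (h : c.model.frac f = algebraMap _ _ P / algebraMap _ _ (c.line ^ n)) :
    ord f (c.model.curve hP' hom') = multiplicity P' P - n * L (c.model.curve hP' hom') := by
  rw [c.model.ord_curve hP' hom' hf, h,
    fracOrd_div hP'.prime hP (pow_ne_zero _ c.line_ne_zero), c.pullback_line hP' hom',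
    FiniteMultiplicity.multiplicity_pow hP'.prime (FiniteMultiplicity.of_prime_left hP'.prime c.line_ne_zero)]
  push_cast
  ring

/-- Every divisor is equivalent to a combination of `L` and contracted curves. -/
lemma exists_cl_eq (c : PlaneCox ρ D e ν E I L) (A : S.Div) :
    ∃ (n : ℤ) (a : Fin t → ℤ), cl A = cl (n • L + ∑ k ∈ I, a k • E k) := by
  classical
  induction A using Finsupp.induction_linear with
  | zero => exact ⟨0, 0, by simp⟩
  | add A B hA hB =>
    obtain ⟨n, a, h1⟩ := hA
    obtain ⟨m, b, h2⟩ := hB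
    refine ⟨n + m, a + b, ?_⟩
    rw [cl_add, h1, h2, ← cl_add, add_smul]
    simp only [Pi.add_apply, add_smul, Finset.sum_add_distrib]
    congr 1
    abel
  | single x z =>
    suffices h : ∃ (n : ℤ) (a : Fin t → ℤ),
        cl (Finsupp.single x 1 : S.Div) = cl (n • L + ∑ k ∈ I, a k • E k) by
      obtain ⟨n, a, h⟩ := h
      refine ⟨z * n, fun k => z * a k, ?_⟩
      have : (Finsupp.single x z : S.Div) = z • Finsupp.single x 1 := by simp
      rw [this, cl_zsmul, h, ← cl_zsmul, smul_add, Finset.smul_sum, mul_smul]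
      simp_rw [mul_smul]
    by_cases hx : c.model.IsCurve x
    · obtain ⟨P, hP, hom, rfl⟩ := hx
      obtain ⟨n, hn⟩ := id hom
      -- Away from the contracted curves the divisor of `P / line ^ n` is the curve of `P` minus `n
      -- • L`.
      obtain ⟨f, hf⟩ := c.model.exists_frac_eq n P (c.line ^ n) hn
        (by simpa using c.line_hom.pow n) (pow_ne_zero _ c.line_ne_zero)
      have hf0 : f ≠ 0 := by
        rintro rfl
        rw [map_zero, eq_comm, div_eq_zero_iff] at hf
        simp [hP.ne_zero, c.line_ne_zero] at hf
      obtain ⟨a, ha⟩ := c.exists_cl_eq_of_curve (A := (n : ℤ) • L)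
        (B := Finsupp.single (c.model.curve hP hom) 1) hf0 (by
          rintro x ⟨P', hP', hom', rfl⟩
          rw [c.ord_fun_curve hP' hom' hP.ne_zero hf0 hf, Finsupp.single_apply, Finsupp.smul_apply,
            smul_eq_mul, add_sub_cancel]
          split_ifs with h
          · rw [c.curve_eq_iff] at h
            rw [multiplicity_eq_of_associated_left h, multiplicity_self]
            rfl
          · rw [c.curve_eq_iff] at h
            rw [multiplicity_eq_zero.mpr fun hd => h (hP'.associated_of_dvd hP hd).symm]
            rfl)
      exact ⟨n, a, ha⟩
    · obtain ⟨k, hk, rfl⟩ := c.eq_pt_of_not_isCurve hx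
      refine ⟨0, Pi.single k 1, ?_⟩
      rw [← c.divisor_eq, zero_smul, zero_add, Finset.sum_eq_single_of_mem k hk]
      · simp
      · intro j _ hj
        simp [hj]

end PlaneCox

end Surface
end DelPezzo

end

/-! ### Independence in the Picard group, and trivialisation of degrees. -/

noncomputable section

namespace DelPezzo

namespace Surface

open MvPolynomial

variable {K : Type u} [Field K] {S : Surface K} {ρ : S.X ⟶ projSpace K 2}

namespace PlaneCox

variable {ι : Type} [Fintype ι] {t : ℕ} {D : ι → S.Div}
  {e : Fin t → CoxRing D} {ν : Fin t → ι → ℤ} {E : Fin t → S.Div} {I : Finset (Fin t)}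
  {L : S.Div}

/-- The class of a line and the classes of the contracted curves are independent. -/
lemma eq_zero_of_cl_eq_zero (c : PlaneCox ρ D e ν E I L) {n : ℤ} {a : Fin t → ℤ}
    (h : cl (n • L + ∑ k ∈ I, a k • E k) = 0) : n = 0 ∧ ∀ k ∈ I, a k = 0 := by
  obtain ⟨f, hf, hfo⟩ := cl_eq_iff.mp (show cl (0 : S.Div) = _ from h.symm)
  have hl := c.algebraMap_line_ne_zero
  have hcurve : ∀ (P : MvPolynomial (Fin 3) K) (_ : Irreducible P) (_ : ∃ n, P.IsHomogeneous n),
      fracOrd P (c.model.frac f) = n * multiplicity P c.line := by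
    intro P hP hom
    rw [← c.model.ord_curve hP hom hf]
    have := hfo (c.model.curve hP hom)
    rw [Finsupp.zero_apply, zero_add, Finsupp.add_apply,
      c.sum_apply_curve _ (isCurve_curve c.model hP hom), Finsupp.smul_apply,
      c.pullback_line] at this
    rw [← this, smul_eq_mul, add_zero]
  have hz : ∀ (P : MvPolynomial (Fin 3) K) (_ : Irreducible P) (m : ℤ), fracOrd P
      (algebraMap _ (FractionRing (MvPolynomial (Fin 3) K)) c.line ^ m) =
        m * multiplicity P c.line := fun P hP m => by
    rw [fracOrd_zpow hP.prime hl, fracOrd_algebraMap hP.prime c.line_ne_zero]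
  -- With `ℓ` the line, `f * ℓ ^ (-n)` and its inverse have order zero along every plane curve. They
  -- are forms of degrees `-n` and `n`, both natural numbers, so `n = 0` and `f` is constant.
  obtain ⟨k, G, hk, hG, hG0, hfG⟩ := c.exists_form hf (-n) fun P hP hom => by
    rw [fracOrd_mul hP.prime (c.model.frac_ne_zero hf) (zpow_ne_zero _ hl), hz P hP,
      hcurve P hP hom]
    linarith
  obtain ⟨k', -, hk', -⟩ := c.exists_form (inv_ne_zero hf) n fun P hP hom => by
    rw [map_inv₀, fracOrd_mul hP.prime (inv_ne_zero (c.model.frac_ne_zero hf)) (zpow_ne_zero _ hl),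
      fracOrd_inv hP.prime (c.model.frac_ne_zero hf), hz P hP, hcurve P hP hom]
    linarith
  obtain rfl : n = 0 := by omega
  obtain rfl : k = 0 := by omega
  refine ⟨rfl, fun j hj => ?_⟩
  obtain ⟨b, rfl⟩ : ∃ b : K, f = algebraMap K S.FunField b := by
    refine ⟨coeff 0 G, c.model.frac.injective ?_⟩
    rw [c.model.frac_const, ← totalDegree_eq_zero_iff_eq_C.mp (hG.totalDegree hG0), ← hfG]
    simp
  have := hfo (c.pt j)
  rw [zero_smul, zero_add, c.sum_apply_pt _ hj, ord_const ((map_ne_zero _).mp hf)] at this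
  simpa using this

/-- The degree of a line. -/
def lineDeg (c : PlaneCox ρ D e ν E I L) : ι → ℤ := (c.basis.exists_combo L).choose

lemma cl_lineDeg (c : PlaneCox ρ D e ν E I L) : cl (combo D c.lineDeg) = cl L :=
  (c.basis.exists_combo L).choose_spec

lemma cl_combo_degrees (c : PlaneCox ρ D e ν E I L) (n : ℤ) (a : Fin t → ℤ) :
    cl (combo D (n • c.lineDeg + ∑ k ∈ I, a k • ν k)) = cl (n • L + ∑ k ∈ I, a k • E k) := by
  rw [← comboHom_apply, map_add, map_zsmul, map_sum, cl_add, cl_add, cl_zsmul, cl_zsmul, cl_sum,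
    cl_sum, comboHom_apply, c.cl_lineDeg]
  congr 1
  refine Finset.sum_congr rfl fun k _ => ?_
  rw [map_zsmul, cl_zsmul, cl_zsmul, comboHom_apply, c.gens.cl_divisor c.div]

/-- The degrees of a line and of the contracted curves. -/
def degVec (c : PlaneCox ρ D e ν E I L) : Option I → ι → ℤ
  | none => c.lineDeg
  | some k => ν k

lemma sum_degVec (c : PlaneCox ρ D e ν E I L) (g : Option I → ℤ) :
    ∑ o, g o • c.degVec o = g none • c.lineDeg +
      ∑ k ∈ I, (if h : k ∈ I then g (some ⟨k, h⟩) else 0) • ν k := by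
  rw [Fintype.sum_option]
  congr 1
  rw [← Finset.sum_coe_sort I]
  refine Finset.sum_congr rfl fun k _ => ?_
  simp [degVec]

/-- The degrees of a line and of the contracted curves form a basis. -/
def degBasis (c : PlaneCox ρ D e ν E I L) : Module.Basis (Option I) ℤ (ι → ℤ) :=
  Module.Basis.mk (v := c.degVec)
    (by
      refine Fintype.linearIndependent_iff.mpr fun g hg => ?_
      rw [c.sum_degVec] at hg
      have h1 := c.cl_combo_degrees (g none) fun k => if h : k ∈ I then g (some ⟨k, h⟩) else 0
      rw [hg, combo_zero] at h1
      obtain ⟨h2, h3⟩ := c.eq_zero_of_cl_eq_zero h1.symm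
      rintro (_ | k)
      · exact h2
      · simpa using h3 k k.2)
    (by
      intro μ _
      obtain ⟨n, a, h⟩ := c.exists_cl_eq (combo D μ)
      rw [← c.cl_combo_degrees] at h
      rw [c.basis.combo_injective h]
      refine add_mem (Submodule.smul_mem _ _ (Submodule.subset_span ⟨none, rfl⟩))
        (Submodule.sum_mem _ fun k hk => Submodule.smul_mem _ _
          (Submodule.subset_span ⟨some ⟨k, hk⟩, rfl⟩)))

lemma degBasis_none (c : PlaneCox ρ D e ν E I L) : c.degBasis none = c.lineDeg := by
  simp [degBasis, degVec]

lemma degBasis_some (c : PlaneCox ρ D e ν E I L) (k : I) : c.degBasis (some k) = ν k := by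
  simp [degBasis, degVec]

/-- The degree in the plane of a class on the surface. -/
def deg (c : PlaneCox ρ D e ν E I L) : (ι → ℤ) →ₗ[ℤ] ℤ := c.degBasis.coord none

/-- The multiplicity of a contracted curve in a class on the surface. -/
def mult (c : PlaneCox ρ D e ν E I L) (k : I) : (ι → ℤ) →ₗ[ℤ] ℤ := c.degBasis.coord (some k)

lemma deg_lineDeg (c : PlaneCox ρ D e ν E I L) : c.deg c.lineDeg = 1 := by
  rw [deg, ← degBasis_none]
  simp

lemma deg_degree (c : PlaneCox ρ D e ν E I L) {k : Fin t} (hk : k ∈ I) : c.deg (ν k) = 0 := by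
  rw [deg, ← c.degBasis_some ⟨k, hk⟩]
  simp

lemma eq_sum (c : PlaneCox ρ D e ν E I L) (μ : ι → ℤ) :
    μ = c.deg μ • c.lineDeg + ∑ k : I, c.mult k μ • ν k := by
  conv_lhs => rw [← c.degBasis.sum_repr μ]
  rw [Fintype.sum_option, degBasis_none]
  simp_rw [degBasis_some]
  rfl

lemma lineFun_exists (c : PlaneCox ρ D e ν E I L) :
    ∃ f : S.FunField, f ≠ 0 ∧ ∀ x, combo D c.lineDeg x = L x + ord f x :=
  cl_eq_iff.mp c.cl_lineDeg.symm

/-- A function whose divisor is the difference of the two divisors of the class of a line. -/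
def lineFun (c : PlaneCox ρ D e ν E I L) : S.FunFieldˣ :=
  Units.mk0 c.lineFun_exists.choose c.lineFun_exists.choose_spec.1

lemma combo_lineDeg (c : PlaneCox ρ D e ν E I L) (x : S.PrimeDivisor) :
    combo D c.lineDeg x = L x + ord (c.lineFun : S.FunField) x :=
  c.lineFun_exists.choose_spec.2 x

/-- Trivialisations of the degrees. -/
def twist (c : PlaneCox ρ D e ν E I L) : (ι → ℤ) →ₗ[ℤ] Additive S.FunFieldˣ :=
  c.degBasis.constr ℤ fun
    | none => Additive.ofMul c.lineFun
    | some k => Additive.ofMul (Units.mk0 (genFun e ν k) (c.gens.genFun_ne_zero k))⁻¹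

/-- The function which trivialises a degree. -/
def twistFun (c : PlaneCox ρ D e ν E I L) (μ : ι → ℤ) : S.FunField := (c.twist μ).toMul

lemma twistFun_ne_zero (c : PlaneCox ρ D e ν E I L) (μ : ι → ℤ) : c.twistFun μ ≠ 0 :=
  Units.ne_zero _

lemma twistFun_zero (c : PlaneCox ρ D e ν E I L) : c.twistFun 0 = 1 := by
  simp [twistFun]

lemma twistFun_add (c : PlaneCox ρ D e ν E I L) (μ μ' : ι → ℤ) :
    c.twistFun (μ + μ') = c.twistFun μ * c.twistFun μ' := by
  simp [twistFun]

lemma twistFun_degree (c : PlaneCox ρ D e ν E I L) {k : Fin t} (hk : k ∈ I) :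
    c.twistFun (ν k) = (genFun e ν k)⁻¹ := by
  rw [twistFun, twist, ← c.degBasis_some ⟨k, hk⟩, Module.Basis.constr_basis]
  simp

lemma twistFun_lineDeg (c : PlaneCox ρ D e ν E I L) : c.twistFun c.lineDeg = c.lineFun := by
  rw [twistFun, twist, ← c.degBasis_none, Module.Basis.constr_basis]
  simp

/-- The correction by `twistFun` is additive in the degree, so the formula only has to be checked on
the basis: for `lineDeg` it is the choice of `lineFun`, and for `ν k` it expresses `E k` as the
divisor of its section. -/
lemma combo_apply (c : PlaneCox ρ D e ν E I L) (μ : ι → ℤ) (x : S.PrimeDivisor) :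
    combo D μ x = ord (c.twistFun μ) x + c.deg μ * L x + ∑ k : I, c.mult k μ * E k x := by
  have h : ∀ μ μ', ord (c.twistFun (μ + μ')) x = ord (c.twistFun μ) x + ord (c.twistFun μ') x :=
    fun μ μ' => by
      rw [twistFun_add, ord_mul (c.twistFun_ne_zero _) (c.twistFun_ne_zero _)]
  let θ : (ι → ℤ) →+ ℤ := (Finsupp.applyAddHom x).comp (comboHom D) -
    AddMonoidHom.mk' (fun μ => ord (c.twistFun μ) x) h
  have h1 : θ c.lineDeg = L x := by
    change combo D c.lineDeg x - ord (c.twistFun c.lineDeg) x = _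
    rw [c.combo_lineDeg, c.twistFun_lineDeg]
    ring
  have h2 : ∀ k : I, θ (ν k) = E k x := by
    intro k
    change combo D (ν k) x - ord (c.twistFun (ν k)) x = _
    rw [c.twistFun_degree k.2, ord_inv (c.gens.genFun_ne_zero k), divisor_apply c.div]
    ring
  have h3 := congrArg θ (c.eq_sum μ)
  rw [map_add, map_zsmul, map_sum, h1] at h3
  simp_rw [map_zsmul, h2] at h3
  change combo D μ x - ord (c.twistFun μ) x = _ at h3
  simp only [smul_eq_mul] at h3
  linarith

end PlaneCox

end Surface
end DelPezzo

end

/-! ### From the Cox ring to forms on the plane. -/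

noncomputable section

namespace DelPezzo

namespace Surface

open MvPolynomial

variable {K : Type u} [Field K] {S : Surface K} {ρ : S.X ⟶ projSpace K 2}

namespace PlaneCox

variable {ι : Type} [Fintype ι] {t : ℕ} {D : ι → S.Div}
  {e : Fin t → CoxRing D} {ν : Fin t → ι → ℤ} {E : Fin t → S.Div} {I : Finset (Fin t)}
  {L : S.Div}

/-- The factor by which a section of degree `μ` is multiplied to become a form on the plane. -/
def formFactor (c : PlaneCox ρ D e ν E I L) (μ : ι → ℤ) : FractionRing (MvPolynomial (Fin 3) K) :=
  c.model.frac (c.twistFun μ) * algebraMap _ _ c.line ^ c.deg μ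

lemma formFactor_ne_zero (c : PlaneCox ρ D e ν E I L) (μ : ι → ℤ) : c.formFactor μ ≠ 0 :=
  mul_ne_zero (c.model.frac_ne_zero (c.twistFun_ne_zero μ))
    (zpow_ne_zero _ c.algebraMap_line_ne_zero)

lemma formFactor_zero (c : PlaneCox ρ D e ν E I L) : c.formFactor 0 = 1 := by
  simp [formFactor, c.twistFun_zero]

lemma formFactor_add (c : PlaneCox ρ D e ν E I L) (μ μ' : ι → ℤ) :
    c.formFactor (μ + μ') = c.formFactor μ * c.formFactor μ' := by
  rw [formFactor, c.twistFun_add, map_add, zpow_add₀ c.algebraMap_line_ne_zero, map_mul]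
  simp only [formFactor]
  ring

lemma frac_mul_formFactor (c : PlaneCox ρ D e ν E I L) (f : S.FunField) (μ : ι → ℤ) :
    c.model.frac f * c.formFactor μ =
      c.model.frac (f * c.twistFun μ) * algebraMap _ _ c.line ^ c.deg μ := by
  rw [formFactor, map_mul, mul_assoc]

/-- The homomorphism which sends a section to the corresponding form on the plane, on the group
algebra. -/
def formRingHom (c : PlaneCox ρ D e ν E I L) :
    AddMonoidAlgebra S.FunField (ι → ℤ) →+* FractionRing (MvPolynomial (Fin 3) K) :=
  AddMonoidAlgebra.liftNCRingHom c.model.frac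
    { toFun := fun μ => c.formFactor μ.toAdd
      map_one' := c.formFactor_zero
      map_mul' := fun μ μ' => c.formFactor_add μ.toAdd μ'.toAdd } fun _ _ => Commute.all _ _

lemma formRingHom_single (c : PlaneCox ρ D e ν E I L) (μ : ι → ℤ) (f : S.FunField) :
    c.formRingHom (AddMonoidAlgebra.single μ f) = c.model.frac f * c.formFactor μ :=
  AddMonoidAlgebra.liftNC_single _ _ _ _

/-- The homomorphism which sends a section to the corresponding form on the plane. -/
def formHom (c : PlaneCox ρ D e ν E I L) :
    CoxRing D →ₐ[K] FractionRing (MvPolynomial (Fin 3) K) :=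
  { c.formRingHom.comp (CoxRing D).val.toRingHom with
    commutes' := fun a => by
      change c.formRingHom (AddMonoidAlgebra.single 0 (algebraMap K S.FunField a)) = _
      rw [formRingHom_single, c.formFactor_zero, mul_one, c.model.frac_const]
      exact (IsScalarTower.algebraMap_apply K (MvPolynomial (Fin 3) K) _ a).symm }

lemma formHom_apply (c : PlaneCox ρ D e ν E I L) {s : CoxRing D} {μ : ι → ℤ} {f : S.FunField}
    (hs : s.1 = AddMonoidAlgebra.single μ f) : c.formHom s = c.model.frac f * c.formFactor μ := by
  change c.formRingHom s.1 = _
  rw [hs, formRingHom_single]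

/-- Along a plane curve the power of the line accounts for the multiple of `L` in `combo_apply`, and
contracted curves do not contribute. So the form vanishes along the plane curve exactly as the
section does along its strict transform. -/
lemma fracOrd_frac_mul_formFactor (c : PlaneCox ρ D e ν E I L) {f : S.FunField} (hf : f ≠ 0)
    (μ : ι → ℤ) {P : MvPolynomial (Fin 3) K} (hP : Irreducible P) (hom : ∃ n, P.IsHomogeneous n) :
    fracOrd P (c.model.frac f * c.formFactor μ) =
      ord f (c.model.curve hP hom) + combo D μ (c.model.curve hP hom) := by
  have h1 := mul_ne_zero hf (c.twistFun_ne_zero μ)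
  rw [frac_mul_formFactor, fracOrd_mul hP.prime (c.model.frac_ne_zero h1)
    (zpow_ne_zero _ c.algebraMap_line_ne_zero), ← c.model.ord_curve hP hom h1,
    ord_mul hf (c.twistFun_ne_zero μ), fracOrd_zpow hP.prime c.algebraMap_line_ne_zero,
    fracOrd_algebraMap hP.prime c.line_ne_zero, c.combo_apply, c.pullback_line, Finset.sum_eq_zero]
  · ring
  · intro k _
    rw [c.divisor_curve_eq_zero k.2 (isCurve_curve c.model hP hom), mul_zero]

lemma exists_form_of_single (c : PlaneCox ρ D e ν E I L) {s : CoxRing D} {μ : ι → ℤ}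
    {f : S.FunField} (hf : f ≠ 0) (hs : s.1 = AddMonoidAlgebra.single μ f) :
    ∃ (n : ℕ) (G : MvPolynomial (Fin 3) K), (n : ℤ) = c.deg μ ∧ G.IsHomogeneous n ∧ G ≠ 0 ∧
      c.formHom s = algebraMap _ _ G := by
  have hmem : f ∈ H0 (combo D μ) := mem_coxRing_single.mp (hs ▸ s.2)
  obtain ⟨n, G, hn, hG, hG0, h⟩ := c.exists_form (mul_ne_zero hf (c.twistFun_ne_zero μ)) (c.deg μ)
    fun P hP hom => by
      rw [← frac_mul_formFactor, c.fracOrd_frac_mul_formFactor hf μ hP hom]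
      exact hmem hf _
  exact ⟨n, G, hn, hG, hG0, by rw [c.formHom_apply hs, frac_mul_formFactor, h]⟩

lemma exists_genForm (c : PlaneCox ρ D e ν E I L) (k : Fin t) :
    ∃ (n : ℕ) (G : MvPolynomial (Fin 3) K), (n : ℤ) = c.deg (ν k) ∧ G.IsHomogeneous n ∧ G ≠ 0 ∧
      c.formHom (e k) = algebraMap _ _ G :=
  c.exists_form_of_single (c.gens.genFun_ne_zero k) (c.gens.eq_single k)

/-- The degree of the form of a generator. -/
def genDeg (c : PlaneCox ρ D e ν E I L) (k : Fin t) : ℕ := (c.exists_genForm k).choose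

/-- The form on the plane which corresponds to a generator. -/
def genForm (c : PlaneCox ρ D e ν E I L) (k : Fin t) : MvPolynomial (Fin 3) K :=
  (c.exists_genForm k).choose_spec.choose

lemma genDeg_eq (c : PlaneCox ρ D e ν E I L) (k : Fin t) : (c.genDeg k : ℤ) = c.deg (ν k) :=
  (c.exists_genForm k).choose_spec.choose_spec.1

lemma genForm_isHomogeneous (c : PlaneCox ρ D e ν E I L) (k : Fin t) :
    (c.genForm k).IsHomogeneous (c.genDeg k) :=
  (c.exists_genForm k).choose_spec.choose_spec.2.1

lemma genForm_ne_zero (c : PlaneCox ρ D e ν E I L) (k : Fin t) : c.genForm k ≠ 0 :=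
  (c.exists_genForm k).choose_spec.choose_spec.2.2.1

lemma formHom_gen (c : PlaneCox ρ D e ν E I L) (k : Fin t) :
    c.formHom (e k) = algebraMap _ _ (c.genForm k) :=
  (c.exists_genForm k).choose_spec.choose_spec.2.2.2

/-- The basis values of `twist` are the inverses of the sections of the contracted curves; this
normalisation makes `formHom` a dehomogenisation. -/
lemma genForm_eq_one (c : PlaneCox ρ D e ν E I L) {k : Fin t} (hk : k ∈ I) : c.genForm k = 1 := by
  apply IsFractionRing.injective (MvPolynomial (Fin 3) K) (FractionRing (MvPolynomial (Fin 3) K))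
  rw [← c.formHom_gen, c.formHom_apply (c.gens.eq_single k), c.frac_mul_formFactor,
    c.twistFun_degree hk, c.deg_degree hk, mul_inv_cancel₀ (c.gens.genFun_ne_zero k)]
  simp

lemma multiplicity_genForm (c : PlaneCox ρ D e ν E I L) (k : Fin t) {P : MvPolynomial (Fin 3) K}
    (hP : Irreducible P) (hom : ∃ n, P.IsHomogeneous n) :
    (multiplicity P (c.genForm k) : ℤ) = E k (c.model.curve hP hom) := by
  rw [← fracOrd_algebraMap (Q := FractionRing (MvPolynomial (Fin 3) K)) hP.prime
    (c.genForm_ne_zero k), ← c.formHom_gen, c.formHom_apply (c.gens.eq_single k),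
    c.fracOrd_frac_mul_formFactor (c.gens.genFun_ne_zero k), divisor_apply c.div]

lemma formHom_aeval (c : PlaneCox ρ D e ν E I L) (p : MvPolynomial (Fin t) K) :
    c.formHom (aeval e p) = algebraMap _ _ (aeval c.genForm p) := by
  have : c.formHom.comp (aeval e) = (Algebra.algHom K (MvPolynomial (Fin 3) K) _).comp
      (aeval c.genForm) := by
    ext k
    simp only [AlgHom.comp_apply, aeval_X, c.formHom_gen]
    rfl
  exact DFunLike.congr_fun this p

lemma deg_combination (c : PlaneCox ρ D e ν E I L) (n : ℤ) (a : Fin t → ℤ) :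
    c.deg (n • c.lineDeg + ∑ k ∈ I, a k • ν k) = n := by
  rw [map_add, map_smul, c.deg_lineDeg, map_sum, Finset.sum_eq_zero]
  · simp
  · intro k hk
    rw [map_smul, c.deg_degree hk, smul_zero]

lemma mult_combination (c : PlaneCox ρ D e ν E I L) (n : ℤ) (a : Fin t → ℤ) (k : I) :
    c.mult k (n • c.lineDeg + ∑ k ∈ I, a k • ν k) = a k := by
  classical
  have h1 : c.mult k c.lineDeg = 0 := by
    rw [mult, ← c.degBasis_none, Module.Basis.coord_apply, Module.Basis.repr_self,
      Finsupp.single_apply, if_neg (by simp)]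
  have h2 : ∀ j : I, c.mult k (ν j) = if j = k then 1 else 0 := by
    intro j
    rw [mult, ← c.degBasis_some, Module.Basis.coord_apply, Module.Basis.repr_self,
      Finsupp.single_apply]
    simp
  rw [map_add, map_smul, h1, map_sum, ← Finset.sum_coe_sort I]
  simp_rw [map_smul, h2]
  simp

/-- Every form on the plane comes from a section. -/
lemma exists_formHom_eq (c : PlaneCox ρ D e ν E I L) {n : ℕ} {F : MvPolynomial (Fin 3) K}
    (hF : F.IsHomogeneous n) : ∃ s, c.formHom s = algebraMap _ _ F := by
  by_cases hF0 : F = 0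
  · exact ⟨0, by simp [hF0]⟩
  obtain ⟨f, hf⟩ := c.model.exists_frac_eq n F (c.line ^ n) hF
    (by simpa using c.line_hom.pow n) (pow_ne_zero _ c.line_ne_zero)
  have hf0 : f ≠ 0 := by
    rintro rfl
    rw [map_zero, eq_comm, div_eq_zero_iff] at hf
    simp [hF0, c.line_ne_zero] at hf
  -- The coefficients of the contracted curves are chosen so that the section has multiplicity
  -- exactly zero along each of them.
  set μ : ι → ℤ := (n : ℤ) • c.lineDeg +
    ∑ k ∈ I, (-ord f (c.pt k) - n * L (c.pt k)) • ν k with hμ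
  have hcl : ∀ x, ord (f * (c.twistFun μ)⁻¹) x + combo D μ x = ord f x + n * L x +
      ∑ k : I, (-ord f (c.pt k) - n * L (c.pt k)) * E k x := by
    intro x
    rw [c.combo_apply, ord_mul hf0 (inv_ne_zero (c.twistFun_ne_zero μ)),
      ord_inv (c.twistFun_ne_zero μ), hμ, c.deg_combination]
    simp_rw [c.mult_combination]
    ring
  have hdeg : c.deg μ = n := c.deg_combination _ _
  refine ⟨⟨AddMonoidAlgebra.single μ (f * (c.twistFun μ)⁻¹), mem_coxRing_single.mpr fun _ x => ?_⟩,
    ?_⟩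
  · rw [hcl]
    by_cases hx : c.model.IsCurve x
    · obtain ⟨P, hP, hom, rfl⟩ := hx
      rw [c.ord_fun_curve hP hom hF0 hf0 hf, Finset.sum_eq_zero]
      · simp
      · intro k _
        rw [c.divisor_curve_eq_zero k.2 (isCurve_curve c.model hP hom), mul_zero]
    · obtain ⟨k, hk, rfl⟩ := c.eq_pt_of_not_isCurve hx
      have := c.sum_apply_pt (fun k => -ord f (c.pt k) - n * L (c.pt k)) hk
      rw [Finsupp.finsetSum_apply, ← Finset.sum_coe_sort I] at this
      simp only [Finsupp.smul_apply, smul_eq_mul] at this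
      rw [this]
      linarith
  · rw [c.formHom_apply rfl, frac_mul_formFactor, inv_mul_cancel_right₀ (c.twistFun_ne_zero μ), hf,
      hdeg, zpow_natCast, map_pow, div_mul_cancel₀]
    exact pow_ne_zero _ c.algebraMap_line_ne_zero

/-- Each coordinate is the form of a section, and each section is a polynomial in the generators. -/
lemma aeval_genForm_surjective (c : PlaneCox ρ D e ν E I L) :
    Function.Surjective (aeval (R := K) c.genForm) := by
  have hX : ∀ i, MvPolynomial.X i ∈ (aeval (R := K) c.genForm).range := by
    intro i
    obtain ⟨s, hs⟩ := c.exists_formHom_eq (isHomogeneous_X K i)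
    have hmem : s ∈ Algebra.adjoin K (Set.range e) := c.gens.generate ▸ Algebra.mem_top
    rw [Algebra.adjoin_range_eq_range_aeval] at hmem
    obtain ⟨p, rfl⟩ := hmem
    refine ⟨p, IsFractionRing.injective (MvPolynomial (Fin 3) K)
      (FractionRing (MvPolynomial (Fin 3) K)) ?_⟩
    rw [← hs]
    exact (c.formHom_aeval p).symm
  rw [← AlgHom.range_eq_top, eq_top_iff, ← adjoin_range_X]
  refine Algebra.adjoin_le ?_
  rintro _ ⟨i, rfl⟩
  exact hX i

/-- Relations between the forms are relations between the generators, in each degree. -/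
lemma aeval_eq_zero_iff (c : PlaneCox ρ D e ν E I L) {p : MvPolynomial (Fin t) K} {μ : ι → ℤ}
    (hp : IsWeightedHomogeneous ν p μ) : aeval e p = 0 ↔ aeval c.genForm p = 0 := by
  -- The homomorphism `formHom` need not be injective on the whole Cox ring, but in a single degree
  -- it is multiplication by a non-zero factor.
  have hsing : ∃ f, (aeval e p).1 = AddMonoidAlgebra.single μ f := by
    have hmon : ∀ d : Fin t →₀ ℕ, ∃ f,
        (d.prod fun k n => e k ^ n).1 = AddMonoidAlgebra.single (Finsupp.weight ν d) f := by
      intro d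
      induction d using Finsupp.induction_linear with
      | zero => exact ⟨1, by simp; rfl⟩
      | add d d' ih ih' =>
        obtain ⟨f, hf⟩ := ih
        obtain ⟨f', hf'⟩ := ih'
        refine ⟨f * f', ?_⟩
        rw [Finsupp.prod_add_index' (by simp) (fun k => pow_add (e k)), MulMemClass.coe_mul, hf,
          hf', AddMonoidAlgebra.single_mul_single, map_add]
      | single k n =>
        refine ⟨genFun e ν k ^ n, ?_⟩
        rw [Finsupp.prod_single_index (by simp), SubmonoidClass.coe_pow, c.gens.eq_single,
          AddMonoidAlgebra.single_pow, Finsupp.weight_single]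
    choose g hg using hmon
    refine ⟨∑ d ∈ p.support, coeff d p • g d, ?_⟩
    conv_lhs => rw [p.as_sum]
    rw [map_sum, AddSubmonoidClass.coe_finsetSum,
      ← AddMonoidAlgebra.singleAddHom_apply, map_sum]
    refine Finset.sum_congr rfl fun d hd => ?_
    rw [aeval_monomial, ← Algebra.smul_def, SetLike.val_smul, hg, hp (mem_support_iff.mp hd)]
    simp
  obtain ⟨f, hf⟩ := hsing
  have h1 := c.formHom_apply hf
  rw [formHom_aeval] at h1
  rw [← map_eq_zero_iff (algebraMap _ _) (IsFractionRing.injective (MvPolynomial (Fin 3) K)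
      (FractionRing (MvPolynomial (Fin 3) K))), h1, mul_eq_zero, or_iff_left (c.formFactor_ne_zero μ),
      map_eq_zero c.model.frac, ← Subtype.coe_inj, hf]
  simp

end PlaneCox

end Surface
end DelPezzo

end

/-! ### The forms of the generators, and statement (1). -/

noncomputable section

namespace DelPezzo

namespace Surface

open MvPolynomial

variable {K : Type u} [Field K] {S : Surface K} {ρ : S.X ⟶ projSpace K 2}

namespace PlaneCox

variable {ι : Type} [Fintype ι] {t : ℕ} {D : ι → S.Div}
  {e : Fin t → CoxRing D} {ν : Fin t → ι → ℤ} {E : Fin t → S.Div} {I : Finset (Fin t)}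
  {L : S.Div}

/-- The generators which are not contracted correspond to irreducible plane curves. -/
lemma irreducible_genForm (c : PlaneCox ρ D e ν E I L) {j : Fin t} (hj : j ∉ I) :
    ∃ (hG : Irreducible (c.genForm j)), c.pt j = c.model.curve hG ⟨_, c.genForm_isHomogeneous j⟩ := by
  classical
  have hx : c.model.IsCurve (c.pt j) := by
    rw [c.isCurve_iff_ne]
    intro k hk h
    exact hj (c.pt_injective h ▸ hk)
  obtain ⟨P, hP, hom, hPj⟩ := hx
  -- The divisor is a single prime with coefficient one, so `P` divides the form exactly once and no
  -- other irreducible form does; the cofactor must be a unit.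
  have hmul : ∀ {P' : MvPolynomial (Fin 3) K} (_ : Irreducible P') (_ : ∃ n, P'.IsHomogeneous n),
      multiplicity P' (c.genForm j) = if Associated P P' then 1 else 0 := by
    intro P' hP' hom'
    have h := c.multiplicity_genForm j hP' hom'
    rw [c.divisor_eq, Finsupp.single_apply, hPj] at h
    simp_rw [c.curve_eq_iff] at h
    split_ifs at h ⊢ <;> exact_mod_cast h
  have hdvd : P ∣ c.genForm j := by
    rw [← multiplicity_ne_zero, hmul hP hom, if_pos (Associated.refl P)]
    exact one_ne_zero
  obtain ⟨u, hu⟩ := hdvd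
  have hu0 : P * u ≠ 0 := hu ▸ c.genForm_ne_zero j
  have hunit : IsUnit u := by
    by_contra hnu
    obtain ⟨P', hP', hP'u⟩ := WfDvdMonoid.exists_irreducible_factor hnu (right_ne_zero_of_mul hu0)
    have hom' := (c.genForm_isHomogeneous j).of_dvd (c.genForm_ne_zero j)
      (hP'u.trans (hu ▸ dvd_mul_left _ _))
    have h1 := hmul hP' hom'
    rw [hu, multiplicity_mul_of_prime hP'.prime hP.ne_zero (right_ne_zero_of_mul hu0)] at h1
    have h2 : multiplicity P' u ≠ 0 := by
      rw [multiplicity_ne_zero]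
      exact hP'u
    split_ifs at h1 with hass
    · rw [multiplicity_eq_of_associated_left hass, multiplicity_self] at h1
      omega
    · omega
  have hass : Associated P (c.genForm j) := hu ▸ (associated_mul_unit_right P u hunit)
  exact ⟨hass.irreducible hP, hPj.trans (c.model.curve_congr _ _ _ _ hass)⟩

lemma genDeg_pos (c : PlaneCox ρ D e ν E I L) {j : Fin t} (hj : j ∉ I) : 0 < c.genDeg j := by
  obtain ⟨hG, -⟩ := c.irreducible_genForm hj
  by_contra h
  have h0 : c.genDeg j = 0 := by omega
  exact hG.not_isUnit (isUnit_of_isHomogeneous_zero (h0 ▸ c.genForm_isHomogeneous j)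
    (c.genForm_ne_zero j))

/-- Since `ρ` is a closed map, it carries the closure of the generic point of `E j` to the closure
of its image, the generic point of the plane curve. -/
lemma image_supp (c : PlaneCox ρ D e ν E I L) {j : Fin t} (hj : j ∉ I) :
    ρ '' supp (E j) = zeroSet (c.genForm j) := by
  obtain ⟨hG, h⟩ := c.irreducible_genForm hj
  rw [c.supp_divisor, ← c.model.isClosedMap.closure_image_eq_of_continuous ρ.continuous,
    Set.image_singleton, h, c.model.map_curve, closure_curvePoint]

/-- The linear part of a polynomial in the forms of the generators. -/
lemma homogeneousComponent_one_mem (c : PlaneCox ρ D e ν E I L) (p : MvPolynomial (Fin t) K) :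
    homogeneousComponent 1 (aeval c.genForm p) ∈
      Submodule.span K (Set.range fun j : {j // j ∉ I ∧ c.genDeg j = 1} => c.genForm j) := by
  induction p using MvPolynomial.induction_on with
  | C a =>
    have : (C a : MvPolynomial (Fin 3) K).IsHomogeneous 0 := isHomogeneous_C _ a
    rw [aeval_C, algebraMap_eq, homogeneousComponent_of_mem this]
    simp
  | add p q hp hq =>
    rw [map_add, map_add]
    exact add_mem hp hq
  | mul_X p j hp =>
    rw [map_mul, aeval_X]
    by_cases hj : j ∈ I
    · rwa [c.genForm_eq_one hj, mul_one]
    -- Multiplying by a form of positive degree leaves a linear part only if the degree is one, and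
    -- then it is the constant term of `p` times that form.
    · have h1 := c.genDeg_pos hj
      rw [← coeff_gradingHom, map_mul, gradingHom_of_isHomogeneous (c.genForm_isHomogeneous j),
        ← Polynomial.C_mul_X_pow_eq_monomial, ← mul_assoc, Polynomial.coeff_mul_X_pow',
        Polynomial.coeff_mul_C, coeff_gradingHom]
      split_ifs with h
      · have h2 : c.genDeg j = 1 := by omega
        rw [h2, Nat.sub_self, homogeneousComponent_zero, ← smul_eq_C_mul]
        exact Submodule.smul_mem _ _ (Submodule.subset_span ⟨⟨j, hj, h2⟩, rfl⟩)
      · exact zero_mem _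

lemma linear_mem_span (c : PlaneCox ρ D e ν E I L) {F : MvPolynomial (Fin 3) K}
    (hF : F.IsHomogeneous 1) :
    F ∈ Submodule.span K (Set.range fun j : {j // j ∉ I ∧ c.genDeg j = 1} => c.genForm j) := by
  obtain ⟨p, rfl⟩ := c.aeval_genForm_surjective F
  have := c.homogeneousComponent_one_mem p
  rwa [homogeneousComponent_of_mem hF, if_pos rfl] at this

/-- The generator forms of degree one span a space containing the three variables, so they contain
three independent ones. -/
lemma exists_independent (c : PlaneCox ρ D e ν E I L) :
    ∃ j : Fin 3 → Fin t, Function.Injective j ∧ (∀ m, j m ∉ I) ∧ (∀ m, c.genDeg (j m) = 1) ∧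
      LinearIndependent K fun m => c.genForm (j m) := by
  obtain ⟨κ, a, ha, hspan, hli⟩ := exists_linearIndependent' K
    (fun j : {j // j ∉ I ∧ c.genDeg j = 1} => c.genForm j)
  have hfin : Finite κ := Finite.of_injective a ha
  have := Fintype.ofFinite κ
  have hcard : 3 ≤ Fintype.card κ := by
    rw [← finrank_span_eq_card hli, hspan]
    have hX := finrank_span_eq_card (linearIndependent_X (R := K) (σ := Fin 3))
    rw [Fintype.card_fin] at hX
    refine hX.symm.le.trans ?_
    have : Module.Finite K (Submodule.span K (Set.range
        fun j : {j // j ∉ I ∧ c.genDeg j = 1} => c.genForm j)) :=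
      Module.Finite.span_of_finite K (Set.finite_range _)
    refine Submodule.finrank_mono (Submodule.span_le.mpr ?_)
    rintro _ ⟨i, rfl⟩
    exact c.linear_mem_span (isHomogeneous_X K i)
  obtain ⟨b⟩ := Function.Embedding.nonempty_of_card_le (α := Fin 3) (β := κ) (by simpa using hcard)
  exact ⟨fun m => (a (b m)).1, Subtype.val_injective.comp (ha.comp b.injective),
    fun m => (a (b m)).2.1, fun m => (a (b m)).2.2, hli.comp b b.injective⟩

/-- Three of the four curves which are not contracted are mapped to independent lines. -/
lemma exists_coordinates (c : PlaneCox ρ D e ν E I L) (hcard : t = I.card + 4) :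
    ∃ (i : Fin 4 → Fin t) (y : Fin 3 → MvPolynomial (Fin 3) K),
      (I : Set (Fin t)) ∪ Set.range i = Set.univ ∧ IsCoordinates y ∧
        ∀ j : Fin 3, ρ '' supp (E (i j.castSucc)) = zeroSet (y j) := by
  classical
  obtain ⟨j, hinj, hjI, hj1, hli⟩ := c.exists_independent
  have hdisj : Disjoint I (Finset.univ.image j) := by
    rw [Finset.disjoint_right]
    intro k hk
    obtain ⟨m, -, rfl⟩ := Finset.mem_image.mp hk
    exact hjI m
  -- Exactly one index is left besides `I` and the three lines; it serves as `i 3`.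
  have h1 : (I ∪ Finset.univ.image j)ᶜ.card = 1 := by
    rw [Finset.card_compl, Finset.card_union_of_disjoint hdisj, Finset.card_image_of_injective _ hinj]
    simp
    omega
  obtain ⟨l, hl⟩ := Finset.card_eq_one.mp h1
  refine ⟨Fin.snoc j l, fun m => c.genForm (j m), ?_, ⟨fun m => ?_, hli⟩, fun m => ?_⟩
  · rw [Set.eq_univ_iff_forall]
    intro k
    by_cases hk : k ∈ (I ∪ Finset.univ.image j)ᶜ
    · rw [hl, Finset.mem_singleton] at hk
      exact Or.inr ⟨Fin.last 3, by rw [Fin.snoc_last, hk]⟩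
    · rw [Finset.mem_compl, not_not, Finset.mem_union] at hk
      rcases hk with hk | hk
      · exact Or.inl hk
      · obtain ⟨m, -, rfl⟩ := Finset.mem_image.mp hk
        exact Or.inr ⟨m.castSucc, Fin.snoc_castSucc ..⟩
  · rw [← hj1 m]
    exact c.genForm_isHomogeneous (j m)
  · rw [Fin.snoc_castSucc]
    exact c.image_supp (hjI m)

end PlaneCox

end Surface
end DelPezzo

end

/-! ### Coordinates, substitution and homogenisation. -/

noncomputable section

namespace DelPezzo

namespace Surface

open MvPolynomial

variable {K : Type u} [Field K] {S : Surface K} {ρ : S.X ⟶ projSpace K 2}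

/-! ### Coordinates of the plane -/

/-- By dimension, three independent linear forms span all linear forms, so each variable is a linear
combination of them. -/
lemma IsCoordinates.exists_inverse {y : Fin 3 → MvPolynomial (Fin 3) K} (hy : IsCoordinates y) :
    ∃ z : Fin 3 → MvPolynomial (Fin 3) K, IsCoordinates z ∧
      (aeval (R := K) y).comp (aeval z) = AlgHom.id K _ := by
  have hspan : Submodule.span K (Set.range y) = homogeneousSubmodule (Fin 3) K 1 := by
    have hX := finrank_span_eq_card (linearIndependent_X (R := K) (σ := Fin 3))
    rw [homogeneousSubmodule_one_eq_span_X]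
    have : Module.Finite K (Submodule.span K (Set.range
        (MvPolynomial.X : Fin 3 → MvPolynomial (Fin 3) K))) :=
      Module.Finite.span_of_finite K (Set.finite_range _)
    refine Submodule.eq_of_le_of_finrank_eq ?_ ?_
    · rw [← homogeneousSubmodule_one_eq_span_X]
      refine Submodule.span_le.mpr ?_
      rintro _ ⟨j, rfl⟩
      exact hy.1 j
    · rw [hX, finrank_span_eq_card hy.2]
  have hX : ∀ i, ∃ z : MvPolynomial (Fin 3) K, z.IsHomogeneous 1 ∧
      aeval y z = MvPolynomial.X i := by
    intro i
    have : MvPolynomial.X i ∈ Submodule.span K (Set.range y) := hspan ▸ isHomogeneous_X K i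
    obtain ⟨a, ha⟩ := (Submodule.mem_span_range_iff_exists_fun K).mp this
    refine ⟨∑ j, a j • MvPolynomial.X j, ?_, by simp [ha]⟩
    exact (homogeneousSubmodule (Fin 3) K 1).sum_mem fun j _ =>
      Submodule.smul_mem _ _ (isHomogeneous_X K j)
  choose z hz hyz using hX
  refine ⟨z, ⟨hz, ?_⟩, ?_⟩
  · refine LinearIndependent.of_comp (aeval (R := K) y).toLinearMap ?_
    have h : (aeval (R := K) y).toLinearMap ∘ z = MvPolynomial.X := funext hyz
    rw [h]
    exact linearIndependent_X (Fin 3) K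
  · refine MvPolynomial.algHom_ext fun i => ?_
    rw [AlgHom.comp_apply, aeval_X, hyz, AlgHom.id_apply]

/-- The right inverse `z` is again a system of coordinates and so has a right inverse itself; thus
substitution of `z` is bijective, with inverse the substitution of `y`. -/
lemma IsCoordinates.aeval_injective {y : Fin 3 → MvPolynomial (Fin 3) K} (hy : IsCoordinates y) :
    Function.Injective (aeval (R := K) y) := by
  obtain ⟨z, hz, hyz⟩ := hy.exists_inverse
  obtain ⟨w, -, hzw⟩ := hz.exists_inverse
  have h1 : Function.LeftInverse (aeval (R := K) y) (aeval z) := DFunLike.congr_fun hyz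
  have h2 : Function.RightInverse (aeval (R := K) w) (aeval z) := DFunLike.congr_fun hzw
  exact (h1.rightInverse_of_surjective h2.surjective).injective

lemma IsCoordinates.exists_aeval_eq {y : Fin 3 → MvPolynomial (Fin 3) K} (hy : IsCoordinates y)
    {n : ℕ} {F : MvPolynomial (Fin 3) K} (hF : F.IsHomogeneous n) :
    ∃ F' : MvPolynomial (Fin 3) K, F'.IsHomogeneous n ∧ aeval y F' = F := by
  obtain ⟨z, hz, hyz⟩ := hy.exists_inverse
  refine ⟨aeval z F, ?_, DFunLike.congr_fun hyz F⟩
  have := hF.aeval z hz.1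
  rwa [one_mul] at this

lemma IsCoordinates.units_smul {y : Fin 3 → MvPolynomial (Fin 3) K} (hy : IsCoordinates y)
    (t : Fin 3 → Kˣ) : IsCoordinates fun j => t j • y j :=
  ⟨fun j => (homogeneousSubmodule (Fin 3) K 1).smul_mem (t j : K) (hy.1 j), hy.2.units_smul t⟩

lemma exists_smul_eq_of_associated {F G : MvPolynomial (Fin 3) K} (h : Associated F G) :
    ∃ t : Kˣ, t • F = G := by
  obtain ⟨u, rfl⟩ := h
  obtain ⟨r, hr, hu⟩ := isUnit_iff_eq_C_of_isReduced.mp u.isUnit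
  refine ⟨hr.unit, ?_⟩
  rw [hu, Units.smul_def, smul_eq_C_mul, mul_comm]
  rfl

/-- The generic point of `{F = 0}` lies on `{G = 0}`, which means `F ∣ G`, and both are irreducible.
-/
lemma associated_of_zeroSet_eq {F G : MvPolynomial (Fin 3) K} (hF : Irreducible F)
    (hFh : ∃ n, F.IsHomogeneous n) (hG : Irreducible G)
    (h : zeroSet F = zeroSet G) : Associated F G := by
  refine hF.associated_of_dvd hG ?_
  have h1 : curvePoint hF hFh ∈ zeroSet G := by
    rw [← h, ← closure_curvePoint hF hFh]
    exact subset_closure rfl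
  exact (mem_curvePoint hF hFh).mp h1

/-! ### Substitution -/

section Subst

variable {t : ℕ} {i : Fin 4 → Fin t}

lemma substHom_X (hi : Function.Injective i) (j : Fin 4) :
    substHom i (MvPolynomial.X (i j) : MvPolynomial (Fin t) K) = MvPolynomial.X j := by
  have h : ∃ j', i j' = i j := ⟨j, rfl⟩
  rw [substHom, aeval_X, dif_pos h, hi h.choose_spec]

lemma substHom_X_of_notMem {k : Fin t} (hk : k ∉ Set.range i) :
    substHom i (MvPolynomial.X k : MvPolynomial (Fin t) K) = 1 := by
  rw [substHom, aeval_X, dif_neg (show ¬∃ j, i j = k from hk)]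

/-- Modulo `X₃ - R'` every polynomial is a polynomial in the first three variables. -/
lemma sub_dvd_sub_rename (R' : MvPolynomial (Fin 3) K) (F : MvPolynomial (Fin 4) K) :
    MvPolynomial.X 3 - rename Fin.castSucc R' ∣ F - rename Fin.castSucc (aeval (R := K)
      (Fin.snoc (α := fun _ => MvPolynomial (Fin 3) K) MvPolynomial.X R') F) := by
  rw [← Ideal.mem_span_singleton, ← Ideal.Quotient.eq]
  set J := Ideal.span {MvPolynomial.X 3 - rename Fin.castSucc R'} with hJ
  have h : (Ideal.Quotient.mkₐ K J).comp ((rename Fin.castSucc).comp (aeval (R := K)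
      (Fin.snoc (α := fun _ => MvPolynomial (Fin 3) K) MvPolynomial.X R'))) =
        Ideal.Quotient.mkₐ K J := by
    refine MvPolynomial.algHom_ext fun j => ?_
    induction j using Fin.lastCases with
    | last =>
      simp only [AlgHom.comp_apply, aeval_X, Fin.snoc_last]
      refine (Ideal.Quotient.eq.mpr ?_).symm
      exact Ideal.subset_span rfl
    | cast j => simp only [AlgHom.comp_apply, aeval_X, Fin.snoc_castSucc, rename_X]
  exact (DFunLike.congr_fun h F).symm

end Subst

namespace PlaneCox

variable {ι : Type} [Fintype ι] {t : ℕ} {D : ι → S.Div}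
  {e : Fin t → CoxRing D} {ν : Fin t → ι → ℤ} {E : Fin t → S.Div} {I : Finset (Fin t)}
  {L : S.Div} {i : Fin 4 → Fin t}

/-- The complement of `I` has four elements and is covered by the four indices, which leaves room
neither for repetitions nor for elements of `I`. -/
lemma injective_of_union {I : Finset (Fin t)} (hcard : t = I.card + 4)
    (hi : (I : Set (Fin t)) ∪ Set.range i = Set.univ) :
    Function.Injective i ∧ ∀ j, i j ∉ I := by
  classical
  have h1 : Iᶜ ⊆ Finset.univ.image i := by
    intro k hk
    have : k ∈ (I : Set (Fin t)) ∪ Set.range i := hi ▸ Set.mem_univ k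
    rcases this with h | ⟨j, rfl⟩
    · exact absurd h (Finset.mem_compl.mp hk)
    · exact Finset.mem_image_of_mem i (Finset.mem_univ j)
  have h2 : Iᶜ.card = 4 := by
    rw [Finset.card_compl, Fintype.card_fin]
    omega
  have h3 : (Finset.univ.image i).card ≤ 4 := Finset.card_image_le
  have h4 := Finset.eq_of_subset_of_card_le h1 (by omega)
  refine ⟨?_, fun j => ?_⟩
  · rw [← Set.injOn_univ, ← Finset.coe_univ, ← Finset.card_image_iff, ← h4, h2]
    rfl
  · rw [← Finset.mem_compl, h4]
    exact Finset.mem_image_of_mem i (Finset.mem_univ j)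

/-- Evaluation at the generator forms factors through the substitution, because the contracted
generators have form `1`. -/
lemma aeval_substHom (c : PlaneCox ρ D e ν E I L)
    (hi : (I : Set (Fin t)) ∪ Set.range i = Set.univ) (hinj : Function.Injective i)
    (p : MvPolynomial (Fin t) K) :
    aeval (fun j => c.genForm (i j)) (substHom i p) = aeval c.genForm p := by
  have h : (aeval (R := K) fun j => c.genForm (i j)).comp (substHom i) = aeval c.genForm := by
    refine MvPolynomial.algHom_ext fun k => ?_
    rw [AlgHom.comp_apply]
    by_cases hk : k ∈ Set.range i
    · obtain ⟨j, rfl⟩ := hk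
      rw [substHom_X hinj, aeval_X, aeval_X]
    · have hkI : k ∈ I := by
        have : k ∈ (I : Set (Fin t)) ∪ Set.range i := hi ▸ Set.mem_univ k
        exact this.resolve_right hk
      rw [substHom_X_of_notMem hk, map_one, aeval_X, c.genForm_eq_one hkI]
  exact DFunLike.congr_fun h p

/-- Homogenisation with the variables of the contracted curves. -/
lemma exists_homogenization (c : PlaneCox ρ D e ν E I L) (hinj : Function.Injective i)
    (hiI : ∀ j, i j ∉ I) {m : ℕ} {F : MvPolynomial (Fin 4) K}
    (hF : IsWeightedHomogeneous (fun j => c.genDeg (i j)) F m) :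
    ∃ B : Fin t → ℤ, ∀ A : Fin t → ℤ, B ≤ A → ∃ p : MvPolynomial (Fin t) K,
      IsWeightedHomogeneous ν p ((m : ℤ) • c.lineDeg + ∑ k ∈ I, A k • ν k) ∧
        substHom i p = F := by
  classical
  induction hF using IsWeightedHomogeneous.induction_on with
  | zero => exact ⟨0, fun A _ => ⟨0, isWeightedHomogeneous_zero _ _ _, map_zero _⟩⟩
  | add p q hp hq ihp ihq =>
    obtain ⟨B, hB⟩ := ihp
    obtain ⟨B', hB'⟩ := ihq
    -- Different monomials have to be brought to a common degree, which is why every `A` above a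
    -- bound is allowed.
    refine ⟨B ⊔ B', fun A hA => ?_⟩
    obtain ⟨p', hp', rfl⟩ := hB A (le_sup_left.trans hA)
    obtain ⟨q', hq', rfl⟩ := hB' A (le_sup_right.trans hA)
    exact ⟨p' + q', hp'.add hq', map_add _ _ _⟩
  | monomial d r hd =>
    set μ : ι → ℤ := ∑ j, d j • ν (i j) with hμ
    have hdeg : c.deg μ = m := by
      rw [hμ, map_sum, ← hd, Finsupp.weight_apply, Finsupp.sum_fintype _ _ (by simp)]
      push_cast
      refine Finset.sum_congr rfl fun j _ => ?_
      rw [map_nsmul, ← c.genDeg_eq]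
      simp
    -- The variable of the `k`-th contracted curve gets the exponent `A k - mult k μ`, so the
    -- multiplicities of the monomial are the bound that keeps it non-negative.
    refine ⟨fun k => if h : k ∈ I then c.mult ⟨k, h⟩ μ else 0, fun A hA => ?_⟩
    refine ⟨C r * ((∏ j, MvPolynomial.X (i j) ^ d j) *
      ∏ k : I, MvPolynomial.X (k : Fin t) ^ (A k - c.mult k μ).toNat), ?_, ?_⟩
    · refine IsWeightedHomogeneous.C_mul ?_ r
      have h1 : IsWeightedHomogeneous ν (∏ j, (MvPolynomial.X (i j) : MvPolynomial (Fin t) K) ^ d j)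
          μ :=
        IsWeightedHomogeneous.prod _ _ _ fun j _ => (isWeightedHomogeneous_X K ν (i j)).pow (d j)
      have h2 : IsWeightedHomogeneous ν (∏ k : I, (MvPolynomial.X (k : Fin t) :
          MvPolynomial (Fin t) K) ^ (A k - c.mult k μ).toNat)
          (∑ k : I, (A k - c.mult k μ).toNat • ν k) :=
        IsWeightedHomogeneous.prod _ _ _ fun k _ => (isWeightedHomogeneous_X K ν k).pow _
      have h3 : (m : ℤ) • c.lineDeg + ∑ k ∈ I, A k • ν k =
          ((m : ℤ) • c.lineDeg + ∑ k : I, c.mult k μ • ν k) +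
            ∑ k : I, (A k - c.mult k μ).toNat • ν k := by
        rw [add_assoc, ← Finset.sum_add_distrib, ← Finset.sum_coe_sort I]
        congr 1
        refine Finset.sum_congr rfl fun k _ => ?_
        have h4 : c.mult k μ ≤ A k := by
          have := hA k
          simpa using this
        rw [← natCast_zsmul, Int.toNat_of_nonneg (by omega), ← add_smul, add_sub_cancel]
      rw [h3, ← hdeg, ← c.eq_sum μ]
      exact h1.mul h2
    · have h1 : substHom i (∏ j, MvPolynomial.X (i j) ^ d j : MvPolynomial (Fin t) K) =
          ∏ j, MvPolynomial.X j ^ d j := by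
        rw [map_prod]
        refine Finset.prod_congr rfl fun j _ => ?_
        rw [map_pow, substHom_X hinj]
      have h2 : substHom i (∏ k : I, MvPolynomial.X (k : Fin t) ^ (A k - c.mult k μ).toNat :
          MvPolynomial (Fin t) K) = 1 := by
        rw [map_prod]
        refine Finset.prod_eq_one fun k _ => ?_
        rw [map_pow, substHom_X_of_notMem, one_pow]
        rintro ⟨j, hj⟩
        exact hiI j (hj ▸ k.2)
      rw [map_mul, map_mul, h1, h2, mul_one, ← algebraMap_eq, AlgHom.commutes, algebraMap_eq,
        monomial_eq, Finsupp.prod_fintype _ _ (by simp)]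

end PlaneCox

end Surface
end DelPezzo

end

/-! ### The dehomogenised relation. -/

noncomputable section

namespace DelPezzo

namespace Surface

open MvPolynomial

variable {K : Type u} [Field K] {S : Surface K} {ρ : S.X ⟶ projSpace K 2}

lemma isWeightedHomogeneous_rename {σ τ : Type*} {w : τ → ℕ} {φ : σ → τ} (hw : ∀ j, w (φ j) = 1)
    {F : MvPolynomial σ K} {n : ℕ} (hF : F.IsHomogeneous n) :
    IsWeightedHomogeneous w (rename φ F) n := by
  intro d hd
  obtain ⟨u, rfl, hu⟩ := coeff_rename_ne_zero _ _ _ hd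
  rw [← hF hu, Finsupp.weight_apply, Finsupp.weight_apply,
    Finsupp.sum_mapDomain_index (by simp) (by intros; rw [add_smul])]
  simp [hw]

namespace PlaneCox

variable {ι : Type} [Fintype ι] {t : ℕ} {D : ι → S.Div}
  {e : Fin t → CoxRing D} {ν : Fin t → ι → ℤ} {E : Fin t → S.Div} {I : Finset (Fin t)}
  {L : S.Div} {i : Fin 4 → Fin t} {R : MvPolynomial (Fin t) K}

/-- Dehomogenised, the relation generates the ideal of relations between the forms of the
generators which are not contracted. -/
lemma associated_substHom (c : PlaneCox ρ D e ν E I L) (hR : IsSingleRelation e ν R)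
    (hi : (I : Set (Fin t)) ∪ Set.range i = Set.univ) (hinj : Function.Injective i)
    (hiI : ∀ j, i j ∉ I) (hy : IsCoordinates fun j : Fin 3 => c.genForm (i j.castSucc))
    {R' : MvPolynomial (Fin 3) K} (hR' : R'.IsHomogeneous (c.genDeg (i 3)))
    (hRi : aeval (fun j : Fin 3 => c.genForm (i j.castSucc)) R' = c.genForm (i 3)) :
    Associated (MvPolynomial.X 3 - rename Fin.castSucc R') (substHom i R) := by
  have hψ : ∀ F : MvPolynomial (Fin 3) K, aeval (fun j => c.genForm (i j)) (rename Fin.castSucc F) =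
      aeval (fun j : Fin 3 => c.genForm (i j.castSucc)) F := fun F => aeval_rename _ _ _
  have hT : aeval (fun j => c.genForm (i j)) (MvPolynomial.X 3 - rename Fin.castSucc R') = 0 := by
    rw [map_sub, hψ, aeval_X, hRi, sub_self]
  refine associated_of_dvd_dvd ?_ ?_
  -- Modulo `Y₃ - R'` the substituted relation is a polynomial in three variables. It vanishes at
  -- coordinates of the plane, so it is zero.
  · have h1 := sub_dvd_sub_rename R' (substHom i R)
    obtain ⟨G, hG⟩ := h1
    have hR0 : aeval (fun j => c.genForm (i j)) (substHom i R) = 0 := by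
      obtain ⟨δ, hδ⟩ := hR.homogeneous
      rw [c.aeval_substHom hi hinj, ← c.aeval_eq_zero_iff hδ, ← RingHom.mem_ker]
      exact hR.generate ▸ Ideal.mem_span_singleton_self R
    have h2 := congrArg (aeval fun j => c.genForm (i j)) hG
    rw [map_sub, map_mul, hT, hR0, zero_mul, zero_sub, neg_eq_zero, hψ,
      map_eq_zero_iff _ hy.aeval_injective] at h2
    rw [h2, map_zero, sub_zero] at hG
    exact ⟨G, hG⟩
  · have hdeg : ∀ j : Fin 3, c.genDeg (i j.castSucc) = 1 := fun j =>
      (c.genForm_isHomogeneous _).inj_right (hy.1 j) (c.genForm_ne_zero _)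
    have hTw : IsWeightedHomogeneous (fun j => c.genDeg (i j))
        (MvPolynomial.X 3 - rename Fin.castSucc R' : MvPolynomial (Fin 4) K) (c.genDeg (i 3)) :=
      (isWeightedHomogeneous_X K _ 3).sub (isWeightedHomogeneous_rename (φ := Fin.castSucc) hdeg hR')
    -- A homogenisation `p` of `Y₃ - R'` lies in a single degree, so it is a relation between the
    -- generators and a multiple of `R`; substituting `1` recovers `Y₃ - R'`.
    obtain ⟨B, hB⟩ := c.exists_homogenization hinj hiI hTw
    obtain ⟨p, hp, hpT⟩ := hB B le_rfl
    have h0 : aeval e p = 0 := by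
      rw [c.aeval_eq_zero_iff hp, ← c.aeval_substHom hi hinj, hpT, hT]
    rw [← RingHom.mem_ker] at h0
    have h1 : p ∈ Ideal.span {R} := hR.generate ▸ h0
    rw [← hpT]
    exact map_dvd _ (Ideal.mem_span_singleton.mp h1)

/-- Both `y j` and the form of the generator cut out the image of `E (i j)`, hence they differ by a
constant, and this constant is the rescaling. The remaining unit is a constant as well. -/
lemma exists_relation (c : PlaneCox ρ D e ν E I L) (hR : IsSingleRelation e ν R)
    (hcard : t = I.card + 4) {y : Fin 3 → MvPolynomial (Fin 3) K}
    (hi : (I : Set (Fin t)) ∪ Set.range i = Set.univ) (hy : IsCoordinates y)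
    (hρ : ∀ j : Fin 3, ρ '' supp (E (i j.castSucc)) = zeroSet (y j)) :
    ∃ (t : Fin 3 → Kˣ) (R' : MvPolynomial (Fin 3) K) (a : Kˣ),
      R'.IsHomogeneous (c.genDeg (i 3)) ∧
        ρ '' supp (E (i 3)) = zeroSet (aeval (fun j => t j • y j) R') ∧
        substHom i R = a • (MvPolynomial.X 3 - rename Fin.castSucc R') := by
  obtain ⟨hinj, hiI⟩ := injective_of_union hcard hi
  have hass : ∀ j : Fin 3, ∃ a : Kˣ, a • y j = c.genForm (i j.castSucc) := by
    intro j
    obtain ⟨hG, -⟩ := c.irreducible_genForm (hiI j.castSucc)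
    have hyj : Irreducible (y j) := irreducible_of_linear (hy.1 j) (hy.2.ne_zero j)
    refine exists_smul_eq_of_associated (associated_of_zeroSet_eq hyj ⟨1, hy.1 j⟩ hG ?_)
    rw [← hρ, c.image_supp (hiI j.castSucc)]
  choose t ht using hass
  have hcoord := hy.units_smul t
  simp_rw [ht] at hcoord
  obtain ⟨R', hR', hRi⟩ := hcoord.exists_aeval_eq (c.genForm_isHomogeneous (i 3))
  obtain ⟨u, hu⟩ := c.associated_substHom hR hi hinj hiI hcoord hR' hRi
  obtain ⟨r, hr, hur⟩ := isUnit_iff_eq_C_of_isReduced.mp u.isUnit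
  refine ⟨t, R', hr.unit, hR', ?_, ?_⟩
  · simp_rw [ht]
    rw [hRi, c.image_supp (hiI 3)]
  · rw [← hu, hur, Units.smul_def, smul_eq_C_mul, mul_comm]
    rfl

end PlaneCox

end Surface
end DelPezzo

end

/-! ### The common point of two lines, and local intersection multiplicities. -/

noncomputable section

namespace DelPezzo

namespace Surface

open MvPolynomial

variable {K : Type u} [Field K] {S : Surface K} {ρ : S.X ⟶ projSpace K 2}

/-! ### The intersection of two lines -/

lemma exists_decomposition {F : MvPolynomial (Fin 3) K} {n : ℕ} (hF : F.IsHomogeneous n) :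
    ∃ (A B : MvPolynomial (Fin 3) K) (c : K), A.IsHomogeneous n ∧ B.IsHomogeneous n ∧
      MvPolynomial.X 0 ∣ A ∧ MvPolynomial.X 1 ∣ B ∧ F = A + B + C c * MvPolynomial.X 2 ^ n := by
  induction hF using IsWeightedHomogeneous.induction_on with
  | zero => exact ⟨0, 0, 0, isHomogeneous_zero _ _ _, isHomogeneous_zero _ _ _, dvd_zero _,
      dvd_zero _, by simp⟩
  | add p q _ _ hp hq =>
    obtain ⟨A, B, c, hA, hB, hXA, hXB, rfl⟩ := hp
    obtain ⟨A', B', c', hA', hB', hXA', hXB', rfl⟩ := hq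
    refine ⟨A + A', B + B', c + c', hA.add hA', hB.add hB', dvd_add hXA hXA', dvd_add hXB hXB', ?_⟩
    rw [C_add]
    ring
  | monomial d r hd =>
    have hm : (monomial d r).IsHomogeneous n := isWeightedHomogeneous_monomial _ _ _ hd
    have hdvd : ∀ i, d i ≠ 0 → MvPolynomial.X i ∣ monomial d r := by
      intro i hi
      rw [X_dvd_monomial]
      exact Or.inr hi
    by_cases h0 : d 0 = 0
    · by_cases h1 : d 1 = 0
      · refine ⟨0, 0, r, isHomogeneous_zero _ _ _, isHomogeneous_zero _ _ _, dvd_zero _,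
          dvd_zero _, ?_⟩
        have hd2 : d = Finsupp.single 2 n := by
          rw [Finsupp.weight_apply, Finsupp.sum_fintype _ _ (by simp), Fin.sum_univ_three, h0,
            h1] at hd
          ext i
          fin_cases i
          · simpa using h0
          · simpa using h1
          · simpa using hd
        rw [hd2, ← C_mul_X_pow_eq_monomial]
        ring
      · exact ⟨0, monomial d r, 0, isHomogeneous_zero _ _ _, hm, dvd_zero _, hdvd 1 h1, by simp⟩
    · exact ⟨monomial d r, 0, 0, hm, isHomogeneous_zero _ _ _, hdvd 0 h0, dvd_zero _, by simp⟩

lemma IsCoordinates.exists_decomposition {y : Fin 3 → MvPolynomial (Fin 3) K}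
    (hy : IsCoordinates y) {F : MvPolynomial (Fin 3) K} {n : ℕ} (hF : F.IsHomogeneous n) :
    ∃ (A B : MvPolynomial (Fin 3) K) (c : K), A.IsHomogeneous n ∧ B.IsHomogeneous n ∧
      y 0 ∣ A ∧ y 1 ∣ B ∧ F = A + B + C c * y 2 ^ n := by
  obtain ⟨F', hF', rfl⟩ := hy.exists_aeval_eq hF
  obtain ⟨A, B, c, hA, hB, hXA, hXB, rfl⟩ := Surface.exists_decomposition hF'
  refine ⟨aeval y A, aeval y B, c, ?_, ?_, ?_, ?_, ?_⟩
  · simpa using hA.aeval y hy.1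
  · simpa using hB.aeval y hy.1
  · simpa using map_dvd (aeval (R := K) y) hXA
  · simpa using map_dvd (aeval (R := K) y) hXB
  · simp [← algebraMap_eq]

/-- Two lines in the plane meet in exactly one point. -/
lemma IsCoordinates.exists_point {y : Fin 3 → MvPolynomial (Fin 3) K} (hy : IsCoordinates y) :
    ∃ q : projSpace K 2, y 0 ∈ q.asHomogeneousIdeal ∧ y 1 ∈ q.asHomogeneousIdeal ∧
      (∀ p : projSpace K 2, y 0 ∈ p.asHomogeneousIdeal → y 1 ∈ p.asHomogeneousIdeal → p = q) ∧
      ∀ (n : ℕ) (F : MvPolynomial (Fin 3) K), F.IsHomogeneous n → F ∈ q.asHomogeneousIdeal →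
        ∃ A B : MvPolynomial (Fin 3) K, A.IsHomogeneous n ∧ B.IsHomogeneous n ∧
          y 0 ∣ A ∧ y 1 ∣ B ∧ F = A + B := by
  obtain ⟨z, -, hyz⟩ := hy.exists_inverse
  have hzy : ∀ j, aeval z (y j) = MvPolynomial.X j := by
    intro j
    apply hy.aeval_injective
    rw [aeval_X]
    exact DFunLike.congr_fun hyz (y j)
  -- This is the point with coordinates `(0 : 0 : 1)` with respect to `y`, expressed in the standard
  -- coordinates.
  set a : Fin 3 → K := fun i => eval ![0, 0, 1] (z i) with ha
  have hev : ∀ j, eval a (y j) = ![0, 0, 1] j := by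
    intro j
    have h1 : eval a (y j) = eval ![0, 0, 1] (aeval z (y j)) := by
      induction y j using MvPolynomial.induction_on with
      | C r => simp
      | add p q hp hq => simp only [map_add, hp, hq]
      | mul_X p i hp => rw [map_mul, map_mul, map_mul, hp, aeval_X, eval_X]
    rw [h1, hzy, eval_X]
  have ha0 : a ≠ 0 := by
    intro h0
    have h1 := hev 2
    rw [h0, eval_zero, constantCoeff_eq, (hy.1 2).coeff_eq_zero (by simp)] at h1
    simp at h1
  have h0 : y 0 ∈ (ratPoint ha0).asHomogeneousIdeal := (mem_ratPoint ha0 (hy.1 0)).mpr (hev 0)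
  have h1 : y 1 ∈ (ratPoint ha0).asHomogeneousIdeal := (mem_ratPoint ha0 (hy.1 1)).mpr (hev 1)
  have hdec : ∀ (n : ℕ) (F : MvPolynomial (Fin 3) K), F.IsHomogeneous n →
      F ∈ (ratPoint ha0).asHomogeneousIdeal →
        ∃ A B : MvPolynomial (Fin 3) K, A.IsHomogeneous n ∧ B.IsHomogeneous n ∧
          y 0 ∣ A ∧ y 1 ∣ B ∧ F = A + B := by
    intro n F hF hFa
    obtain ⟨A, B, c, hA, hB, ⟨A', hA'⟩, ⟨B', hB'⟩, hABc⟩ := hy.exists_decomposition hF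
    refine ⟨A, B, hA, hB, ⟨A', hA'⟩, ⟨B', hB'⟩, ?_⟩
    have hc := (mem_ratPoint ha0 hF).mp hFa
    rw [hABc, hA', hB'] at hc
    simp only [map_add, map_mul, map_pow, hev, eval_C] at hc
    have hc0 : c = 0 := by simpa using hc
    rw [hABc, hc0, C_0, zero_mul, add_zero]
  refine ⟨ratPoint ha0, h0, h1, fun p hp0 hp1 => ?_, hdec⟩
  have hmem : ∀ {A B : MvPolynomial (Fin 3) K}, y 0 ∣ A → y 1 ∣ B → ∀ {q : projSpace K 2},
      y 0 ∈ q.asHomogeneousIdeal → y 1 ∈ q.asHomogeneousIdeal → A + B ∈ q.asHomogeneousIdeal := by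
    rintro _ _ ⟨A, rfl⟩ ⟨B, rfl⟩ q hq0 hq1
    exact q.asHomogeneousIdeal.toIdeal.add_mem (Ideal.mul_mem_right _ _ hq0)
      (Ideal.mul_mem_right _ _ hq1)
  -- Otherwise all coordinates would vanish at `p`. Consequently a form vanishing at `p` has no term
  -- `y 2 ^ n`.
  have hp2 : y 2 ∉ p.asHomogeneousIdeal := by
    intro hp2
    obtain ⟨i, hi⟩ := exists_X_notMem p
    obtain ⟨A, B, c, -, -, hA, hB, hX⟩ := hy.exists_decomposition (isHomogeneous_X K i)
    apply hi
    rw [hX, pow_one]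
    exact p.asHomogeneousIdeal.toIdeal.add_mem (hmem hA hB hp0 hp1) (Ideal.mul_mem_left _ _ hp2)
  refine Inseparable.eq (Specializes.antisymm (specializes_of_forms fun n F hF hFp => ?_)
    (specializes_of_forms fun n F hF hFa => ?_))
  · obtain ⟨A, B, c, -, -, hA, hB, hABc⟩ := hy.exists_decomposition hF
    have hc0 : c = 0 := by
      by_contra hc
      have h2 : C c * y 2 ^ n ∈ p.asHomogeneousIdeal.toIdeal := by
        rw [← Ideal.add_mem_iff_right _ (hmem hA hB hp0 hp1), ← hABc]
        exact hFp
      have h3 : IsUnit (C c : MvPolynomial (Fin 3) K) := (isUnit_iff_ne_zero.mpr hc).map C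
      rw [Ideal.unit_mul_mem_iff_mem _ h3] at h2
      exact pow_notMem hp2 n h2
    rw [hABc, hc0, C_0, zero_mul, add_zero]
    exact hmem hA hB h0 h1
  · obtain ⟨A, B, -, -, hA, hB, rfl⟩ := hdec n F hF hFa
    exact hmem hA hB hp0 hp1

/-! ### Intersection numbers of strict transforms of lines -/

lemma mem_primeIdealAt {p : S.X} {x : S.PrimeDivisor} (h : x.1 ⤳ p) {n : ℕ} {a b : stdGrading K 2 n}
    (hb : (b : MvPolynomial (Fin 3) K) ∉ (ρ p).asHomogeneousIdeal) :
    pullbackStalk ρ p (HomogeneousLocalization.mk ⟨n, a, b, hb⟩) ∈ primeIdealAt p x h ↔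
      (a : MvPolynomial (Fin 3) K) ∈ (ρ x.1).asHomogeneousIdeal := by
  have hx := notMem_of_specializes (ρ.base.hom.map_specializes h) hb
  rw [primeIdealAt, Ideal.mem_comap, stalkSpecializes_pullbackStalk ρ h a b hb hx,
    IsLocalRing.mem_maximalIdeal, mem_nonunits_iff, isUnit_pullbackStalk_iff, not_not]

/-- The hypothesis expresses transversality: the ideals of the two image curves add up to the ideal
of the point. Since the local rings agree, the quotient is the residue field. -/
lemma length_eq_one {p : S.X} (hbij : Function.Bijective (pullbackStalk ρ p)) {x y : S.PrimeDivisor}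
    (hx : x.1 ⤳ p) (hy : y.1 ⤳ p)
    (h : ∀ (n : ℕ) (F : MvPolynomial (Fin 3) K), F.IsHomogeneous n → F ∈ (ρ p).asHomogeneousIdeal →
      ∃ A B : MvPolynomial (Fin 3) K, A.IsHomogeneous n ∧ B.IsHomogeneous n ∧
        A ∈ (ρ x.1).asHomogeneousIdeal ∧ B ∈ (ρ y.1).asHomogeneousIdeal ∧ F = A + B) :
    Module.length (S.X.presheaf.stalk p)
      (S.X.presheaf.stalk p ⧸ (primeIdealAt p x hx ⊔ primeIdealAt p y hy)) = 1 := by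
  have hmax : primeIdealAt p x hx ⊔ primeIdealAt p y hy =
      IsLocalRing.maximalIdeal (S.X.presheaf.stalk p) := by
    have hle : ∀ (z : S.PrimeDivisor) (hz : z.1 ⤳ p), primeIdealAt p z hz ≤
        IsLocalRing.maximalIdeal (S.X.presheaf.stalk p) := fun z hz =>
      IsLocalRing.le_maximalIdeal (Ideal.IsPrime.ne_top (Ideal.comap_isPrime _ _))
    refine le_antisymm (sup_le (hle x hx) (hle y hy)) fun s hs => ?_
    obtain ⟨s', rfl⟩ := hbij.2 s
    obtain ⟨⟨n, a, b, hb⟩, rfl⟩ := HomogeneousLocalization.mk_surjective s'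
    rw [IsLocalRing.mem_maximalIdeal, mem_nonunits_iff] at hs
    replace hb : (b : MvPolynomial (Fin 3) K) ∉ (ρ p).asHomogeneousIdeal := hb
    obtain ⟨A, B, hA, hB, hAx, hBy, hAB⟩ :=
      h n a a.2 (not_not.mp (mt (isUnit_pullbackStalk_iff hb).mpr hs))
    have hsum : (HomogeneousLocalization.mk ⟨n, a, b, hb⟩ : planeStalk (ρ p)) =
        HomogeneousLocalization.mk ⟨n, ⟨A, hA⟩, b, hb⟩ +
          HomogeneousLocalization.mk ⟨n, ⟨B, hB⟩, b, hb⟩ := by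
      rw [HomogeneousLocalization.ext_iff_val, HomogeneousLocalization.val_add,
        HomogeneousLocalization.val_mk, HomogeneousLocalization.val_mk,
        HomogeneousLocalization.val_mk, Localization.add_mk_self]
      congr 1
    rw [hsum, map_add]
    exact Submodule.add_mem_sup ((mem_primeIdealAt hx hb).mpr hAx) ((mem_primeIdealAt hy hb).mpr hBy)
  rw [hmax, Module.length_eq_one_iff, isSimpleModule_iff_isCoatom]
  exact (IsLocalRing.maximalIdeal.isMaximal _).out

lemma primeInter_eq_zero {x y : S.PrimeDivisor} (h : ∀ p, x.1 ⤳ p → ¬ y.1 ⤳ p) :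
    primeInter x y = 0 := by
  have : IsEmpty {p : S.X // IsClosed {p} ∧ x.1 ⤳ p ∧ y.1 ⤳ p} :=
    ⟨fun p => h p.1 p.2.2.1 p.2.2.2⟩
  exact finsum_of_isEmpty _

lemma primeInter_eq_one {x y : S.PrimeDivisor} {p : S.X} (hp : IsClosed {p}) (hx : x.1 ⤳ p)
    (hy : y.1 ⤳ p) (hu : ∀ q, x.1 ⤳ q → y.1 ⤳ q → q = p)
    (hl : Module.length (S.X.presheaf.stalk p)
      (S.X.presheaf.stalk p ⧸ (primeIdealAt p x hx ⊔ primeIdealAt p y hy)) = 1) :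
    primeInter x y = 1 := by
  rw [primeInter, finsum_eq_single _ (⟨p, hp, hx, hy⟩ :
    {p : S.X // IsClosed {p} ∧ x.1 ⤳ p ∧ y.1 ⤳ p}) fun q hq =>
      absurd (Subtype.ext (hu q.1 q.2.2.1 q.2.2.2)) hq, hl]
  rfl

end Surface
end DelPezzo

end

/-! ### The intersection number with the class of a line. -/

noncomputable section

namespace DelPezzo

namespace Surface

open MvPolynomial

variable {K : Type u} [Field K] {S : Surface K} {ρ : S.X ⟶ projSpace K 2}

/-- Two different lines are part of a system of coordinates. -/
lemma exists_coordinates_of_lines {M N : MvPolynomial (Fin 3) K} (hM : M.IsHomogeneous 1)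
    (hN : N.IsHomogeneous 1) (hM0 : M ≠ 0) (hMN : ¬ M ∣ N) :
    ∃ y : Fin 3 → MvPolynomial (Fin 3) K, IsCoordinates y ∧ y 0 = M ∧ y 1 = N := by
  have h2 : LinearIndependent K ![M, N] := by
    rw [LinearIndependent.pair_iff]
    intro a b hab
    have hb : b = 0 := by
      by_contra hb
      apply hMN
      have h3 : b • N = (-a) • M := by
        rw [neg_smul]
        exact eq_neg_of_add_eq_zero_right hab
      have h4 : N = (b⁻¹ * -a) • M := by
        rw [mul_smul, ← h3, smul_smul, inv_mul_cancel₀ hb, one_smul]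
      rw [h4, smul_eq_C_mul]
      exact dvd_mul_left _ _
    rw [hb, zero_smul, add_zero, smul_eq_zero] at hab
    exact ⟨hab.resolve_right hM0, hb⟩
  obtain ⟨i, hi⟩ : ∃ i : Fin 3, MvPolynomial.X i ∉ Submodule.span K (Set.range ![M, N]) := by
    by_contra! hall
    have h3 : Submodule.span K (Set.range (MvPolynomial.X : Fin 3 → MvPolynomial (Fin 3) K)) ≤
        Submodule.span K (Set.range ![M, N]) :=
      Submodule.span_le.mpr (by rintro _ ⟨i, rfl⟩; exact hall i)
    have : Module.Finite K (Submodule.span K (Set.range ![M, N])) :=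
      Module.Finite.span_of_finite K (Set.finite_range _)
    have h4 := Submodule.finrank_mono h3
    rw [finrank_span_eq_card (linearIndependent_X (Fin 3) K), finrank_span_eq_card h2] at h4
    simp at h4
  refine ⟨Fin.snoc ![M, N] (MvPolynomial.X i), ⟨fun j => ?_, ?_⟩, rfl, rfl⟩
  · induction j using Fin.lastCases with
    | last => simpa using isHomogeneous_X K i
    | cast j =>
      rw [Fin.snoc_castSucc]
      fin_cases j
      · exact hM
      · exact hN
  · exact linearIndependent_finSnoc.mpr ⟨h2, hi⟩

/-- The denominator `z` can be chosen without zero at the generic point of the curve, so only `y`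
contributes to the order. -/
lemma PlaneModel.pullback_curve (m : PlaneModel ρ) {L : S.Div} {y : stdGrading K 2 1} (hy : y ≠ 0)
    (hL : ∀ (x : S.PrimeDivisor) (z : stdGrading K 2 1)
      (hz : ρ x.1 ∉ zeroSet (z : MvPolynomial (Fin 3) K)), L x = ord (pullbackQuot ρ x.1 y z hz) x)
    {P : MvPolynomial (Fin 3) K} (hP : Irreducible P) (hom : ∃ n, P.IsHomogeneous n) :
    L (m.curve hP hom) = multiplicity P (y : MvPolynomial (Fin 3) K) := by
  have hy0 : (y : MvPolynomial (Fin 3) K) ≠ 0 := fun h => hy (Subtype.ext h)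
  obtain ⟨z, hz, hzρ⟩ := exists_linear_notMem_point (ρ (m.curve hP hom).1)
  have h1 := m.frac_pullbackQuot (m.curve hP hom).1 y ⟨z, hz⟩ hzρ
  have hzP : ¬ P ∣ z := by
    rwa [m.map_curve, mem_curvePoint] at hzρ
  have hz0 : z ≠ 0 := by
    rintro rfl
    exact hzP (dvd_zero P)
  have h2 : pullbackQuot ρ (m.curve hP hom).1 y ⟨z, hz⟩ hzρ ≠ 0 := by
    intro h0
    have h3 := ((congrArg m.frac h0).symm.trans h1).symm
    rw [map_zero, div_eq_zero_iff] at h3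
    simp [hy0, hz0] at h3
  refine (hL (m.curve hP hom) ⟨z, hz⟩ hzρ).trans ((m.ord_curve hP hom h2).trans ?_)
  refine (congrArg (fracOrd P) h1).trans ((fracOrd_div hP.prime hy0 hz0).trans ?_)
  rw [multiplicity_eq_zero.mpr hzP]
  simp

namespace PlaneCox

variable {ι : Type} [Fintype ι] {t : ℕ} {D : ι → S.Div}
  {e : Fin t → CoxRing D} {ν : Fin t → ι → ℤ} {E : Fin t → S.Div} {I : Finset (Fin t)}
  {L : S.Div}

/-- A line which avoids the images of the contracted curves is pulled back to its strict
transform. -/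
lemma cl_eq_of_avoid (c : PlaneCox ρ D e ν E I L) (hL : IsPullbackOfLine ρ L)
    {M : MvPolynomial (Fin 3) K} (hM : M.IsHomogeneous 1) (hMi : Irreducible M)
    (havoid : ∀ k ∈ I, ∀ x ∈ supp (E k), M ∉ (ρ x).asHomogeneousIdeal) :
    cl L = cl (Finsupp.single (c.model.curve hMi ⟨1, hM⟩) 1 : S.Div) := by
  classical
  obtain ⟨y, hy, hLy⟩ := hL
  have hy0 : (y : MvPolynomial (Fin 3) K) ≠ 0 := fun h => hy (Subtype.ext h)
  have hMx : M ∈ (ρ (c.model.curve hMi ⟨1, hM⟩).1).asHomogeneousIdeal := by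
    rw [c.model.map_curve, mem_curvePoint]
  obtain ⟨f, hf⟩ := c.model.exists_frac_eq 1 M y hM y.2 hy0
  have hf0 : f ≠ 0 := by
    rintro rfl
    rw [map_zero, eq_comm, div_eq_zero_iff] at hf
    simp [hMi.ne_zero, hy0] at hf
  refine cl_eq_iff.mpr ⟨f, hf0, fun x => ?_⟩
  -- Where `M` vanishes, `x` is not contracted and must be the strict transform of `M`. Elsewhere
  -- `M` itself is an admissible denominator, and the local equation `y / M` of `L` is `f⁻¹`.
  by_cases hx : M ∈ (ρ x.1).asHomogeneousIdeal
  · have hcurve : c.model.IsCurve x := by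
      rw [c.isCurve_iff]
      exact fun k hk hxk => havoid k hk _ hxk hx
    obtain ⟨P, hP, hom, rfl⟩ := hcurve
    rw [c.model.map_curve, mem_curvePoint] at hx
    have hass := hP.associated_of_dvd hMi hx
    rw [Finsupp.single_apply, if_pos ((c.curve_eq_iff _ _ _ _).mpr hass.symm),
      c.model.pullback_curve hy hLy, c.model.ord_curve hP hom hf0, hf,
      fracOrd_div hP.prime hMi.ne_zero hy0, multiplicity_eq_of_associated_right hass.symm,
      multiplicity_self]
    push_cast
    ring
  · have h1 := hLy x ⟨M, hM⟩ hx
    have h2 : pullbackQuot ρ x.1 y ⟨M, hM⟩ hx = f⁻¹ := by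
      apply c.model.frac.injective
      rw [map_inv₀, hf, inv_div]
      exact c.model.frac_pullbackQuot x.1 y ⟨M, hM⟩ hx
    rw [h1, h2, ord_inv hf0, Finsupp.single_apply, if_neg, neg_add_cancel]
    rintro rfl
    exact hx hMx

/-- The class of `L` is represented by the strict transforms of two different lines `M` and `N`
which avoid the contracted points. Then `E j` is equivalent to `genDeg j` times the transform of `N`
plus contracted curves; the latter are disjoint from the transform of `M`, and the two transforms
meet transversally in one point. -/
lemma hasInter [IsAlgClosed K] (c : PlaneCox ρ D e ν E I L) (hρ : IsContraction ρ (E '' I))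
    (hL : IsPullbackOfLine ρ L) (j : Fin t) : HasInter (E j) L (c.genDeg j) := by
  classical
  have hinf : Infinite K := IsAlgClosed.instInfinite
  obtain ⟨U, hiso, hU, hη, -, -⟩ := hρ.exists_opens
  have hU' : ∀ x, (∀ k ∈ I, x ∉ supp (E k)) → ρ x ∈ U := by
    intro x hx
    rw [hU]
    simpa using hx
  have hfin : (⋃ k ∈ I, ρ '' supp (E k)).Finite := by
    refine Set.Finite.biUnion I.finite_toSet fun k hk => ?_
    obtain ⟨p, -, hp⟩ := hρ.2.1 (E k) ⟨k, hk, rfl⟩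
    rw [hp]
    exact Set.finite_singleton p
  have hex : ∀ q : projSpace K 2, ∃ M : MvPolynomial (Fin 3) K, M.IsHomogeneous 1 ∧
      M ∉ q.asHomogeneousIdeal ∧ ∀ k ∈ I, ∀ x ∈ supp (E k), M ∉ (ρ x).asHomogeneousIdeal := by
    intro q
    obtain ⟨M, hM, hMs⟩ := exists_linear_notMem (hfin.insert q)
    refine ⟨M, hM, hMs q (Set.mem_insert _ _), fun k hk x hx => hMs _ (Set.mem_insert_of_mem _ ?_)⟩
    simp only [Set.mem_iUnion]
    exact ⟨k, hk, x, hx, rfl⟩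
  have hne : ∀ (M : MvPolynomial (Fin 3) K) (q : projSpace K 2), M ∉ q.asHomogeneousIdeal →
      M ≠ 0 := by
    rintro _ q hq rfl
    exact hq (zero_mem q.asHomogeneousIdeal.toIdeal)
  -- Avoiding the generic point of the plane only says `M ≠ 0`; below, avoiding the generic point of
  -- `{M = 0}` makes `N` a different line.
  obtain ⟨M, hM, hMq, hMa⟩ := hex planeGeneric
  have hM0 := hne M _ hMq
  have hMi := irreducible_of_linear hM hM0
  obtain ⟨N, hN, hNq, hNa⟩ := hex (curvePoint hMi ⟨1, hM⟩)
  have hNi := irreducible_of_linear hN (hne N _ hNq)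
  rw [mem_curvePoint] at hNq
  obtain ⟨y, hy, hyM, hyN⟩ := exists_coordinates_of_lines hM hN hM0 hNq
  obtain ⟨q, hq0, hq1, hqu, hqd⟩ := hy.exists_point
  rw [hyM] at hq0 hqu hqd
  rw [hyN] at hq1 hqu hqd
  set xM := c.model.curve hMi ⟨1, hM⟩ with hxM
  set xN := c.model.curve hNi ⟨1, hN⟩ with hxN
  have hMN : xN ≠ xM := by
    rw [hxM, hxN, Ne, c.curve_eq_iff]
    exact fun h => hNq h.symm.dvd
  have hmem : ∀ {P : MvPolynomial (Fin 3) K} (hP : Irreducible P) (hom : ∃ n, P.IsHomogeneous n)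
      (p : S.X), (c.model.curve hP hom).1 ⤳ p → P ∈ (ρ p).asHomogeneousIdeal := by
    intro P hP hom p h
    have h1 := ρ.base.hom.map_specializes h
    refine specializes_iff.mp h1 P ?_
    change P ∈ (ρ (c.model.curve hP hom).1).asHomogeneousIdeal
    rw [c.model.map_curve, mem_curvePoint]
  -- The common point of the two lines is not the image of a point on a contracted curve, since `M`
  -- vanishes at it; so `ρ` is an isomorphism near it.
  have hqU : q ∈ U := by
    obtain ⟨x, rfl⟩ : q ∈ Set.range ρ :=
      (planeGeneric_specializes q).mem_closed c.model.isClosedMap.isClosed_range ⟨_, hη⟩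
    exact hU' x fun k hk hx => hMa k hk x hx hq0
  obtain ⟨p, rfl⟩ := exists_of_mem (ρ := ρ) U hqU
  have hsp : ∀ {P : MvPolynomial (Fin 3) K} (hP : Irreducible P) (hom : ∃ n, P.IsHomogeneous n),
      P ∈ (ρ p).asHomogeneousIdeal → (c.model.curve hP hom).1 ⤳ p := by
    intro P hP hom hPp
    refine specializes_of_isIso U (hU' _ ?_) hqU ?_
    · exact (c.isCurve_iff _).mp (isCurve_curve c.model hP hom)
    · rw [c.model.map_curve, specializes_iff]
      intro F hF
      obtain ⟨G, rfl⟩ := (mem_curvePoint hP hom).mp hF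
      exact Ideal.mul_mem_right G (ρ p).asHomogeneousIdeal.toIdeal hPp
  have hp : ∀ p', M ∈ (ρ p').asHomogeneousIdeal → N ∈ (ρ p').asHomogeneousIdeal → p' = p :=
    fun p' h h' => (injOn_of_isIso U hqU (hqu _ h h').symm).symm
  have hMN1 : primeInter xN xM = 1 := by
    have hpcl : IsClosed {p} := by
      refine isClosed_of_closure_subset fun p' hp' => ?_
      have h := ρ.base.hom.map_specializes (specializes_iff_mem_closure.mpr hp')
      exact hp p' (specializes_iff.mp h M hq0) (specializes_iff.mp h N hq1)
    refine primeInter_eq_one hpcl (hsp _ _ hq1) (hsp _ _ hq0)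
      (fun p' h h' => hp p' (hmem _ _ _ h') (hmem _ _ _ h))
      (length_eq_one (pullbackStalk_bijective U hqU) _ _ fun n F hF hFp => ?_)
    obtain ⟨A, B, hA, hB, hMA, hNB, rfl⟩ := hqd n F hF hFp
    refine ⟨B, A, hB, hA, ?_, ?_, add_comm _ _⟩
    · rw [hxN, c.model.map_curve, mem_curvePoint]
      exact hNB
    · rw [hxM, c.model.map_curve, mem_curvePoint]
      exact hMA
  have hk0 : ∀ k ∈ I, primeInter (c.pt k) xM = 0 := by
    intro k hk
    refine primeInter_eq_zero fun p' h h' => hMa k hk p' ?_ (hmem _ _ _ h')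
    rw [c.supp_divisor, ← specializes_iff_mem_closure]
    exact h
  have hkM : ∀ k ∈ I, c.pt k ≠ xM := fun k hk h =>
    (c.isCurve_iff_ne xM).mp (isCurve_curve c.model _ _) k hk h.symm
  set a : Fin t → ℤ := fun k => if h : k ∈ I then c.mult ⟨k, h⟩ (ν j) else 0 with ha
  refine ⟨(c.genDeg j : ℤ) • Finsupp.single xN 1 + ∑ k ∈ I, a k • E k, Finsupp.single xM 1, ?_,
    (c.cl_eq_of_avoid hL hM hMi hMa).symm, ?_, ?_⟩
  · rw [c.gens.cl_divisor c.div, cl_add, cl_zsmul, ← c.cl_eq_of_avoid hL hN hNi hNa, ← cl_zsmul,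
      ← cl_add, ← c.cl_combo_degrees, c.genDeg_eq]
    congr 2
    conv_rhs => rw [c.eq_sum (ν j)]
    rw [← Finset.sum_coe_sort I]
    simp [ha]
  · rw [Finset.disjoint_right]
    intro x hx
    rw [Finsupp.mem_support_single] at hx
    rw [hx.1, Finsupp.notMem_support_iff, Finsupp.add_apply,
      c.sum_apply_curve _ (isCurve_curve c.model _ _)]
    simp [hMN]
  -- With the single prime `xM` as second argument the intersection sum is additive in the first, so
  -- it can be evaluated term by term.
  · have hsum : ∀ A : S.Div, (A.sum fun x a => (Finsupp.single xM (1 : ℤ)).sum fun y b =>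
        a * b * (primeInter x y : ℤ)) = Finsupp.liftAddHom
          (fun x => (AddMonoidHom.mulRight (primeInter x xM : ℤ))) A := by
      intro A
      rw [Finsupp.liftAddHom_apply]
      refine Finsupp.sum_congr fun x _ => ?_
      rw [Finsupp.sum_single_index (by simp)]
      simp
    rw [hsum, map_add, map_zsmul, map_sum, Finset.sum_eq_zero]
    · simp [hMN1]
    · intro k hk
      rw [map_zsmul, c.divisor_eq]
      simp [hk0 k hk]

end PlaneCox

end Surface
end DelPezzo

end

noncomputable section

namespace DelPezzo

namespace Surface

open MvPolynomial

variable {K : Type u} [Field K] {S : Surface K} {ρ : S.X ⟶ projSpace K 2}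

lemma exists_planeCox [IsAlgClosed K] {ι : Type} [Fintype ι] {t : ℕ} {D : ι → S.Div}
    {e : Fin t → CoxRing D} {ν : Fin t → ι → ℤ} {E : Fin t → S.Div} {I : Finset (Fin t)}
    {L : S.Div} (hD : IsPicBasis D) (he : IsMinimalGenerators e ν)
    (hE : ∀ k, IsDivisorOf (e k) (ν k) (E k)) (hρ : IsContraction ρ (E '' I))
    (hL : IsPullbackOfLine ρ L) : Nonempty (PlaneCox ρ D e ν E I L) := by
  obtain ⟨m, hm⟩ := hρ.exists_planeModel
  obtain ⟨y, hy, hLy⟩ := hL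
  exact ⟨{
    model := m
    basis := hD
    gens := he
    div := hE
    isCurve_iff := fun x => by rw [hm]; simp
    line := y
    line_hom := y.2
    line_ne_zero := fun h => hy (Subtype.ext h)
    pullback_line := fun hP hom => m.pullback_curve hy hLy hP hom }⟩

end Surface
end DelPezzo

end

open DelPezzo DelPezzo.Surface in
theorem lemma2p8 {K : Type u} [Field K] [IsAlgClosed K] [CharZero K]
    (S : Surface K) (d : ℕ) (hd : d ≤ 7) (hS : S.IsGeneralizedDelPezzo d)
    (D : Fin (10 - d) → S.Div) (hD : IsPicBasis D)
    (e : Fin (13 - d) → CoxRing D) (ν : Fin (13 - d) → Fin (10 - d) → ℤ)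
    (he : IsMinimalGenerators e ν)
    (R : MvPolynomial (Fin (13 - d)) K) (hR : IsSingleRelation e ν R)
    (E : Fin (13 - d) → S.Div) (hE : ∀ k, IsDivisorOf (e k) (ν k) (E k))
    (I : Finset (Fin (13 - d))) (hI : I.card = 9 - d)
    (ρ : S.X ⟶ projSpace K 2) (hρ : IsContraction ρ (E '' I))
    (L : S.Div) (hL : IsPullbackOfLine ρ L) :
    (∃ (i : Fin 4 → Fin (13 - d)) (y : Fin 3 → MvPolynomial (Fin 3) K),
      (I : Set (Fin (13 - d))) ∪ Set.range i = Set.univ ∧ IsCoordinates y ∧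
        ∀ j : Fin 3, ρ '' supp (E (i j.castSucc)) = zeroSet (y j)) ∧
    ∀ (i : Fin 4 → Fin (13 - d)) (y : Fin 3 → MvPolynomial (Fin 3) K),
      (I : Set (Fin (13 - d))) ∪ Set.range i = Set.univ → IsCoordinates y →
      (∀ j : Fin 3, ρ '' supp (E (i j.castSucc)) = zeroSet (y j)) →
      ∃ (t : Fin 3 → Kˣ) (n : ℕ) (R' : MvPolynomial (Fin 3) K) (c : Kˣ),
        HasInter (E (i 3)) L n ∧ R'.IsHomogeneous n ∧
        ρ '' supp (E (i 3)) = zeroSet (MvPolynomial.aeval (fun j => t j • y j) R') ∧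
        substHom i R =
          c • (MvPolynomial.X 3 - MvPolynomial.rename Fin.castSucc R') := by
  -- The subtractions are truncated; `d ≤ 7` makes `13 - d` equal to `(9 - d) + 4`.
  have hcard : 13 - d = I.card + 4 := by omega
  obtain ⟨p⟩ := exists_planeCox hD he hE hρ hL
  refine ⟨p.exists_coordinates hcard, fun i y hi hy hiy => ?_⟩
  obtain ⟨t, R', c, hR', hzero, hsubst⟩ := p.exists_relation hR hcard hi hy hiy
  exact ⟨t, p.genDeg (i 3), R', c, p.hasInter hρ hL (i 3), hR', hzero, hsubst⟩
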